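/- Throughout, a polygon \(P\) is a simple polygon in the plane with \(|P|\ge 3\) vertices, no three of them collinear. A diagonal of \(P\) is a segment joining two distinct non-consecutive vertices of \(P\) that lies, apart from its end-points, in the interior of \(P\); \(M_d(P)\) is the set of diagonals of \(P\), and \(M_d=M_d(P)\). Two segments are non-crossing if they have no common point in their relative interiors. For a finite set \(M\) of segments, let \(NC[M]\) be the family of all subsets of \(M\) (including \(\varnothing\)) whose segments are pairwise non-crossing, let \(f_i(M)\) be the number of \(J\in NC[M]\) with \(\#J=i\), and let \(\chi(M)=\sum_{i\ge 0}(-1)^i f_i(M)\). Every \(I\in NC[M_d]\) divides \(P\) into sub-polygons, whose interiors are the connected components of the interior of \(P\) with the segments of \(I\) removed. For \(M\subseteq M_d\), let \(NC_c[M]\) be the family of those \(I\in NC[M]\) for which all these sub-polygons are convex, and let \(NC_{nc}[M]=NC[M]\setminus NC_c[M]\). **Theorem.** Let \(P\) be a polygon and \(J\in NC[M_d]\). Then \[\chi(M_d\setminus J)=(-1)^{|P|+1}\sum_{I\in NC_c[J]}(-1)^{\#I}.\] (1) If \(J\in NC_{nc}[M_d]\), then \(\chi(M_d\setminus J)=0\).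 (2) Let \(J\in NC_c[M_d]\). (a) If \(NC_c[J]\) has a unique element \(J'\) that is minimal with respect to inclusion, then \(\chi(M_d\setminus J)=0\) if \(J'\ne J\), and \(\chi(M_d\setminus J)=(-1)^{|P|+1+\#J}\) if \(J'=J\). (b) If \(J\) is not the union of all the inclusion-minimal elements of \(NC_c[J]\), then \(\chi(M_d\setminus J)=0\). (c) If \(J'\subseteq\bigcap_{I\in NC_c[J]}I\), then \(J'\) divides \(P\) into \(m=\#J'+1\) sub-polygons \(P^1,\dots,P^m\), and \(\chi(M_d\setminus J)=\prod_{k=1}^m\chi(M_d(P^k)\setminus J)\). (3) For every \(l\in\mathbb Z\) there exist a polygon \(P\) and \(J\in NC[M_d(P)]\) such that \(\chi(M_d(P)\setminus J)=l\). -/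

import Mathlib

/-- The Euclidean plane. -/
abbrev Plane : Type := EuclideanSpace ℝ (Fin 2)

/-- A line segment, given by the unordered pair of its end-points. -/
abbrev Seg : Type := Sym2 Plane

namespace Seg

/-- The closed segment with the given end-points, as a set of points. -/
def carrier (s : Seg) : Set Plane :=
  Sym2.lift ⟨fun a b => segment ℝ a b, fun a b => segment_symm ℝ a b⟩ s

/-- The segment without its end-points, as a set of points. -/
def relInterior (s : Seg) : Set Plane :=
  Sym2.lift ⟨fun a b => openSegment ℝ a b, fun a b => openSegment_symm ℝ a b⟩ s

/-- Two segments are non-crossing if their relative interiors are disjoint (they may share an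
end-point). -/
def NonCrossing (s t : Seg) : Prop := Disjoint s.relInterior t.relInterior

open Classical in
/-- `NC M`: the sets of pairwise non-crossing segments of `M` (the empty set included). -/
noncomputable def NC (M : Finset Seg) : Finset (Finset Seg) :=
  M.powerset.filter fun J => (J : Set Seg).Pairwise NonCrossing

/-- `f i M`: the number of sets of `i` pairwise non-crossing segments of `M`. -/
noncomputable def f (i : ℕ) (M : Finset Seg) : ℕ := ((NC M).filter fun J => J.card = i).card

/-- The Euler characteristic `∑ i, (-1) ^ i * f i M`; the terms with `i > #M` vanish. -/
noncomputable def χ (M : Finset Seg) : ℤ :=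
  ∑ i ∈ Finset.range (M.card + 1), (-1) ^ i * (f i M : ℤ)

end Seg

/-- A simple polygon in the plane whose vertices are in general position. -/
structure SimplePolygon where
  /-- the number of vertices -/
  n : ℕ
  three_le : 3 ≤ n
  /-- the cyclic sequence of vertices; the `i`-th edge joins vertex `i` to vertex `i + 1` mod `n` -/
  toPolygon : Polygon Plane n
  injective : Function.Injective toPolygon.vertices
  /-- no three vertices are collinear -/
  general_position : ∀ i j k : Fin n, i ≠ j → j ≠ k → i ≠ k →
    ¬ Collinear ℝ {toPolygon i, toPolygon j, toPolygon k}
  /-- two distinct edges meet at most in a common vertex of two consecutive edges -/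
  simple : ∀ i j : Fin n, i ≠ j → ∀ x, x ∈ toPolygon.edgeSet ℝ i → x ∈ toPolygon.edgeSet ℝ j →
    (finRotate n i = j ∧ x = toPolygon j) ∨ (finRotate n j = i ∧ x = toPolygon i)

namespace SimplePolygon

open Seg

/-- The polygon as a closed curve: the union of its edges. -/
def curve (P : SimplePolygon) : Set Plane := P.toPolygon.boundary ℝ

/-- The edges of the polygon, as segments. -/
noncomputable def edges (P : SimplePolygon) : Set Seg :=
  Set.range fun i : Fin P.n => s(P.toPolygon i, P.toPolygon (finRotate P.n i))

/-- The interior of the polygon: the points off the curve that lie in a bounded connected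
component of the complement of the curve. -/
def inside (P : SimplePolygon) : Set Plane :=
  {x | x ∈ P.curveᶜ ∧ Bornology.IsBounded (connectedComponentIn P.curveᶜ x)}

/-- The segment joining the vertices `i` and `j` is a chord: its end-points are distinct and
not consecutive. -/
def IsChord (P : SimplePolygon) (i j : Fin P.n) : Prop :=
  i ≠ j ∧ finRotate P.n i ≠ j ∧ finRotate P.n j ≠ i

/-- A diagonal is a chord that lies in the interior of `P` (apart from its end-points). -/
def IsDiagonal (P : SimplePolygon) (i j : Fin P.n) : Prop :=
  P.IsChord i j ∧ relInterior s(P.toPolygon i, P.toPolygon j) ⊆ P.inside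

open Classical in
/-- `M_d(P)`: the set of diagonals of `P`. -/
noncomputable def diagonals (P : SimplePolygon) : Finset Seg :=
  (Finset.univ.filter fun p : Fin P.n × Fin P.n => P.IsDiagonal p.1 p.2).image
    fun p => s(P.toPolygon p.1, P.toPolygon p.2)

/-- The regions into which the segments of `I` divide the interior of `P`: the connected
components of what remains of the interior when these segments are removed. -/
def pieces (P : SimplePolygon) (I : Finset Seg) : Set (Set Plane) :=
  {U | ∃ x ∈ P.inside \ ⋃ s ∈ I, carrier s,
    U = connectedComponentIn (P.inside \ ⋃ s ∈ I, carrier s) x}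

/-- `I` provides a convex partition of `P`: all regions are convex. -/
def IsConvexPartition (P : SimplePolygon) (I : Finset Seg) : Prop :=
  ∀ U ∈ P.pieces I, Convex ℝ U

open Classical in
/-- `NC_c[M]`: the sets of pairwise non-crossing segments of `M` that provide a convex partition
of `P`. -/
noncomputable def NCc (P : SimplePolygon) (M : Finset Seg) : Finset (Finset Seg) :=
  (NC M).filter fun I => P.IsConvexPartition I

open Classical in
/-- `NC_nc[M] = NC[M] \ NC_c[M]`. -/
noncomputable def NCnc (P : SimplePolygon) (M : Finset Seg) : Finset (Finset Seg) :=
  NC M \ P.NCc M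

open Classical in
/-- The minimal sets (with respect to inclusion) in `NC_c[M]`. -/
noncomputable def minimalNCc (P : SimplePolygon) (M : Finset Seg) : Finset (Finset Seg) :=
  (P.NCc M).filter fun I => Minimal (fun K => K ∈ P.NCc M) I

/-- `Q 0, …, Q (m - 1)` are the sub-polygons into which `I` divides `P`: their edges are edges
of `P` or segments of `I`, and their interiors are the regions into which `I` divides the
interior of `P`, each region occurring exactly once. -/
def IsDivision (P : SimplePolygon) (I : Finset Seg) {m : ℕ} (Q : Fin m → SimplePolygon) : Prop :=
  (∀ k, (Q k).edges ⊆ P.edges ∪ (I : Set Seg)) ∧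
    Set.BijOn (fun k => (Q k).inside) Set.univ (P.pieces I)

end SimplePolygon

/-!
The main formula is proved by a recursion on `J`. Removing a diagonal `d` from `J` adds `d` to the
set `P.diagonals \ J`, and the non-crossing sets that contain `d` are pairs of non-crossing sets
of the two polygons `Q` and `R` into which `d` cuts `P`. So the left-hand side drops by the
product of the left-hand sides for `Q` and `R` (`SimplePolygon.IsSplit.χ_erase`), and so does the
right-hand side, because a convex partition that contains `d` is a pair of convex partitions of
`Q` and `R` (`SimplePolygon.IsSplit.convexSum_erase`). By induction on the number of vertices, the
difference of the two sides does not depend on `J`, and it is enough to find one `J` for which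
both sides vanish, unless `P` is a triangle, where both sides are `1`. This `J` is the set of all
diagonals from the tip `v` of an ear. On the left, the
diagonal that cuts off the ear crosses only diagonals from `v`, so the complex of non-crossing
sets is a cone (`SimplePolygon.IsSplit.χ_sdiff_diagonalsAt`). On the right, the diagonal from `v`
to the vertex that is farthest beyond the ear can be added to and removed from every convex
partition (`SimplePolygon.IsSplit.convexSum_diagonalsAt`).

The geometry behind this rests on winding numbers, defined as sums of the angles at which the
edges are seen. They are integers, vanish outside, and jump by one across an edge. Since the curve
is connected and has two sides near each of its points, each component of the complement
accumulates at the whole curve. Hence there is only one bounded component, which lies on one side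
of each edge (`SimplePolygon.exists_sides`). That a diagonal cuts the polygon into two follows
from the additivity of winding numbers (`SimplePolygon.exists_isSplit_arc`), and diagonals and
ears are found at an extreme vertex (`SimplePolygon.exists_diagonal_of_extreme`,
`SimplePolygon.exists_ear`). Convexity is a local condition: a non-crossing set of diagonals
provides a convex partition if and only if no vertex is the center of a half-disc in the remaining
region (`SimplePolygon.isConvexPartition_iff`). In particular the convex partitions are closed
under adding diagonals.

In view of the formula, the criteria for the vanishing of `χ` are about alternating sums over an
upward closed family of subsets of `J`; such a sum is `0` if some diagonal can be added and
removed freely (`SimplePolygon.convexSum_eq_zero_of_forall_notMem`). The product formula holds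
because, by the recursion, `χ` is multiplicative along a diagonal that belongs to all convex
partitions within `J` (`SimplePolygon.IsSplit.χ_sdiff_eq_mul`).

To realize all integers, consider a zigzag polygon whose reflex vertices lie on a parabola. A set
of chords between the reflex vertices provides a convex partition if and only if it covers all of
them (`SimplePolygon.isConvexPartition_image_reflexChord`), and the alternating sum over the edge
covers of a graph is, up to sign, the one over its independent sets (`sum_edgeCovers_eq`). For a
chain of triangles joined by edges, the latter takes the values `± (k + 1)` and `± k` for `3 * k`
and `3 * k + 1` vertices (`independentSum_three_mul`), with signs that lead to all integers.
-/

section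

open Set Filter Topology Seg

/-! ### The determinant and the viewing angle of a segment -/

namespace Plane

theorem ext_coord {x y : Plane} (h0 : x 0 = y 0) (h1 : x 1 = y 1) : x = y := by
  ext i; fin_cases i <;> assumption

/-- The determinant of two plane vectors. -/
def cross (u v : Plane) : ℝ := u 0 * v 1 - u 1 * v 0

@[simp] theorem cross_self (u : Plane) : cross u u = 0 := by simp [cross]; ring

@[simp] theorem cross_zero (u : Plane) : cross u 0 = 0 := by simp [cross]

theorem cross_swap (u v : Plane) : cross v u = -cross u v := by simp [cross]; ring

theorem cross_add (u v w : Plane) : cross u (v + w) = cross u v + cross u w := by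
  simp [cross]; ring

theorem cross_sub (u v w : Plane) : cross u (v - w) = cross u v - cross u w := by
  simp [cross]; ring

theorem cross_smul (u v : Plane) (t : ℝ) : cross u (t • v) = t * cross u v := by
  simp [cross]; ring

theorem cross_neg (u v : Plane) : cross u (-v) = -cross u v := by
  simp [cross]; ring

theorem cross_smul_left (u v : Plane) (t : ℝ) : cross (t • u) v = t * cross u v := by
  simp [cross]; ring

theorem cross_neg_left (u v : Plane) : cross (-u) v = -cross u v := by
  simp [cross]; ring

@[fun_prop] theorem continuous_cross {X : Type*} [TopologicalSpace X] {f g : X → Plane}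
    (hf : Continuous f) (hg : Continuous g) : Continuous fun x => cross (f x) (g x) := by
  unfold cross; fun_prop

/-- The vector `u` turned counterclockwise by a right angle. -/
noncomputable def perp (u : Plane) : Plane := !₂[-u 1, u 0]

@[simp] theorem perp_zero_coord (u : Plane) : perp u 0 = -u 1 := by simp [perp]

@[simp] theorem perp_one_coord (u : Plane) : perp u 1 = u 0 := by simp [perp]

theorem cross_perp_pos {u : Plane} (hu : u ≠ 0) : 0 < cross u (perp u) := by
  have : u 0 ≠ 0 ∨ u 1 ≠ 0 := by
    by_contra! h
    exact hu (ext_coord (by simpa using h.1) (by simpa using h.2))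
  simp only [cross, perp_zero_coord, perp_one_coord]
  rcases this with h | h
  · nlinarith [mul_self_pos.2 h, mul_self_nonneg (u 1)]
  · nlinarith [mul_self_pos.2 h, mul_self_nonneg (u 0)]

/-- Coordinates with respect to two linearly independent vectors. -/
theorem eq_smul_add_smul {a b : Plane} (h : cross a b ≠ 0) (x : Plane) :
    x = (cross x b / cross a b) • a + (cross a x / cross a b) • b := by
  apply ext_coord <;> simp only [PiLp.add_apply, PiLp.smul_apply, smul_eq_mul] <;>
    field_simp <;> simp only [cross] <;> ring

theorem exists_smul_of_cross_eq_zero {u v : Plane} (hu : u ≠ 0) (h : cross u v = 0) :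
    ∃ t : ℝ, v = t • u := by
  have hp : cross u (perp u) ≠ 0 := (cross_perp_pos hu).ne'
  have := eq_smul_add_smul hp v
  rw [h, zero_div, zero_smul, add_zero] at this
  exact ⟨_, this⟩

theorem collinear_iff (a b c : Plane) :
    Collinear ℝ {a, b, c} ↔ cross (b - a) (c - a) = 0 := by
  rw [collinear_iff_of_mem (p₀ := a) (by simp)]
  constructor
  · rintro ⟨v, hv⟩
    obtain ⟨r, hr⟩ := hv b (by simp)
    obtain ⟨t, ht⟩ := hv c (by simp)
    simp only [vadd_eq_add] at hr ht
    rw [hr, ht]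
    simp [cross_smul, cross_smul_left]
  · intro h
    by_cases hab : b - a = 0
    · refine ⟨c - a, ?_⟩
      have : b = a := sub_eq_zero.1 hab
      rintro p (rfl | rfl | rfl)
      · exact ⟨0, by simp⟩
      · exact ⟨0, by simpa using this⟩
      · exact ⟨1, by simp⟩
    · obtain ⟨t, ht⟩ := exists_smul_of_cross_eq_zero hab h
      refine ⟨b - a, ?_⟩
      rintro p (rfl | rfl | rfl)
      · exact ⟨0, by simp⟩
      · exact ⟨1, by simp⟩
      · exact ⟨t, by rw [← ht]; simp⟩

theorem cross_eq_zero_of_mem_segment {a b x : Plane} (hx : x ∈ segment ℝ a b) :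
    cross (b - a) (x - a) = 0 := by
  rw [segment_eq_image'] at hx
  obtain ⟨t, -, rfl⟩ := hx
  simp [cross_smul]

theorem tendsto_add_smul (c n : Plane) :
    Tendsto (fun s : ℝ => c + s • n) (𝓝[>] 0) (𝓝 c) := by
  have : Continuous fun s : ℝ => c + s • n := by fun_prop
  simpa using (this.tendsto 0).mono_left nhdsWithin_le_nhds

theorem tendsto_sub_smul (c n : Plane) :
    Tendsto (fun s : ℝ => c - s • n) (𝓝[>] 0) (𝓝 c) := by
  have : Continuous fun s : ℝ => c - s • n := by fun_prop
  simpa using (this.tendsto 0).mono_left nhdsWithin_le_nhds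

theorem eventually_pos : ∀ᶠ s : ℝ in 𝓝[>] 0, 0 < s := eventually_mem_nhdsWithin

/-- Identification of the plane with the complex numbers. -/
def toC (x : Plane) : ℂ := ⟨x 0, x 1⟩

@[fun_prop] theorem continuous_toC : Continuous toC := by
  have : toC = fun x : Plane => Complex.equivRealProdCLM.symm (x 0, x 1) := by
    funext x; rfl
  rw [this]; fun_prop

theorem toC_injective : Function.Injective toC := fun _ _ h =>
  ext_coord (congrArg Complex.re h) (congrArg Complex.im h)

/-- The oriented angle in `(-π, π]` at which the segment from `a` to `b` is seen from `x`; it is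
`0` if `x` is one of the end-points. -/
noncomputable def seenAngle (a b x : Plane) : ℝ :=
  Complex.arg ((toC b - toC x) / (toC a - toC x))

/-- The quotient whose argument is the viewing angle is a real number `≤ 0` only if `x` lies on
the segment, so that the branch cut of the argument is never met off the segment. -/
theorem ratio_mem_slitPlane {a b x : Plane} (hx : x ∉ segment ℝ a b) :
    (toC b - toC x) / (toC a - toC x) ∈ Complex.slitPlane := by
  by_contra h
  rw [Complex.mem_slitPlane_iff] at h
  push Not at h
  obtain ⟨h1, h2⟩ := h
  have hax : toC a - toC x ≠ 0 := by
    intro h0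
    exact hx (by rw [← toC_injective (sub_eq_zero.1 h0)]; exact left_mem_segment ℝ a b)
  set z := (toC b - toC x) / (toC a - toC x) with hz
  have hzr : z = (z.re : ℂ) := by
    apply Complex.ext <;> simp [h2]
  have hb : toC b - toC x = (z.re : ℂ) * (toC a - toC x) := by
    rw [← hzr, hz, div_mul_cancel₀ _ hax]
  have h0 : b 0 - x 0 = z.re * (a 0 - x 0) := by
    have := congrArg Complex.re hb; simpa [toC] using this
  have h1' : b 1 - x 1 = z.re * (a 1 - x 1) := by
    have := congrArg Complex.im hb; simpa [toC] using this
  apply hx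
  have hp : 0 < 1 - z.re := by linarith
  refine ⟨-z.re / (1 - z.re), 1 / (1 - z.re), ?_, by positivity, ?_, ?_⟩
  · exact div_nonneg (by linarith) hp.le
  · field_simp; ring
  · apply ext_coord <;> simp only [PiLp.add_apply, PiLp.smul_apply, smul_eq_mul] <;>
      field_simp <;> linarith

theorem continuousAt_seenAngle {a b x : Plane} (hx : x ∉ segment ℝ a b) :
    ContinuousAt (seenAngle a b) x := by
  have hax : toC a - toC x ≠ 0 := by
    intro h0
    exact hx (by rw [← toC_injective (sub_eq_zero.1 h0)]; exact left_mem_segment ℝ a b)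
  refine ContinuousAt.comp (f := fun x => (toC b - toC x) / (toC a - toC x))
    (Complex.continuousAt_arg (ratio_mem_slitPlane hx)) ?_
  exact ContinuousAt.div (by fun_prop) (by fun_prop) hax

theorem seenAngle_swap {a b x : Plane} (hx : x ∉ segment ℝ a b) :
    seenAngle b a x = -seenAngle a b x := by
  unfold seenAngle
  have := ratio_mem_slitPlane hx
  rw [← inv_div, Complex.arg_inv, if_neg (Complex.slitPlane_arg_ne_pi this)]

/-- Modulo `2 * π` the viewing angle is a difference of directions; this is what makes the sum of
the viewing angles of a closed polygon telescope to a multiple of `2 * π`. -/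
theorem coe_seenAngle {a b x : Plane} (ha : x ≠ a) (hb : x ≠ b) :
    (seenAngle a b x : Real.Angle) =
      Complex.arg (toC b - toC x) - Complex.arg (toC a - toC x) := by
  have h : ∀ {a}, x ≠ a → toC a - toC x ≠ 0 := fun ha h0 =>
    ha (toC_injective (sub_eq_zero.1 h0)).symm
  exact Complex.arg_div_coe_angle (h hb) (h ha)

/-- A segment is seen at small angles from far away. -/
theorem tendsto_seenAngle_cobounded (a b : Plane) :
    Tendsto (seenAngle a b) (Bornology.cobounded Plane) (𝓝 0) := by
  have hnorm : ∀ x : Plane, ‖toC x‖ = ‖x‖ := by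
    intro x
    rw [Complex.norm_def, EuclideanSpace.norm_eq, Complex.normSq_apply]
    simp [toC, Fin.sum_univ_two, sq]
  have h1 : Tendsto (fun x : Plane => toC a - toC x) (Bornology.cobounded Plane)
      (Bornology.cobounded ℂ) := by
    rw [← tendsto_norm_atTop_iff_cobounded]
    refine tendsto_atTop_mono (fun x => ?_)
      (tendsto_atTop_add_const_right _ (-‖toC a‖) (tendsto_norm_cobounded_atTop (E := Plane)))
    have := norm_sub_norm_le (toC x) (toC a)
    rw [norm_sub_rev, hnorm] at this
    linarith
  have h2 : Tendsto (fun x : Plane => (toC b - toC a) * (toC a - toC x)⁻¹ + 1)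
      (Bornology.cobounded Plane) (𝓝 1) := by
    simpa using ((tendsto_inv₀_cobounded.comp h1).const_mul (toC b - toC a)).add_const 1
  have h3 : Tendsto (fun x : Plane => (toC b - toC x) / (toC a - toC x))
      (Bornology.cobounded Plane) (𝓝 1) := by
    refine h2.congr' ?_
    have : ∀ᶠ x in Bornology.cobounded Plane, toC a - toC x ≠ 0 :=
      (h1.eventually (Bornology.eventually_ne_cobounded (0 : ℂ)))
    filter_upwards [this] with x hx
    field_simp
    ring
  have h4 := (Complex.continuousAt_arg (x := 1) (by simp)).tendsto.comp h3
  rw [Complex.arg_one] at h4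
  exact h4

/-- From points close to an open segment, the segment is seen at an angle greater than `π / 2` on
its left-hand side and less than `-π / 2` on its right-hand side. -/
theorem seenAngle_sides {a b c : Plane} (hab : a ≠ b) (hc : c ∈ openSegment ℝ a b) :
    ∀ᶠ s : ℝ in 𝓝[>] 0, Real.pi / 2 < seenAngle a b (c + s • perp (b - a)) ∧
      seenAngle a b (c - s • perp (b - a)) < -(Real.pi / 2) := by
  rw [openSegment_eq_image'] at hc
  obtain ⟨α, ⟨h0, h1⟩, rfl⟩ := hc
  have hu : toC b - toC a ≠ 0 := fun h => hab (toC_injective (sub_eq_zero.1 h)).symm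
  -- in complex coordinates in which `a b` is the unit interval, the viewpoint is `α + s * i`
  have key : ∀ s : ℝ, s ≠ 0 → (toC b - toC (a + α • (b - a) + s • perp (b - a))) /
      (toC a - toC (a + α • (b - a) + s • perp (b - a))) =
        ⟨(s * s - α * (1 - α)) / (α * α + s * s), s / (α * α + s * s)⟩ := by
    intro s hs
    have e1 : toC b - toC (a + α • (b - a) + s • perp (b - a)) =
        (toC b - toC a) * ⟨1 - α, -s⟩ := by
      apply Complex.ext <;> simp [toC] <;> ring
    have e2 : toC a - toC (a + α • (b - a) + s • perp (b - a)) =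
        (toC b - toC a) * ⟨-α, -s⟩ := by
      apply Complex.ext <;> simp [toC] <;> ring
    have hne : (⟨-α, -s⟩ : ℂ) ≠ 0 := fun h => h0.ne' (by simpa using congrArg Complex.re h)
    rw [e1, e2, mul_div_mul_left _ _ hu, div_eq_iff hne]
    have : 0 < α * α + s * s := by nlinarith [mul_self_nonneg s]
    apply Complex.ext <;> simp <;> field_simp <;> ring
  have hsm : ∀ᶠ s : ℝ in 𝓝[>] 0, s * s < α * (1 - α) := by
    have : Continuous fun s : ℝ => s * s := by fun_prop
    have ht : Tendsto (fun s : ℝ => s * s) (𝓝[>] 0) (𝓝 0) := by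
      simpa using (this.tendsto 0).mono_left (nhdsWithin_le_nhds (s := Ioi 0))
    exact ht.eventually (gt_mem_nhds (mul_pos h0 (by linarith)))
  filter_upwards [hsm, eventually_pos] with s hs hs0
  have hden : 0 < α * α + s * s := by positivity
  constructor
  · unfold seenAngle
    rw [key s hs0.ne']
    set z : ℂ := ⟨(s * s - α * (1 - α)) / (α * α + s * s), s / (α * α + s * s)⟩ with hz
    have hre : z.re < 0 := div_neg_of_neg_of_pos (by linarith) hden
    have him : 0 ≤ z.im := (div_pos hs0 hden).le
    have h2 : ¬ |Complex.arg z| ≤ Real.pi / 2 := by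
      rw [Complex.abs_arg_le_pi_div_two_iff]; linarith
    rw [abs_of_nonneg (Complex.arg_nonneg_iff.2 him)] at h2
    linarith
  · unfold seenAngle
    have := key (-s) (by linarith)
    rw [neg_smul, ← sub_eq_add_neg] at this
    rw [this]
    set z : ℂ := ⟨(-s * -s - α * (1 - α)) / (α * α + -s * -s), -s / (α * α + -s * -s)⟩ with hz
    have hden' : 0 < α * α + -s * -s := by nlinarith
    have hre : z.re < 0 := div_neg_of_neg_of_pos (by linarith) hden'
    have him : z.im < 0 := div_neg_of_neg_of_pos (by linarith) hden'
    have h2 : ¬ |Complex.arg z| ≤ Real.pi / 2 := by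
      rw [Complex.abs_arg_le_pi_div_two_iff]; linarith
    rw [abs_of_neg (Complex.arg_neg_iff.2 him)] at h2
    linarith

end Plane

open Plane

/-! ### Segments, vertices and edges -/

namespace Seg

@[simp] theorem carrier_mk (a b : Plane) : carrier s(a, b) = segment ℝ a b := rfl

@[simp] theorem relInterior_mk (a b : Plane) : relInterior s(a, b) = openSegment ℝ a b := rfl

theorem relInterior_subset_carrier (s : Seg) : s.relInterior ⊆ s.carrier := by
  induction s using Sym2.ind with | _ a b => exact openSegment_subset_segment ℝ a b

theorem carrier_eq (s : Seg) : s.carrier = {x | x ∈ s} ∪ s.relInterior := by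
  induction s using Sym2.ind with
  | _ a b =>
    ext x
    simp only [carrier_mk, relInterior_mk, ← insert_endpoints_openSegment, mem_insert_iff,
      mem_union, mem_ofPred_eq, Sym2.mem_iff, or_assoc]

theorem mem_carrier_of_mem {s : Seg} {x : Plane} (h : x ∈ s) : x ∈ s.carrier := by
  rw [carrier_eq]; exact Or.inl h

theorem isCompact_segment (a b : Plane) : IsCompact (segment ℝ a b) := by
  rw [segment_eq_image']
  exact isCompact_Icc.image (by fun_prop)

theorem isClosed_carrier (s : Seg) : IsClosed s.carrier := by
  induction s using Sym2.ind with
  | _ a b => exact (isCompact_segment a b).isClosed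

theorem convex_relInterior (s : Seg) : Convex ℝ s.relInterior := by
  induction s using Sym2.ind with
  | _ a b => exact convex_openSegment a b

theorem carrier_subset_closure_relInterior (s : Seg) : s.carrier ⊆ closure s.relInterior := by
  induction s using Sym2.ind with
  | _ a b => exact segment_subset_closure_openSegment

theorem NonCrossing.symm {s t : Seg} (h : NonCrossing s t) : NonCrossing t s := Disjoint.symm h

end Seg

open Seg

namespace SimplePolygon

variable (P : SimplePolygon)

theorem n_pos : 0 < P.n := by have := P.three_le; omega

/-- The vertices as a periodic sequence, indexed by all natural numbers so that indices can be
added without reduction. -/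
def vtx (k : ℕ) : Plane := P.toPolygon ⟨k % P.n, Nat.mod_lt _ P.n_pos⟩

theorem vtx_congr {i j : ℕ} (h : i % P.n = j % P.n) : P.vtx i = P.vtx j := by
  unfold vtx; congr 2

@[simp] theorem vtx_add_n (k : ℕ) : P.vtx (k + P.n) = P.vtx k := P.vtx_congr (by simp)

theorem vtx_mod (k : ℕ) : P.vtx (k % P.n) = P.vtx k := P.vtx_congr (by simp)

theorem vtx_eq_iff {i j : ℕ} : P.vtx i = P.vtx j ↔ i % P.n = j % P.n := by
  refine ⟨fun h => ?_, P.vtx_congr⟩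
  simpa using P.injective h

theorem toPolygon_eq_vtx (i : Fin P.n) : P.toPolygon i = P.vtx i := by
  unfold vtx; congr 1; exact Fin.ext (Nat.mod_eq_of_lt i.2).symm

theorem val_finRotate {n : ℕ} (i : Fin n) : ((finRotate n i : Fin n) : ℕ) = (i + 1) % n := by
  have := i.neZero
  rw [finRotate_apply, Fin.val_add, Fin.val_one', Nat.add_mod_mod]

theorem toPolygon_finRotate (i : Fin P.n) : P.toPolygon (finRotate P.n i) = P.vtx (i + 1) := by
  rw [toPolygon_eq_vtx, val_finRotate, vtx_mod]

theorem mod_succ_eq (k : ℕ) : (k % P.n + 1) % P.n = (k + 1) % P.n := by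
  rw [Nat.mod_add_mod]

/-- The edge from vertex `k` to vertex `k + 1`. -/
def edge (k : ℕ) : Set Plane := segment ℝ (P.vtx k) (P.vtx (k + 1))

theorem edgeSet_eq_edge (i : Fin P.n) : P.toPolygon.edgeSet ℝ i = P.edge i := by
  rw [Polygon.edgeSet, affineSegment_eq_segment, toPolygon_eq_vtx, toPolygon_finRotate]
  rfl

theorem edge_congr {i j : ℕ} (h : i % P.n = j % P.n) : P.edge i = P.edge j := by
  have h2 : (i + 1) % P.n = (j + 1) % P.n := by rw [Nat.add_mod, h, ← Nat.add_mod]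
  rw [edge, edge, P.vtx_congr h, P.vtx_congr h2]

theorem edge_mod (k : ℕ) : P.edge (k % P.n) = P.edge k := P.edge_congr (by simp)

theorem curve_eq : P.curve = ⋃ k : ℕ, P.edge k := by
  ext x
  simp only [curve, Polygon.boundary, mem_iUnion, edgeSet_eq_edge]
  constructor
  · rintro ⟨i, hi⟩; exact ⟨i, hi⟩
  · rintro ⟨k, hk⟩
    exact ⟨⟨k % P.n, Nat.mod_lt _ P.n_pos⟩, by rw [edge_mod]; exact hk⟩

theorem curve_eq_biUnion : P.curve = ⋃ k ∈ Finset.range P.n, P.edge k := by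
  ext x
  simp only [curve, Polygon.boundary, mem_iUnion, edgeSet_eq_edge, Finset.mem_range]
  exact ⟨fun ⟨i, hi⟩ => ⟨i, i.2, hi⟩, fun ⟨k, hk, h⟩ => ⟨⟨k, hk⟩, h⟩⟩

theorem edges_eq : P.edges = range fun k : ℕ => s(P.vtx k, P.vtx (k + 1)) := by
  ext x
  simp only [edges, mem_range, toPolygon_finRotate]
  simp only [toPolygon_eq_vtx]
  constructor
  · rintro ⟨i, hi⟩; exact ⟨i, hi⟩
  · rintro ⟨k, hk⟩
    refine ⟨⟨k % P.n, Nat.mod_lt _ P.n_pos⟩, ?_⟩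
    rw [← hk, P.vtx_mod, P.vtx_congr (P.mod_succ_eq k)]

theorem finite_edges : P.edges.Finite := Set.finite_range _

/-- The set of vertices. -/
def verts : Set Plane := range P.vtx

theorem vtx_mem_verts (k : ℕ) : P.vtx k ∈ P.verts := ⟨k, rfl⟩

theorem verts_eq_image : P.verts = P.vtx '' (Finset.range P.n) := by
  ext x
  constructor
  · rintro ⟨k, rfl⟩
    exact ⟨k % P.n, by simpa using Nat.mod_lt _ P.n_pos, P.vtx_mod k⟩
  · rintro ⟨k, -, rfl⟩; exact ⟨k, rfl⟩

theorem finite_verts : P.verts.Finite := by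
  rw [verts_eq_image]; exact (Finset.finite_toSet _).image _

theorem cross_ne_zero {a b c : Plane} (ha : a ∈ P.verts) (hb : b ∈ P.verts) (hc : c ∈ P.verts)
    (hab : a ≠ b) (hbc : b ≠ c) (hac : a ≠ c) : cross (b - a) (c - a) ≠ 0 := by
  obtain ⟨i, rfl⟩ := ha
  obtain ⟨j, rfl⟩ := hb
  obtain ⟨k, rfl⟩ := hc
  rw [Ne, ← collinear_iff]
  unfold vtx at *
  exact P.general_position _ _ _ (fun h => hab (by rw [h])) (fun h => hbc (by rw [h]))
    (fun h => hac (by rw [h]))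

theorem eq_of_mem_edge {i j : ℕ} (hij : i % P.n ≠ j % P.n) {x : Plane} (hi : x ∈ P.edge i)
    (hj : x ∈ P.edge j) :
    ((i + 1) % P.n = j % P.n ∧ x = P.vtx j) ∨ ((j + 1) % P.n = i % P.n ∧ x = P.vtx i) := by
  have := P.simple ⟨i % P.n, Nat.mod_lt _ P.n_pos⟩ ⟨j % P.n, Nat.mod_lt _ P.n_pos⟩
    (by simpa using hij) x (by rw [edgeSet_eq_edge, edge_mod]; exact hi)
    (by rw [edgeSet_eq_edge, edge_mod]; exact hj)
  simp only [Fin.ext_iff, val_finRotate, toPolygon_eq_vtx, vtx_mod, mod_succ_eq] at this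
  exact this

theorem succ_mod_ne (k : ℕ) : (k + 1) % P.n ≠ k % P.n := by
  have h3 := P.three_le
  intro h
  have : (1 : ℕ) ≡ 0 [MOD P.n] := Nat.ModEq.add_left_cancel' k h
  rw [Nat.ModEq, Nat.mod_eq_of_lt (by omega), Nat.zero_mod] at this
  omega

theorem vtx_succ_ne (k : ℕ) : P.vtx k ≠ P.vtx (k + 1) := fun h =>
  P.succ_mod_ne k (P.vtx_eq_iff.1 h).symm

theorem vtx_mem_edge (k : ℕ) : P.vtx k ∈ P.edge k := left_mem_segment _ _ _

theorem vtx_succ_mem_edge (k : ℕ) : P.vtx (k + 1) ∈ P.edge k := right_mem_segment _ _ _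

theorem edge_subset_curve (k : ℕ) : P.edge k ⊆ P.curve := by
  rw [curve_eq]; exact subset_iUnion _ _

theorem verts_subset_curve : P.verts ⊆ P.curve := by
  rintro _ ⟨k, rfl⟩; exact P.edge_subset_curve k (P.vtx_mem_edge k)

theorem isClosed_edge (k : ℕ) : IsClosed (P.edge k) := (isCompact_segment _ _).isClosed

theorem isClosed_curve : IsClosed P.curve := by
  rw [curve_eq_biUnion]
  exact isClosed_biUnion_finset fun k _ => P.isClosed_edge k

theorem isPreconnected_curve : IsPreconnected P.curve := by
  rw [curve_eq]
  refine IsPreconnected.iUnion_of_chain (fun k => (convex_segment _ _).isPreconnected) fun k => ?_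
  exact ⟨P.vtx (k + 1), P.vtx_succ_mem_edge k, P.vtx_mem_edge (k + 1)⟩

theorem carrier_subset_curve {s : Seg} (hs : s ∈ P.edges) : s.carrier ⊆ P.curve := by
  rw [edges_eq] at hs
  obtain ⟨k, rfl⟩ := hs
  exact P.edge_subset_curve k

theorem exists_edge_of_mem_curve {x : Plane} (hx : x ∈ P.curve) :
    ∃ s ∈ P.edges, x ∈ s.carrier := by
  rw [curve_eq, mem_iUnion] at hx
  obtain ⟨k, hk⟩ := hx
  exact ⟨s(P.vtx k, P.vtx (k + 1)), by rw [edges_eq]; exact ⟨k, rfl⟩, hk⟩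

theorem exists_of_mem_edges {s : Seg} (hs : s ∈ P.edges) :
    ∃ a ∈ P.verts, ∃ b ∈ P.verts, a ≠ b ∧ s = s(a, b) := by
  rw [edges_eq] at hs
  obtain ⟨k, rfl⟩ := hs
  exact ⟨_, P.vtx_mem_verts k, _, P.vtx_mem_verts (k + 1), P.vtx_succ_ne k, rfl⟩

/-- Two distinct edges meet only in common end-points. -/
theorem mem_of_mem_carrier {s t : Seg} (hs : s ∈ P.edges) (ht : t ∈ P.edges) (hst : s ≠ t)
    {x : Plane} (hxs : x ∈ s.carrier) (hxt : x ∈ t.carrier) : x ∈ s ∧ x ∈ t := by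
  rw [edges_eq] at hs ht
  obtain ⟨i, rfl⟩ := hs
  obtain ⟨j, rfl⟩ := ht
  have hij : i % P.n ≠ j % P.n := by
    intro h
    apply hst
    have h2 : (i + 1) % P.n = (j + 1) % P.n := by rw [Nat.add_mod, h, ← Nat.add_mod]
    simp only [P.vtx_congr h, P.vtx_congr h2]
  rcases P.eq_of_mem_edge hij hxs hxt with ⟨h, rfl⟩ | ⟨h, rfl⟩
  · simp [P.vtx_congr h]
  · simp [P.vtx_congr h]

/-- A vertex lies on an edge only as one of its end-points. -/
theorem mem_of_vertex_mem_carrier {s : Seg} (hs : s ∈ P.edges) {v : Plane} (hv : v ∈ P.verts)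
    (h : v ∈ s.carrier) : v ∈ s := by
  obtain ⟨k, rfl⟩ := hv
  by_cases hk : s = s(P.vtx k, P.vtx (k + 1))
  · rw [hk]; simp
  · exact (P.mem_of_mem_carrier hs (by rw [edges_eq]; exact ⟨k, rfl⟩) hk h
      (left_mem_segment _ _ _)).1

theorem not_mem_openSegment_of_verts {a b v : Plane} (ha : a ∈ P.verts) (hb : b ∈ P.verts)
    (hv : v ∈ P.verts) (hab : a ≠ b) : v ∉ openSegment ℝ a b := by
  intro h
  have hva : v ≠ a := by
    rintro rfl; exact hab (by simpa using left_mem_openSegment_iff.1 h)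
  have hvb : v ≠ b := by
    rintro rfl; exact hab (by simpa using right_mem_openSegment_iff.1 h)
  exact P.cross_ne_zero ha hb hv hab hvb.symm hva.symm
    (cross_eq_zero_of_mem_segment (openSegment_subset_segment _ _ _ h))

/-- The two neighbours of a vertex. They are joined by an edge only in a triangle. -/
theorem exists_neighbours {v : Plane} (hv : v ∈ P.verts) :
    ∃ u ∈ P.verts, ∃ w ∈ P.verts, u ≠ v ∧ w ≠ v ∧ u ≠ w ∧ s(v, u) ∈ P.edges ∧
      s(v, w) ∈ P.edges ∧ (∀ s ∈ P.edges, v ∈ s.carrier → s = s(v, u) ∨ s = s(v, w)) ∧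
      (4 ≤ P.n → s(u, w) ∉ P.edges) := by
  obtain ⟨k₀, rfl⟩ := hv
  have h3 := P.three_le
  obtain ⟨k, hk⟩ : ∃ k, P.vtx k₀ = P.vtx (k + 1) :=
    ⟨k₀ + (P.n - 1), P.vtx_congr (by
      rw [show k₀ + (P.n - 1) + 1 = k₀ + P.n by omega]; simp)⟩
  have hne : k % P.n ≠ (k + 2) % P.n := by
    intro h
    have : (0 : ℕ) ≡ 2 [MOD P.n] := Nat.ModEq.add_left_cancel' k h
    rw [Nat.ModEq, Nat.mod_eq_of_lt (by omega : 2 < P.n), Nat.zero_mod] at this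
    omega
  rw [hk]
  refine ⟨P.vtx k, P.vtx_mem_verts k, P.vtx (k + 2), P.vtx_mem_verts _, P.vtx_succ_ne k,
    (P.vtx_succ_ne (k + 1)).symm, fun h => hne (P.vtx_eq_iff.1 h), ?_, ?_, ?_, ?_⟩
  · rw [edges_eq]; exact ⟨k, Sym2.eq_swap⟩
  · rw [edges_eq]; exact ⟨k + 1, rfl⟩
  · intro s hs hx
    have := P.mem_of_vertex_mem_carrier hs (P.vtx_mem_verts _) hx
    rw [edges_eq] at hs
    obtain ⟨j, rfl⟩ := hs
    simp only [Sym2.mem_iff, P.vtx_eq_iff] at this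
    rcases this with h | h
    · right
      have h2 : (k + 2) % P.n = (j + 1) % P.n := by
        rw [show k + 2 = (k + 1) + 1 by omega, Nat.add_mod, h, ← Nat.add_mod]
      simp only [P.vtx_congr h, P.vtx_congr h2]
    · left
      have h2 : k ≡ j [MOD P.n] := Nat.ModEq.add_right_cancel' 1 h
      simp only [P.vtx_congr h, P.vtx_congr h2]
      exact Sym2.eq_swap
  · intro h4 hs
    rw [edges_eq] at hs
    obtain ⟨j, hj⟩ := hs
    simp only [Sym2.eq_iff, P.vtx_eq_iff] at hj
    rcases hj with ⟨h1, h2⟩ | ⟨h1, h2⟩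
    · have h3' : j + 1 ≡ k + 1 [MOD P.n] := Nat.ModEq.add_right 1 h1
      have h4' : k + 1 ≡ k + 2 [MOD P.n] := h3'.symm.trans h2
      exact P.succ_mod_ne (k + 1) h4'.symm
    · have h3' : k + 3 ≡ j + 1 [MOD P.n] := Nat.ModEq.add_right 1 (Nat.ModEq.symm h1)
      have h4' : k + 3 ≡ k + 0 [MOD P.n] := h3'.trans h2
      have : 3 ≡ 0 [MOD P.n] := Nat.ModEq.add_left_cancel' k h4'
      rw [Nat.ModEq, Nat.mod_eq_of_lt (by omega : 3 < P.n), Nat.zero_mod] at this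
      omega

/-- A simple polygon from a sequence of vertices. The hypothesis `hs` is about the edges along the
sequence, which are compared only in increasing order, and `hc` about the edge from the last
vertex to the first one. -/
def ofSeq (n : ℕ) (hn : 3 ≤ n) (q : ℕ → Plane) (hinj : ∀ i < n, ∀ j < n, q i = q j → i = j)
    (hgp : ∀ i < n, ∀ j < n, ∀ k < n, i ≠ j → j ≠ k → i ≠ k →
      cross (q j - q i) (q k - q i) ≠ 0)
    (hs : ∀ i j, i < j → j + 1 < n → ∀ x ∈ segment ℝ (q i) (q (i + 1)),
      x ∈ segment ℝ (q j) (q (j + 1)) → j = i + 1 ∧ x = q j)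
    (hc : ∀ i, i + 1 < n → ∀ x ∈ segment ℝ (q i) (q (i + 1)),
      x ∈ segment ℝ (q (n - 1)) (q 0) → (i + 1 = n - 1 ∧ x = q (n - 1)) ∨ (i = 0 ∧ x = q 0)) :
    SimplePolygon where
  n := n
  three_le := hn
  toPolygon := ⟨fun i => q i⟩
  injective := fun i j h => Fin.ext (hinj i i.2 j j.2 h)
  general_position := by
    intro i j k hij hjk hik
    rw [collinear_iff]
    exact hgp i i.2 j j.2 k k.2 (by simpa [Fin.ext_iff] using hij)
      (by simpa [Fin.ext_iff] using hjk) (by simpa [Fin.ext_iff] using hik)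
  simple := by
    have key : ∀ i j : Fin n, i < j → ∀ x,
        x ∈ segment ℝ (q i) (q ((finRotate n i : Fin n) : ℕ)) →
        x ∈ segment ℝ (q j) (q ((finRotate n j : Fin n) : ℕ)) →
        (finRotate n i = j ∧ x = q j) ∨ (finRotate n j = i ∧ x = q i) := by
      intro i j hij x hi hj
      have hij' : (i : ℕ) < j := hij
      have hj2 := j.2
      have e1 : (i + 1 : ℕ) % n = i + 1 := Nat.mod_eq_of_lt (by omega)
      rw [val_finRotate, e1] at hi
      rw [Fin.ext_iff, Fin.ext_iff, val_finRotate, val_finRotate, e1]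
      rcases Nat.lt_or_ge (j + 1) n with h | h
      · rw [val_finRotate, Nat.mod_eq_of_lt h] at hj
        obtain ⟨h1, h2⟩ := hs i j hij' h x hi hj
        exact Or.inl ⟨h1.symm, h2⟩
      · have hjn : (j : ℕ) = n - 1 := by omega
        have e2 : (j + 1 : ℕ) % n = 0 := by rw [hjn, Nat.sub_add_cancel (by omega)]; simp
        rw [val_finRotate, e2, hjn] at hj
        rcases hc i (by omega) x hi hj with ⟨h1, h2⟩ | ⟨h1, h2⟩
        · exact Or.inl ⟨by omega, by rw [h2, hjn]⟩
        · exact Or.inr ⟨by rw [e2, h1], by rw [h2, h1]⟩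
    intro i j hij x hi hj
    rw [Polygon.edgeSet, affineSegment_eq_segment] at hi hj
    rcases lt_or_gt_of_ne hij with h | h
    · exact key i j h x hi hj
    · exact (key j i h x hj hi).symm

section

variable {n : ℕ} {hn : 3 ≤ n} {q : ℕ → Plane} {hinj hgp hs hc}

theorem ofSeq_vtx {k : ℕ} (hk : k < n) : (ofSeq n hn q hinj hgp hs hc).vtx k = q k := by
  simp [vtx, ofSeq, Nat.mod_eq_of_lt hk]

theorem ofSeq_vtx_self : (ofSeq n hn q hinj hgp hs hc).vtx n = q 0 := by
  simp [vtx, ofSeq]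

end

end SimplePolygon

/-! ### Winding numbers and the components of the complement -/

/-- Close to `c`, only those segments are met that contain `c`. -/
theorem Seg.exists_ball_avoiding {S : Set Seg} (hS : S.Finite) (c : Plane) :
    ∃ r > 0, ∀ x ∈ Metric.ball c r, ∀ s ∈ S, x ∈ s.carrier → c ∈ s.carrier := by
  have hK : IsClosed (⋃ s ∈ {s ∈ S | c ∉ s.carrier}, s.carrier) :=
    (hS.subset (sep_subset _ _)).isClosed_biUnion fun s _ => s.isClosed_carrier
  have hc : c ∈ (⋃ s ∈ {s ∈ S | c ∉ s.carrier}, s.carrier)ᶜ := by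
    simp only [mem_compl_iff, mem_iUnion, not_exists]
    intro s hs h
    exact hs.2 h
  obtain ⟨r, hr, hb⟩ := Metric.isOpen_iff.1 hK.isOpen_compl c hc
  refine ⟨r, hr, fun x hx s hs hxs => ?_⟩
  by_contra hcs
  exact hb hx (mem_biUnion (show s ∈ {s ∈ S | c ∉ s.carrier} from ⟨hs, hcs⟩) hxs)

theorem Plane.mem_segment_of_dist_lt {v p : Plane} {t : ℝ} (ht : 0 ≤ t)
    (h : v + t • (p - v) ∈ Metric.ball v (dist v p)) : v + t • (p - v) ∈ segment ℝ v p := by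
  rw [Metric.mem_ball, dist_eq_norm, add_sub_cancel_left, norm_smul, Real.norm_of_nonneg ht,
    dist_comm, dist_eq_norm] at h
  rw [segment_eq_image']
  refine ⟨t, ⟨ht, ?_⟩, rfl⟩
  by_contra! h1
  nlinarith [norm_nonneg (p - v)]

theorem Plane.convex_cross_lt (u c : Plane) (a : ℝ) : Convex ℝ {x | a < cross u (x - c)} := by
  intro x hx y hy s t hs ht hst
  simp only [mem_ofPred_eq] at *
  have : s • x + t • y - c = s • (x - c) + t • (y - c) := by
    calc s • x + t • y - c = s • x + t • y - (s + t) • c := by rw [hst, one_smul]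
      _ = _ := by module
  rw [this, cross_add, cross_smul, cross_smul]
  rcases hs.eq_or_lt with rfl | h
  · have : t = 1 := by linarith
    subst this; linarith
  · nlinarith [mul_lt_mul_of_pos_left hx h, mul_le_mul_of_nonneg_left hy.le ht,
      congrArg (· * a) hst]

theorem Plane.convex_lt_cross (u c : Plane) (a : ℝ) : Convex ℝ {x | cross u (x - c) < a} := by
  have := convex_cross_lt (-u) c (-a)
  simpa only [cross_neg_left, neg_lt_neg_iff] using this

namespace SimplePolygon

variable (P : SimplePolygon)

/-- The winding number of the polygon around a point, multiplied by `2 * π`. It is meaningful only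
off the curve. -/
noncomputable def wind (x : Plane) : ℝ :=
  ∑ k ∈ Finset.range P.n, seenAngle (P.vtx k) (P.vtx (k + 1)) x

theorem notMem_edge {x : Plane} (hx : x ∉ P.curve) (k : ℕ) : x ∉ P.edge k := fun h =>
  hx (P.edge_subset_curve k h)

theorem ne_vtx {x : Plane} (hx : x ∉ P.curve) (k : ℕ) : x ≠ P.vtx k := fun h =>
  hx (P.verts_subset_curve ⟨k, h.symm⟩)

theorem continuousAt_wind {x : Plane} (hx : x ∉ P.curve) : ContinuousAt P.wind x := by
  unfold wind
  exact tendsto_finsetSum _ fun k _ => continuousAt_seenAngle (P.notMem_edge hx k)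

/-- The winding number is an integer. -/
theorem exists_wind_eq {x : Plane} (hx : x ∉ P.curve) :
    ∃ z : ℤ, P.wind x = z * (2 * Real.pi) := by
  have h : ((P.wind x : ℝ) : Real.Angle) = 0 := by
    have h1 : ((P.wind x : ℝ) : Real.Angle) =
        ∑ k ∈ Finset.range P.n, (seenAngle (P.vtx k) (P.vtx (k + 1)) x : Real.Angle) := by
      unfold wind
      exact map_sum Real.Angle.coeHom _ _
    rw [h1, Finset.sum_congr rfl fun k _ => coe_seenAngle (P.ne_vtx hx k) (P.ne_vtx hx (k + 1)),
      Finset.sum_range_sub (fun k => (Complex.arg (toC (P.vtx k) - toC x) : Real.Angle))]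
    have : P.vtx P.n = P.vtx 0 := by simpa using P.vtx_add_n 0
    rw [this, sub_self]
  obtain ⟨z, hz⟩ := Real.Angle.coe_eq_zero_iff.1 h
  exact ⟨z, by rw [← hz, zsmul_eq_mul]⟩

/-- The difference of two winding numbers is known once it is known up to less than one turn. -/
theorem wind_eq_of_lt {x y : Plane} (hx : x ∉ P.curve) (hy : y ∉ P.curve) {m : ℤ}
    (h1 : (m - 1) * (2 * Real.pi) < P.wind x - P.wind y)
    (h2 : P.wind x - P.wind y < (m + 1) * (2 * Real.pi)) :
    P.wind x - P.wind y = m * (2 * Real.pi) := by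
  obtain ⟨z, hz⟩ := P.exists_wind_eq hx
  obtain ⟨w, hw⟩ := P.exists_wind_eq hy
  rw [hz, hw, ← sub_mul] at h1 h2 ⊢
  have hpi : 0 < 2 * Real.pi := Real.two_pi_pos
  have h3 : m - 1 < z - w := by exact_mod_cast lt_of_mul_lt_mul_right h1 hpi.le
  have h4 : z - w < m + 1 := by exact_mod_cast lt_of_mul_lt_mul_right h2 hpi.le
  have : z - w = m := by omega
  rw [← this]; push_cast; ring

/-- The winding number is constant on connected sets off the curve, since a continuous
integer-valued function on them is constant. -/
theorem wind_eq_of_isPreconnected {S : Set Plane} (hS : IsPreconnected S) (hSc : S ⊆ P.curveᶜ)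
    {x y : Plane} (hx : x ∈ S) (hy : y ∈ S) : P.wind x = P.wind y := by
  have key : ∀ {x y}, x ∈ S → y ∈ S → ¬ P.wind x < P.wind y := by
    intro x y hx hy hlt
    obtain ⟨z, hz⟩ := P.exists_wind_eq (hSc hx)
    obtain ⟨w, hw⟩ := P.exists_wind_eq (hSc hy)
    have hpi : 0 < 2 * Real.pi := Real.two_pi_pos
    have hzw : z + 1 ≤ w := by
      rw [hz, hw] at hlt
      have : z < w := by exact_mod_cast lt_of_mul_lt_mul_right hlt hpi.le
      omega
    have hzw' : ((z : ℝ) + 1) ≤ w := by exact_mod_cast hzw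
    have hcont : ContinuousOn P.wind S := fun x hx =>
      (P.continuousAt_wind (hSc hx)).continuousWithinAt
    obtain ⟨m, hm, hmv⟩ := hS.intermediate_value hx hy hcont
      (show (z + 1 / 2 : ℝ) * (2 * Real.pi) ∈ Icc _ _ by
        rw [hz, hw]; constructor <;> nlinarith)
    obtain ⟨t, ht⟩ := P.exists_wind_eq (hSc hm)
    rw [ht] at hmv
    have h1 : (t : ℝ) = z + 1 / 2 := mul_right_cancel₀ hpi.ne' hmv
    have h2 : (2 * t : ℤ) = 2 * z + 1 := by
      have : (2 * t : ℝ) = 2 * z + 1 := by linarith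
      exact_mod_cast this
    omega
  exact le_antisymm (not_lt.1 (key hy hx)) (not_lt.1 (key hx hy))

/-- The component of the complement of the curve that contains `x`. -/
def comp (x : Plane) : Set Plane := connectedComponentIn P.curveᶜ x

theorem comp_subset (x : Plane) : P.comp x ⊆ P.curveᶜ := connectedComponentIn_subset _ _

theorem isPreconnected_comp (x : Plane) : IsPreconnected (P.comp x) :=
  isPreconnected_connectedComponentIn

theorem mem_comp {x : Plane} (hx : x ∉ P.curve) : x ∈ P.comp x := mem_connectedComponentIn hx

theorem isOpen_comp (x : Plane) : IsOpen (P.comp x) :=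
  P.isClosed_curve.isOpen_compl.connectedComponentIn

theorem subset_comp {S : Set Plane} (hS : IsPreconnected S) (hSc : S ⊆ P.curveᶜ) {x y : Plane}
    (hx : x ∈ S) (hy : x ∈ P.comp y) : S ⊆ P.comp y := by
  have := hS.subset_connectedComponentIn hx hSc
  rwa [← connectedComponentIn_eq hy] at this

theorem comp_subset_inside {x : Plane} (hx : x ∈ P.inside) : P.comp x ⊆ P.inside := by
  intro y hy
  refine ⟨P.comp_subset x hy, ?_⟩
  rw [← connectedComponentIn_eq hy]
  exact hx.2

theorem isOpen_inside : IsOpen P.inside := by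
  rw [isOpen_iff_forall_mem_open]
  exact fun x hx => ⟨P.comp x, P.comp_subset_inside hx, P.isOpen_comp x, P.mem_comp hx.1⟩

/-- A connected set off the curve that meets the interior lies in the interior. -/
theorem subset_inside {S : Set Plane} (hS : IsPreconnected S) (hSc : S ⊆ P.curveᶜ) {x : Plane}
    (hx : x ∈ S) (hxi : x ∈ P.inside) : S ⊆ P.inside :=
  (hS.subset_connectedComponentIn hx hSc).trans (P.comp_subset_inside hxi)

/-- Outside, the winding number vanishes: it is constant on the component of `x`, which is
unbounded, and tends to `0` at infinity. -/
theorem wind_eq_zero {x : Plane} (hx : x ∉ P.curve) (h : x ∉ P.inside) : P.wind x = 0 := by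
  have hb : ¬ Bornology.IsBounded (P.comp x) := fun hb => h ⟨hx, hb⟩
  have ht : Tendsto P.wind (Bornology.cobounded Plane) (𝓝 0) := by
    unfold wind
    rw [show (0 : ℝ) = ∑ k ∈ Finset.range P.n, 0 by simp]
    exact tendsto_finsetSum _ fun k _ => tendsto_seenAngle_cobounded _ _
  have hev := ht.eventually (Ioo_mem_nhds (neg_lt_zero.2 Real.two_pi_pos) Real.two_pi_pos)
  obtain ⟨y, hy, hyw⟩ : ∃ y ∈ P.comp x, P.wind y ∈ Ioo (-(2 * Real.pi)) (2 * Real.pi) := by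
    by_contra! hcon
    apply hb
    rw [← Bornology.isCobounded_compl_iff, Bornology.isCobounded_def]
    exact mem_of_superset hev fun y hy hyc => hcon y hyc hy
  rw [P.wind_eq_of_isPreconnected (P.isPreconnected_comp x) (P.comp_subset x) (P.mem_comp hx) hy]
  obtain ⟨z, hz⟩ := P.exists_wind_eq (P.comp_subset x hy)
  rw [hz] at hyw ⊢
  have hpi : 0 < 2 * Real.pi := Real.two_pi_pos
  have h1 : (-1 : ℝ) < z := by nlinarith [hyw.1]
  have h2 : (z : ℝ) < 1 := by nlinarith [hyw.2]
  have h1' : -1 < z := by exact_mod_cast h1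
  have h2' : z < 1 := by exact_mod_cast h2
  have : z = 0 := by omega
  simp [this]

theorem cross_le_of_mem_curve {n : Plane} {c : ℝ} (hv : ∀ v ∈ P.verts, cross n v ≤ c)
    {y : Plane} (hy : y ∈ P.curve) : cross n y ≤ c := by
  rw [curve_eq, mem_iUnion] at hy
  obtain ⟨k, a, b, ha, hb, hab, rfl⟩ := hy
  rw [cross_add, cross_smul, cross_smul]
  have h1 := hv _ (P.vtx_mem_verts k)
  have h2 := hv _ (P.vtx_mem_verts (k + 1))
  nlinarith [mul_le_mul_of_nonneg_left h1 ha, mul_le_mul_of_nonneg_left h2 hb,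
    congrArg (· * c) hab]

/-- If all vertices lie in a closed half-plane, then the interior lies in the open half-plane. -/
theorem cross_lt_of_mem_inside {n : Plane} (hn : n ≠ 0) {c : ℝ}
    (hv : ∀ v ∈ P.verts, cross n v ≤ c) {x : Plane} (hx : x ∈ P.inside) : cross n x < c := by
  by_contra! hcx
  have hp := cross_perp_pos hn
  -- from a point beyond the half-plane a ray escapes to infinity without meeting the curve
  set f : ℝ → Plane := fun t => x + t • perp n with hf
  have hpre : IsPreconnected (f '' Ici 0) :=
    isPreconnected_Ici.image _ (by rw [hf]; fun_prop)
  have hsub : f '' Ici 0 ⊆ P.curveᶜ := by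
    rintro _ ⟨t, ht, rfl⟩ hmem
    rcases (show (0 : ℝ) ≤ t from ht).eq_or_lt with rfl | ht'
    · exact hx.1 (by simpa [hf] using hmem)
    · have := P.cross_le_of_mem_curve hv hmem
      simp only [hf, cross_add, cross_smul] at this
      nlinarith [mul_pos ht' hp]
  have hx0 : x ∈ f '' Ici 0 := ⟨0, by simp, by simp [hf]⟩
  have hbd : Bornology.IsBounded (f '' Ici 0) :=
    hx.2.subset (hpre.subset_connectedComponentIn hx0 hsub)
  obtain ⟨R, hR⟩ := hbd.exists_norm_le
  have hpn : 0 < ‖perp n‖ := norm_pos_iff.2 fun h => by rw [h] at hp; simp at hp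
  have hR' := hR x hx0
  have hR0 : 0 ≤ R := (norm_nonneg x).trans hR'
  have h1 := hR (f ((2 * R + 1) / ‖perp n‖))
    ⟨_, by simp only [mem_Ici]; positivity, rfl⟩
  have h2 : ‖((2 * R + 1) / ‖perp n‖) • perp n‖ = 2 * R + 1 := by
    rw [norm_smul, Real.norm_of_nonneg (by positivity),
      div_mul_cancel₀ _ hpn.ne']
  have h3 := norm_sub_le (f ((2 * R + 1) / ‖perp n‖)) x
  rw [hf] at h3
  simp only [add_sub_cancel_left, h2] at h3
  linarith

/-- Near a point of an open edge, the curve is the line through that edge. -/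
theorem exists_ball_edge {a b c : Plane} (h : s(a, b) ∈ P.edges) (hc : c ∈ openSegment ℝ a b) :
    ∃ r > 0, ∀ x ∈ Metric.ball c r, x ∈ P.curve ↔ cross (b - a) (x - c) = 0 := by
  obtain ⟨a', -, b', -, hab', hs⟩ := P.exists_of_mem_edges h
  have hab : a ≠ b := by
    rintro rfl
    apply hab'
    rcases Sym2.eq_iff.1 hs with ⟨h1, h2⟩ | ⟨h1, h2⟩
    · rw [← h1, ← h2]
    · rw [← h1, ← h2]
  obtain ⟨r₁, hr₁, hb₁⟩ := exists_ball_avoiding P.finite_edges c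
  have hsegc := cross_eq_zero_of_mem_segment (openSegment_subset_segment ℝ a b hc)
  have hca : c ≠ a := by
    rintro rfl; exact hab (by simpa using left_mem_openSegment_iff.1 hc)
  have hcb : c ≠ b := by
    rintro rfl; exact hab (by simpa using right_mem_openSegment_iff.1 hc)
  refine ⟨min r₁ (min (dist c a) (dist c b)),
    lt_min hr₁ (lt_min (dist_pos.2 hca) (dist_pos.2 hcb)), fun x hx => ?_⟩
  simp only [Metric.mem_ball, lt_min_iff] at hx
  constructor
  · intro hxc
    obtain ⟨s, hs, hxs⟩ := P.exists_edge_of_mem_curve hxc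
    have hcs := hb₁ x hx.1 s hs hxs
    have hss : s = s(a, b) := by
      by_contra hne
      have := (P.mem_of_mem_carrier hs h hne hcs (openSegment_subset_segment _ _ _ hc)).2
      rcases Sym2.mem_iff.1 this with h | h
      exacts [hca h, hcb h]
    rw [hss] at hxs
    have := cross_eq_zero_of_mem_segment hxs
    rw [show x - c = (x - a) - (c - a) by abel, cross_sub, this, hsegc, sub_zero]
  · intro hx0
    apply P.carrier_subset_curve h
    rw [openSegment_eq_image'] at hc
    obtain ⟨α, ⟨h0, h1⟩, rfl⟩ := hc
    obtain ⟨t, ht⟩ := exists_smul_of_cross_eq_zero (sub_ne_zero.2 hab.symm) hx0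
    have hx' : x = a + (α + t) • (b - a) := by
      rw [eq_add_of_sub_eq ht]; module
    have hpos : 0 < ‖b - a‖ := norm_pos_iff.2 (sub_ne_zero.2 hab.symm)
    have h2 := hx.2.1
    have h3 := hx.2.2
    rw [dist_eq_norm, ht, norm_smul, dist_eq_norm, add_sub_cancel_left, norm_smul] at h2
    rw [dist_eq_norm, ht, norm_smul, dist_eq_norm,
      show a + α • (b - a) - b = (-(1 - α)) • (b - a) by module, norm_smul] at h3
    have h2' := lt_of_mul_lt_mul_right h2 hpos.le
    have h3' := lt_of_mul_lt_mul_right h3 hpos.le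
    rw [Real.norm_eq_abs, Real.norm_eq_abs, abs_of_pos h0] at h2'
    rw [Real.norm_eq_abs, Real.norm_eq_abs, abs_neg, abs_of_pos (by linarith : 0 < 1 - α)] at h3'
    rw [carrier_mk, segment_eq_image']
    refine ⟨α + t, ⟨?_, ?_⟩, hx'.symm⟩
    · linarith [neg_abs_le t]
    · linarith [le_abs_self t]

/-- Near a vertex, the curve consists of the two edges at this vertex. -/
theorem exists_ball_vertex {v u w : Plane} (hu : s(v, u) ∈ P.edges) (hw : s(v, w) ∈ P.edges)
    (huv : u ≠ v) (hwv : w ≠ v)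
    (hvs : ∀ s ∈ P.edges, v ∈ s.carrier → s = s(v, u) ∨ s = s(v, w)) :
    ∃ r > 0, ∀ x ∈ Metric.ball v r, x ∈ P.curve ↔
      (∃ t : ℝ, 0 ≤ t ∧ x = v + t • (u - v)) ∨ (∃ t : ℝ, 0 ≤ t ∧ x = v + t • (w - v)) := by
  obtain ⟨r₁, hr₁, hb₁⟩ := exists_ball_avoiding P.finite_edges v
  refine ⟨min r₁ (min (dist v u) (dist v w)),
    lt_min hr₁ (lt_min (dist_pos.2 huv.symm) (dist_pos.2 hwv.symm)), fun x hx => ?_⟩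
  simp only [Metric.mem_ball, lt_min_iff] at hx
  constructor
  · intro hxc
    obtain ⟨s, hs, hxs⟩ := P.exists_edge_of_mem_curve hxc
    rcases hvs s hs (hb₁ x hx.1 s hs hxs) with rfl | rfl
    · rw [carrier_mk, segment_eq_image'] at hxs
      obtain ⟨t, ht, rfl⟩ := hxs
      exact Or.inl ⟨t, ht.1, rfl⟩
    · rw [carrier_mk, segment_eq_image'] at hxs
      obtain ⟨t, ht, rfl⟩ := hxs
      exact Or.inr ⟨t, ht.1, rfl⟩
  · rintro (⟨t, ht, rfl⟩ | ⟨t, ht, rfl⟩)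
    · exact P.carrier_subset_curve hu (mem_segment_of_dist_lt ht hx.2.1)
    · exact P.carrier_subset_curve hw (mem_segment_of_dist_lt ht hx.2.2)

end SimplePolygon

/-! ### The two sides of the curve -/

namespace SimplePolygon

variable (P : SimplePolygon)

theorem exists_local_sides_edge {a b c : Plane} (h : s(a, b) ∈ P.edges) (hab : a ≠ b)
    (hc : c ∈ openSegment ℝ a b) :
    ∃ r > 0, ∃ A B : Set Plane, IsPreconnected A ∧ IsPreconnected B ∧ A ⊆ P.curveᶜ ∧
      B ⊆ P.curveᶜ ∧ Metric.ball c r \ P.curve ⊆ A ∪ B ∧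
      Metric.ball c r ∩ P.curve ⊆ closure A ∩ closure B := by
  obtain ⟨r, hr, hb⟩ := P.exists_ball_edge h hc
  set u := b - a with hu
  have hu0 : u ≠ 0 := sub_ne_zero.2 hab.symm
  have hp := cross_perp_pos hu0
  refine ⟨r, hr, Metric.ball c r ∩ {x | 0 < cross u (x - c)},
    Metric.ball c r ∩ {x | cross u (x - c) < 0},
    ((convex_ball c r).inter (convex_cross_lt u c 0)).isPreconnected,
    ((convex_ball c r).inter (convex_lt_cross u c 0)).isPreconnected, ?_, ?_, ?_, ?_⟩
  · rintro x ⟨hx, hx'⟩ hxc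
    exact (show 0 < cross u (x - c) from hx').ne' ((hb x hx).1 hxc)
  · rintro x ⟨hx, hx'⟩ hxc
    exact (show cross u (x - c) < 0 from hx').ne ((hb x hx).1 hxc)
  · rintro x ⟨hx, hxc⟩
    rcases lt_trichotomy (cross u (x - c)) 0 with h | h | h
    · exact Or.inr ⟨hx, h⟩
    · exact absurd ((hb x hx).2 h) hxc
    · exact Or.inl ⟨hx, h⟩
  · rintro y ⟨hy, hyc⟩
    have h0 := (hb y hy).1 hyc
    have hn : Metric.ball c r ∈ 𝓝 y := Metric.isOpen_ball.mem_nhds hy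
    constructor
    · refine mem_closure_of_tendsto (tendsto_add_smul y (perp u)) ?_
      filter_upwards [(tendsto_add_smul y (perp u)).eventually hn, eventually_pos] with s hs hs0
      refine ⟨hs, ?_⟩
      simp only [mem_ofPred_eq]
      rw [add_sub_right_comm, cross_add, h0, cross_smul, zero_add]
      exact mul_pos hs0 hp
    · refine mem_closure_of_tendsto (tendsto_sub_smul y (perp u)) ?_
      filter_upwards [(tendsto_sub_smul y (perp u)).eventually hn, eventually_pos] with s hs hs0
      refine ⟨hs, ?_⟩
      simp only [mem_ofPred_eq]
      rw [sub_right_comm, cross_sub, h0, cross_smul, zero_sub, neg_lt_zero]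
      exact mul_pos hs0 hp

/-- Near a vertex `v` the curve has two connected sides: the convex sector `A` between the edges
to `u` and to `w`, and the reflex sector `B`, which is the union of two half-discs. -/
theorem exists_local_sides_vertex {v u w : Plane} (hu : s(v, u) ∈ P.edges)
    (hw : s(v, w) ∈ P.edges) (hD : 0 < cross (u - v) (w - v))
    (hvs : ∀ s ∈ P.edges, v ∈ s.carrier → s = s(v, u) ∨ s = s(v, w)) :
    ∃ r > 0, ∃ A B : Set Plane, (∀ x, x ∈ A ↔
        x ∈ Metric.ball v r ∧ cross (w - v) (x - v) < 0 ∧ 0 < cross (u - v) (x - v)) ∧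
      IsPreconnected A ∧ IsPreconnected B ∧ A ⊆ P.curveᶜ ∧
      B ⊆ P.curveᶜ ∧ Metric.ball v r \ P.curve ⊆ A ∪ B ∧
      Metric.ball v r ∩ P.curve ⊆ closure A ∩ closure B := by
  have huv : u ≠ v := by rintro rfl; simp [cross] at hD
  have hwv : w ≠ v := by rintro rfl; simp [cross] at hD
  obtain ⟨r, hr, hb⟩ := P.exists_ball_vertex hu hw huv hwv hvs
  set p := u - v with hp
  set q := w - v with hq
  have hqp : cross q p = -cross p q := cross_swap p q
  refine ⟨r, hr,
    Metric.ball v r ∩ ({x | cross q (x - v) < 0} ∩ {x | 0 < cross p (x - v)}),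
    Metric.ball v r ∩ {x | 0 < cross q (x - v)} ∪ Metric.ball v r ∩ {x | cross p (x - v) < 0},
    fun x => Iff.rfl,
    ((convex_ball v r).inter
      ((convex_lt_cross q v 0).inter (convex_cross_lt p v 0))).isPreconnected, ?_, ?_, ?_, ?_, ?_⟩
  -- the two half-discs of the reflex sector meet opposite to the bisecting direction `p + q`
  · obtain ⟨s, hs, hs0⟩ := (((tendsto_sub_smul v (p + q)).eventually
      (Metric.ball_mem_nhds v hr)).and eventually_pos).exists
    refine IsPreconnected.union (v - s • (p + q)) ⟨hs, ?_⟩ ⟨hs, ?_⟩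
      ((convex_ball v r).inter (convex_cross_lt q v 0)).isPreconnected
      ((convex_ball v r).inter (convex_lt_cross p v 0)).isPreconnected
    · simp only [mem_ofPred_eq]
      rw [sub_sub_cancel_left, cross_neg, cross_smul, cross_add, cross_self, hqp]
      nlinarith
    · simp only [mem_ofPred_eq]
      rw [sub_sub_cancel_left, cross_neg, cross_smul, cross_add, cross_self]
      nlinarith
  · rintro x ⟨hx, h1, h2⟩ hxc
    simp only [mem_ofPred_eq] at h1 h2
    rcases (hb x hx).1 hxc with ⟨t, ht, rfl⟩ | ⟨t, ht, rfl⟩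
    · rw [add_sub_cancel_left, cross_smul, cross_self] at h2; simp at h2
    · rw [add_sub_cancel_left, cross_smul, cross_self] at h1; simp at h1
  · rintro x (⟨hx, h1⟩ | ⟨hx, h1⟩) hxc
    · simp only [mem_ofPred_eq] at h1
      rcases (hb x hx).1 hxc with ⟨t, ht, rfl⟩ | ⟨t, ht, rfl⟩
      · rw [add_sub_cancel_left, cross_smul, hqp] at h1; nlinarith
      · rw [add_sub_cancel_left, cross_smul, cross_self] at h1; simp at h1
    · simp only [mem_ofPred_eq] at h1
      rcases (hb x hx).1 hxc with ⟨t, ht, rfl⟩ | ⟨t, ht, rfl⟩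
      · rw [add_sub_cancel_left, cross_smul, cross_self] at h1; simp at h1
      · rw [add_sub_cancel_left, cross_smul] at h1; nlinarith
  · rintro x ⟨hx, hxc⟩
    by_cases h1 : 0 < cross q (x - v)
    · exact Or.inr (Or.inl ⟨hx, h1⟩)
    by_cases h2 : cross p (x - v) < 0
    · exact Or.inr (Or.inr ⟨hx, h2⟩)
    left
    have hrep := eq_smul_add_smul hD.ne' (x - v)
    rw [cross_swap q] at hrep
    refine ⟨hx, lt_of_le_of_ne (not_lt.1 h1) fun h0 => hxc ((hb x hx).2 ?_),
      lt_of_le_of_ne (not_lt.1 h2) fun h0 => hxc ((hb x hx).2 ?_)⟩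
    · right
      refine ⟨_, div_nonneg (not_lt.1 h2) hD.le, ?_⟩
      rw [h0, neg_zero, zero_div, zero_smul, zero_add] at hrep
      rw [← hrep]; abel
    · left
      refine ⟨_, div_nonneg (neg_nonneg.2 (not_lt.1 h1)) hD.le, ?_⟩
      rw [← h0, zero_div, zero_smul, add_zero] at hrep
      rw [← hrep]; abel
  · rintro y ⟨hy, hyc⟩
    have hn : Metric.ball v r ∈ 𝓝 y := Metric.isOpen_ball.mem_nhds hy
    have hcl : ∀ {S : Set Plane} {d : Plane}, (∀ s : ℝ, 0 < s → y + s • d ∈ Metric.ball v r →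
        y + s • d ∈ S) → y ∈ closure S := by
      intro S d hS
      refine mem_closure_of_tendsto (tendsto_add_smul y d) ?_
      filter_upwards [(tendsto_add_smul y d).eventually hn, eventually_pos] with s hs hs0
      exact hS s hs0 hs
    rcases (hb y hy).1 hyc with ⟨t, ht, rfl⟩ | ⟨t, ht, rfl⟩
    · constructor
      · refine hcl (d := p + q) fun s hs hball => ⟨hball, ?_, ?_⟩
        · simp only [mem_ofPred_eq]
          rw [add_assoc, add_sub_cancel_left, cross_add, cross_smul, cross_smul, cross_add,
            cross_self, hqp]
          nlinarith [mul_pos hs hD, mul_nonneg ht hD.le]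
        · simp only [mem_ofPred_eq]
          rw [add_assoc, add_sub_cancel_left, cross_add, cross_smul, cross_smul, cross_add,
            cross_self]
          nlinarith [mul_pos hs hD, mul_nonneg ht hD.le]
      · refine hcl (d := -q) fun s hs hball => Or.inr ⟨hball, ?_⟩
        simp only [mem_ofPred_eq]
        rw [add_assoc, add_sub_cancel_left, cross_add, cross_smul, cross_smul, cross_neg,
          cross_self]
        nlinarith [mul_pos hs hD]
    · constructor
      · refine hcl (d := p + q) fun s hs hball => ⟨hball, ?_, ?_⟩
        · simp only [mem_ofPred_eq]
          rw [add_assoc, add_sub_cancel_left, cross_add, cross_smul, cross_smul, cross_add,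
            cross_self, hqp]
          nlinarith [mul_pos hs hD, mul_nonneg ht hD.le]
        · simp only [mem_ofPred_eq]
          rw [add_assoc, add_sub_cancel_left, cross_add, cross_smul, cross_smul, cross_add,
            cross_self]
          nlinarith [mul_pos hs hD, mul_nonneg ht hD.le]
      · refine hcl (d := -p) fun s hs hball => Or.inl ⟨hball, ?_⟩
        simp only [mem_ofPred_eq]
        rw [add_assoc, add_sub_cancel_left, cross_add, cross_smul, cross_smul, cross_neg,
          cross_self, hqp]
        nlinarith [mul_pos hs hD]

/-- Near each of its points the curve has two connected sides, and both of them accumulate at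
all points of the curve nearby. -/
theorem exists_local_sides {c : Plane} (hc : c ∈ P.curve) :
    ∃ r > 0, ∃ A B : Set Plane, IsPreconnected A ∧ IsPreconnected B ∧ A ⊆ P.curveᶜ ∧
      B ⊆ P.curveᶜ ∧ Metric.ball c r \ P.curve ⊆ A ∪ B ∧
      Metric.ball c r ∩ P.curve ⊆ closure A ∩ closure B := by
  by_cases hcv : c ∈ P.verts
  · obtain ⟨u, hu, w, hw, huv, hwv, huw, heu, hew, hvs, -⟩ := P.exists_neighbours hcv
    have hD := P.cross_ne_zero hcv hu hw huv.symm huw hwv.symm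
    rcases lt_or_gt_of_ne hD with h | h
    · obtain ⟨r, hr, A, B, -, hAB⟩ := P.exists_local_sides_vertex hew heu
        (by rw [cross_swap]; linarith) fun s hs hcs => (hvs s hs hcs).symm
      exact ⟨r, hr, A, B, hAB⟩
    · obtain ⟨r, hr, A, B, -, hAB⟩ := P.exists_local_sides_vertex heu hew h hvs
      exact ⟨r, hr, A, B, hAB⟩
  · obtain ⟨s, hs, hcs⟩ := P.exists_edge_of_mem_curve hc
    obtain ⟨a, ha, b, hb, hab, rfl⟩ := P.exists_of_mem_edges hs
    refine P.exists_local_sides_edge hs hab ?_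
    rw [carrier_mk, ← insert_endpoints_openSegment] at hcs
    rcases hcs with rfl | rfl | h
    exacts [absurd ha hcv, absurd hb hcv, h]

/-- Every component of the complement of the curve accumulates at the whole curve, by the
connectedness of the curve. -/
theorem curve_subset_closure_comp {x : Plane} (hx : x ∉ P.curve) :
    P.curve ⊆ closure (P.comp x) := by
  set U := P.comp x with hU
  -- the points of the curve in the closure of `U` form a subset that is open in the curve,
  -- because `U` contains one of the two local sides at each of them
  have hloc : ∀ c ∈ P.curve, c ∈ closure U → ∃ r > 0, Metric.ball c r ∩ P.curve ⊆ closure U := by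
    intro c hc hcU
    obtain ⟨r, hr, A, B, hA, hB, hAc, hBc, hAB, hcl⟩ := P.exists_local_sides hc
    refine ⟨r, hr, ?_⟩
    obtain ⟨y, hyb, hyU⟩ := mem_closure_iff.1 hcU _ Metric.isOpen_ball (Metric.mem_ball_self hr)
    rcases hAB ⟨hyb, P.comp_subset x hyU⟩ with hy | hy
    · exact fun z hz => closure_mono (P.subset_comp hA hAc hy hyU) (hcl hz).1
    · exact fun z hz => closure_mono (P.subset_comp hB hBc hy hyU) (hcl hz).2
  -- the closure of `U` meets the curve, for otherwise `U` would be clopen in the plane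
  have hmeet : (P.curve ∩ closure U).Nonempty := by
    by_contra! hemp
    have hsub : closure U ⊆ P.curveᶜ := fun y hy hyc =>
      (hemp ▸ (⟨hyc, hy⟩ : y ∈ P.curve ∩ closure U) : y ∈ (∅ : Set Plane))
    have hclU : closure U ⊆ U :=
      P.subset_comp (P.isPreconnected_comp x).closure hsub
        (subset_closure (P.mem_comp hx)) (P.mem_comp hx)
    have hclopen : IsClopen U := ⟨closure_subset_iff_isClosed.1 hclU, P.isOpen_comp x⟩
    have huniv : U = univ := hclopen.eq_univ ⟨x, P.mem_comp hx⟩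
    have hv : P.vtx 0 ∈ U := huniv ▸ mem_univ _
    exact P.comp_subset x hv (P.verts_subset_curve (P.vtx_mem_verts 0))
  set O : Set Plane := {y | ∃ c r, y ∈ Metric.ball c r ∧ Metric.ball c r ∩ P.curve ⊆ closure U}
    with hO
  have hOo : IsOpen O := by
    rw [isOpen_iff_forall_mem_open]
    rintro y ⟨c, r, hy, h⟩
    exact ⟨Metric.ball c r, fun z hz => ⟨c, r, hz, h⟩, Metric.isOpen_ball, hy⟩
  have hcO : ∀ c ∈ P.curve, c ∈ closure U → c ∈ O := by
    intro c hc hcU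
    obtain ⟨r, hr, h⟩ := hloc c hc hcU
    exact ⟨c, r, Metric.mem_ball_self hr, h⟩
  by_contra hnot
  obtain ⟨z, hz, hzU⟩ := not_subset.1 hnot
  obtain ⟨y, hy, hyU⟩ := hmeet
  obtain ⟨t, ht, ⟨c, r, htb, hsub⟩, htU⟩ := P.isPreconnected_curve O (closure U)ᶜ hOo
    isClosed_closure.isOpen_compl (fun t ht => by
      by_cases h : t ∈ closure U
      exacts [Or.inl (hcO t ht h), Or.inr h]) ⟨y, hy, hcO y hy hyU⟩ ⟨z, hz, hzU⟩
  exact htU (hsub ⟨htb, ht⟩)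

/-- The winding number increases by one when an edge is crossed from right to left. -/
theorem eventually_wind_jump {k : ℕ} {c : Plane}
    (hc : c ∈ openSegment ℝ (P.vtx k) (P.vtx (k + 1))) :
    ∀ᶠ s : ℝ in 𝓝[>] 0, P.wind (c + s • perp (P.vtx (k + 1) - P.vtx k)) -
      P.wind (c - s • perp (P.vtx (k + 1) - P.vtx k)) = 2 * Real.pi := by
  wlog hk : k < P.n generalizing k
  · have h1 := P.vtx_mod k
    have h2 := P.vtx_congr (P.mod_succ_eq k)
    have := this (k := k % P.n) (by rw [h1, h2]; exact hc) (Nat.mod_lt _ P.n_pos)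
    rwa [h1, h2] at this
  set n := perp (P.vtx (k + 1) - P.vtx k) with hn
  have hab := P.vtx_succ_ne k
  have hedge : s(P.vtx k, P.vtx (k + 1)) ∈ P.edges := by rw [edges_eq]; exact ⟨k, rfl⟩
  obtain ⟨r, hr, hb⟩ := P.exists_ball_edge hedge hc
  have hpos := cross_perp_pos (sub_ne_zero.2 hab.symm)
  -- the other edges contribute continuously at `c`, so the jump comes from the edge `k`
  set rest : Plane → ℝ := fun x =>
    ∑ j ∈ (Finset.range P.n).erase k, seenAngle (P.vtx j) (P.vtx (j + 1)) x with hrest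
  have hwind : ∀ x, P.wind x = seenAngle (P.vtx k) (P.vtx (k + 1)) x + rest x := fun x =>
    (Finset.add_sum_erase _ _ (Finset.mem_range.2 hk)).symm
  have hcont : ContinuousAt rest c := by
    refine tendsto_finsetSum _ fun j hj => continuousAt_seenAngle fun hcj => ?_
    rw [Finset.mem_erase, Finset.mem_range] at hj
    have hne : s(P.vtx j, P.vtx (j + 1)) ≠ s(P.vtx k, P.vtx (k + 1)) := by
      intro h
      have hjk : j % P.n ≠ k % P.n := by
        rw [Nat.mod_eq_of_lt hj.2, Nat.mod_eq_of_lt hk]; exact hj.1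
      rcases Sym2.eq_iff.1 h with ⟨h1, -⟩ | ⟨h1, h2⟩
      · exact hjk (P.vtx_eq_iff.1 h1)
      · have e1 : j ≡ k + 1 [MOD P.n] := P.vtx_eq_iff.1 h1
        have e2 : j + 1 ≡ k [MOD P.n] := P.vtx_eq_iff.1 h2
        have e3 : k + 2 ≡ k + 0 [MOD P.n] := (e1.add_right 1).symm.trans e2
        have e4 : 2 ≡ 0 [MOD P.n] := Nat.ModEq.add_left_cancel' k e3
        have h3 := P.three_le
        rw [Nat.ModEq, Nat.mod_eq_of_lt (by omega), Nat.zero_mod] at e4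
        omega
    have hjedge : s(P.vtx j, P.vtx (j + 1)) ∈ P.edges := by rw [edges_eq]; exact ⟨j, rfl⟩
    have hmem := (P.mem_of_mem_carrier hjedge hedge hne hcj
      (openSegment_subset_segment _ _ _ hc)).2
    rcases Sym2.mem_iff.1 hmem with rfl | rfl
    · exact hab (by simpa using left_mem_openSegment_iff.1 hc)
    · exact hab (by simpa using right_mem_openSegment_iff.1 hc)
  have hpi := Real.pi_pos
  have hd : Tendsto (fun s : ℝ => rest (c + s • n) - rest (c - s • n)) (𝓝[>] 0) (𝓝 0) := by
    have := ((hcont.tendsto.comp (tendsto_add_smul c n)).sub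
      (hcont.tendsto.comp (tendsto_sub_smul c n)))
    rw [sub_self] at this
    exact this
  have hev := hd.eventually (Ioo_mem_nhds (neg_lt_zero.2 hpi) hpi)
  have hball := Metric.ball_mem_nhds c hr
  filter_upwards [hev, seenAngle_sides hab hc, (tendsto_add_smul c n).eventually hball,
    (tendsto_sub_smul c n).eventually hball, eventually_pos] with s h1 h2 h3 h4 hs
  have h5 : c + s • n ∉ P.curve := by
    rw [hb _ h3, add_sub_cancel_left, cross_smul]
    exact (mul_pos hs hpos).ne'
  have h6 : c - s • n ∉ P.curve := by
    rw [hb _ h4, sub_sub_cancel_left, cross_neg, cross_smul, neg_eq_zero]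
    exact (mul_pos hs hpos).ne'
  have h7 := P.wind_eq_of_lt (m := 1) h5 h6
  push_cast at h7
  rw [one_mul, hwind, hwind] at h7
  rw [hwind, hwind]
  have h8 : seenAngle (P.vtx k) (P.vtx (k + 1)) (c + s • n) ≤ Real.pi := Complex.arg_le_pi _
  have h9 : -Real.pi < seenAngle (P.vtx k) (P.vtx (k + 1)) (c - s • n) :=
    Complex.neg_pi_lt_arg _
  exact h7 (by linarith [h1.1, h2.1, h2.2]) (by linarith [h1.2, h2.1, h2.2])

end SimplePolygon

/-! ### The interior of a simple polygon -/

namespace SimplePolygon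

variable (P : SimplePolygon)

theorem exists_outside : ∃ x, x ∉ P.curve ∧ x ∉ P.inside := by
  set n : Plane := !₂[1, 0] with hn
  have hn0 : n ≠ 0 := fun h => by simpa [hn] using congrArg (fun x : Plane => x 0) h
  obtain ⟨C, hC⟩ := (P.finite_verts.image (cross n)).bddAbove
  have hC' : ∀ v ∈ P.verts, cross n v ≤ C := fun v hv => hC (mem_image_of_mem _ hv)
  have hx : cross n ((C + 1) • perp n) = C + 1 := by simp [cross, hn]
  refine ⟨(C + 1) • perp n, fun h => ?_, fun h => ?_⟩
  · have := P.cross_le_of_mem_curve hC' h; linarith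
  · have := P.cross_lt_of_mem_inside hn0 hC' h; linarith

theorem mem_inside_of_mem_comp {x y : Plane} (hy : y ∈ P.comp x) (h : y ∈ P.inside) :
    x ∈ P.inside := by
  have hx : x ∉ P.curve := fun hx => by
    rw [comp, connectedComponentIn_eq_empty (by simpa using hx)] at hy; exact hy
  have := P.comp_subset_inside h
  rw [comp, ← connectedComponentIn_eq hy] at this
  exact this (P.mem_comp hx)

/-- Let `A` and `B` be connected sets such that every component of the complement contains one of
them. If one point of `A` is inside, then `A` is inside, `B` is outside since some component is
unbounded, and every bounded component contains `A`. -/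
theorem inside_of_sides {A B : Set Plane} (hA : IsPreconnected A) (hAc : A ⊆ P.curveᶜ)
    {a : Plane} (ha : a ∈ A) (hai : a ∈ P.inside)
    (hB : B.Nonempty) (hAB : ∀ x, x ∉ P.curve → A ⊆ P.comp x ∨ B ⊆ P.comp x) :
    A ⊆ P.inside ∧ (∀ x ∈ B, x ∉ P.inside) ∧ ∀ x ∈ P.inside, A ⊆ P.comp x := by
  obtain ⟨x₀, hx₀, hx₀i⟩ := P.exists_outside
  have hAi := P.subset_inside hA hAc ha hai
  have hB₀ : B ⊆ P.comp x₀ := (hAB x₀ hx₀).resolve_left fun h =>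
    hx₀i (P.mem_inside_of_mem_comp (h ha) hai)
  have hBi : ∀ x ∈ B, x ∉ P.inside := fun x hx hxi =>
    hx₀i (P.mem_inside_of_mem_comp (hB₀ hx) hxi)
  refine ⟨hAi, hBi, fun x hx => (hAB x hx.1).resolve_right fun h => ?_⟩
  obtain ⟨b, hb⟩ := hB
  exact hBi b hb (P.comp_subset_inside hx (h hb))

/-- One side of an edge is inside and the other one is outside; `σ` is the orientation of the
polygon. The set `A` is the inner side: it lies in all bounded components at once, so there is
only one of them. -/
theorem exists_sides {k : ℕ} {c : Plane}
    (hc : c ∈ openSegment ℝ (P.vtx k) (P.vtx (k + 1))) :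
    ∃ r > 0, ∃ σ : ℝ, (σ = 1 ∨ σ = -1) ∧
      (∀ x ∈ Metric.ball c r, x ∈ P.curve ↔ cross (P.vtx (k + 1) - P.vtx k) (x - c) = 0) ∧
      (∀ x ∈ Metric.ball c r, 0 < σ * cross (P.vtx (k + 1) - P.vtx k) (x - c) → x ∈ P.inside) ∧
      (∀ x ∈ Metric.ball c r, σ * cross (P.vtx (k + 1) - P.vtx k) (x - c) < 0 →
        x ∉ P.inside) ∧
      (∀ x ∈ P.inside, P.wind x = σ * (2 * Real.pi)) ∧
      ∃ A : Set Plane, A.Nonempty ∧ ∀ x ∈ P.inside, A ⊆ P.comp x := by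
  have hedge : s(P.vtx k, P.vtx (k + 1)) ∈ P.edges := by rw [edges_eq]; exact ⟨k, rfl⟩
  obtain ⟨r, hr, hb⟩ := P.exists_ball_edge hedge hc
  set u := P.vtx (k + 1) - P.vtx k with hu
  have hpos := cross_perp_pos (sub_ne_zero.2 (P.vtx_succ_ne k).symm)
  rw [← hu] at hpos
  set A := Metric.ball c r ∩ {x | 0 < cross u (x - c)} with hAdef
  set B := Metric.ball c r ∩ {x | cross u (x - c) < 0} with hBdef
  have hA : IsPreconnected A := ((convex_ball c r).inter (convex_cross_lt u c 0)).isPreconnected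
  have hB : IsPreconnected B := ((convex_ball c r).inter (convex_lt_cross u c 0)).isPreconnected
  have hAc : A ⊆ P.curveᶜ := by
    rintro x ⟨hx, hx'⟩ hxc
    exact (show 0 < cross u (x - c) from hx').ne' ((hb x hx).1 hxc)
  have hBc : B ⊆ P.curveᶜ := by
    rintro x ⟨hx, hx'⟩ hxc
    exact (show cross u (x - c) < 0 from hx').ne ((hb x hx).1 hxc)
  have hcc : c ∈ P.curve := (hb c (Metric.mem_ball_self hr)).2 (by simp)
  have hAB : ∀ x, x ∉ P.curve → A ⊆ P.comp x ∨ B ⊆ P.comp x := by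
    intro x hx
    obtain ⟨y, hyb, hyU⟩ := mem_closure_iff.1 (P.curve_subset_closure_comp hx hcc) _
      Metric.isOpen_ball (Metric.mem_ball_self hr)
    rcases lt_trichotomy (cross u (y - c)) 0 with h | h | h
    · exact Or.inr (P.subset_comp hB hBc ⟨hyb, h⟩ hyU)
    · exact absurd ((hb y hyb).2 h) (P.comp_subset x hyU)
    · exact Or.inl (P.subset_comp hA hAc ⟨hyb, h⟩ hyU)
  have hball := Metric.ball_mem_nhds c hr
  obtain ⟨s, ⟨h1, h3, h4⟩, hs⟩ := (((P.eventually_wind_jump hc).and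
    (((tendsto_add_smul c (perp u)).eventually hball).and
    ((tendsto_sub_smul c (perp u)).eventually hball))).and eventually_pos).exists
  rw [← hu] at h1
  have ha : c + s • perp u ∈ A := ⟨h3, by
    simp only [mem_ofPred_eq]; rw [add_sub_cancel_left, cross_smul]; exact mul_pos hs hpos⟩
  have hb' : c - s • perp u ∈ B := ⟨h4, by
    simp only [mem_ofPred_eq]
    rw [sub_sub_cancel_left, cross_neg, cross_smul, neg_lt_zero]; exact mul_pos hs hpos⟩
  have hpi := Real.pi_pos
  -- the side that contains a point of the interior is the inner one, and the winding number on
  -- the interior is read off from the jump across the edge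
  by_cases hai : c + s • perp u ∈ P.inside
  · obtain ⟨hAi, hBi, hcomp⟩ := P.inside_of_sides hA hAc ha hai ⟨_, hb'⟩ hAB
    refine ⟨r, hr, 1, Or.inl rfl, hb, ?_, ?_, ?_, A, ⟨_, ha⟩, hcomp⟩
    · intro x hx h; rw [one_mul] at h; exact hAi ⟨hx, h⟩
    · intro x hx h; rw [one_mul] at h; exact hBi x ⟨hx, h⟩
    · intro x hx
      rw [P.wind_eq_zero (hBc hb') (hBi _ hb'), sub_zero] at h1
      rw [one_mul, ← h1]
      exact P.wind_eq_of_isPreconnected (P.isPreconnected_comp x) (P.comp_subset x)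
        (P.mem_comp hx.1) (hcomp x hx ha)
  · have hbi : c - s • perp u ∈ P.inside := by
      by_contra hbi
      rw [P.wind_eq_zero (hBc hb') hbi, P.wind_eq_zero (hAc ha) hai] at h1
      linarith
    obtain ⟨hBi, hAi, hcomp⟩ := P.inside_of_sides hB hBc hb' hbi ⟨_, ha⟩
      fun x hx => (hAB x hx).symm
    refine ⟨r, hr, -1, Or.inr rfl, hb, ?_, ?_, ?_, B, ⟨_, hb'⟩, hcomp⟩
    · intro x hx h; exact hBi ⟨hx, by simp only [mem_ofPred_eq]; linarith⟩
    · intro x hx h; exact hAi x ⟨hx, by simp only [mem_ofPred_eq]; linarith⟩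
    · intro x hx
      rw [P.wind_eq_zero (hAc ha) (hAi _ ha)] at h1
      have := P.wind_eq_of_isPreconnected (P.isPreconnected_comp x) (P.comp_subset x)
        (P.mem_comp hx.1) (hcomp x hx hb')
      linarith

theorem midpoint_mem_openSegment (a b : Plane) :
    (2⁻¹ : ℝ) • a + (2⁻¹ : ℝ) • b ∈ openSegment ℝ a b :=
  ⟨2⁻¹, 2⁻¹, by norm_num, by norm_num, by norm_num, rfl⟩

/-- On the interior the winding number is constant, equal to `1` or `-1`. -/
theorem exists_orientation :
    ∃ σ : ℝ, (σ = 1 ∨ σ = -1) ∧ ∀ x ∈ P.inside, P.wind x = σ * (2 * Real.pi) := by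
  obtain ⟨r, -, σ, hσ, -, -, -, h, -⟩ := P.exists_sides (k := 0) (midpoint_mem_openSegment _ _)
  exact ⟨σ, hσ, h⟩

/-- The interior is one component of the complement of the curve. -/
theorem comp_eq_inside {x : Plane} (hx : x ∈ P.inside) : P.comp x = P.inside := by
  refine (P.comp_subset_inside hx).antisymm fun y hy => ?_
  obtain ⟨r, -, σ, -, -, -, -, -, A, ⟨a, ha⟩, h⟩ :=
    P.exists_sides (k := 0) (midpoint_mem_openSegment _ _)
  have h1 := connectedComponentIn_eq (h x hx ha)
  have h2 := connectedComponentIn_eq (h y hy ha)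
  rw [comp, h1, ← h2]
  exact P.mem_comp hy.1

theorem inside_nonempty : P.inside.Nonempty := by
  have hmid := midpoint_mem_openSegment (P.vtx 0) (P.vtx (0 + 1))
  obtain ⟨r, hr, σ, hσ, -, h, -⟩ := P.exists_sides (k := 0) hmid
  set c := (2⁻¹ : ℝ) • P.vtx 0 + (2⁻¹ : ℝ) • P.vtx (0 + 1)
  set u := P.vtx (0 + 1) - P.vtx 0 with hu
  have hpos := cross_perp_pos (sub_ne_zero.2 (P.vtx_succ_ne 0).symm)
  have hball := Metric.ball_mem_nhds c hr
  obtain ⟨s, h3, hs⟩ := (((tendsto_add_smul c (σ • perp u)).eventually hball).and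
    eventually_pos).exists
  refine ⟨_, h _ h3 ?_⟩
  rw [add_sub_cancel_left, cross_smul, cross_smul]
  have : 0 < s * cross u (perp u) := mul_pos hs hpos
  rcases hσ with rfl | rfl <;> linarith

theorem isPreconnected_inside : IsPreconnected P.inside := by
  obtain ⟨x, hx⟩ := P.inside_nonempty
  rw [← P.comp_eq_inside hx]
  exact P.isPreconnected_comp x

theorem curve_subset_closure_inside : P.curve ⊆ closure P.inside := by
  obtain ⟨x, hx⟩ := P.inside_nonempty
  rw [← P.comp_eq_inside hx]
  exact P.curve_subset_closure_comp hx.1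

theorem isClosed_inside_union_curve : IsClosed (P.inside ∪ P.curve) := by
  rw [← isOpen_compl_iff, isOpen_iff_forall_mem_open]
  intro x hx
  simp only [mem_compl_iff, mem_union, not_or] at hx
  refine ⟨P.comp x, fun y hy => ?_, P.isOpen_comp x, P.mem_comp hx.2⟩
  simp only [mem_compl_iff, mem_union, not_or]
  exact ⟨fun h => hx.1 (P.mem_inside_of_mem_comp hy h), P.comp_subset x hy⟩

theorem closure_inside : closure P.inside = P.inside ∪ P.curve :=
  (closure_minimal subset_union_left P.isClosed_inside_union_curve).antisymm
    (union_subset subset_closure P.curve_subset_closure_inside)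

/-- Every point of the curve is a limit of points outside. -/
theorem curve_subset_closure_outside : P.curve ⊆ closure (P.inside ∪ P.curve)ᶜ := by
  obtain ⟨x, hx, hxi⟩ := P.exists_outside
  refine (P.curve_subset_closure_comp hx).trans (closure_mono fun y hy => ?_)
  simp only [mem_compl_iff, mem_union, not_or]
  exact ⟨fun h => hxi (P.mem_inside_of_mem_comp hy h), P.comp_subset x hy⟩

/-- The curve is the boundary of the interior, so that it is determined by the interior. -/
theorem curve_eq_of_inside_eq {P Q : SimplePolygon} (h : P.inside = Q.inside) :
    P.curve = Q.curve := by
  have key : ∀ R : SimplePolygon, R.curve = closure R.inside \ R.inside := by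
    intro R
    rw [closure_inside, union_sdiff_left]
    exact (sdiff_eq_left.2 (disjoint_left.2 fun x hx hi => hi.1 hx)).symm
  rw [key P, key Q, h]

end SimplePolygon

/-! ### Splitting a polygon along a diagonal -/

theorem Plane.openSegment_nonempty (a b : Plane) : (openSegment ℝ a b).Nonempty :=
  ⟨_, SimplePolygon.midpoint_mem_openSegment a b⟩

namespace SimplePolygon

variable (P : SimplePolygon)

theorem vtx_add_eq_iff {i k l : ℕ} (hk : k < P.n) (hl : l < P.n) :
    P.vtx (i + k) = P.vtx (i + l) ↔ k = l := by
  refine ⟨fun h => ?_, fun h => by rw [h]⟩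
  have : k ≡ l [MOD P.n] := Nat.ModEq.add_left_cancel' i (P.vtx_eq_iff.1 h)
  rwa [Nat.ModEq, Nat.mod_eq_of_lt hk, Nat.mod_eq_of_lt hl] at this

theorem mod_add_eq_iff {i k l : ℕ} (hk : k < P.n) (hl : l < P.n) :
    (i + k) % P.n = (i + l) % P.n ↔ k = l := by
  rw [← P.vtx_eq_iff, P.vtx_add_eq_iff hk hl]

theorem edge_mem_edges (k : ℕ) : s(P.vtx k, P.vtx (k + 1)) ∈ P.edges := by
  rw [edges_eq]; exact ⟨k, rfl⟩

theorem exists_add_eq (i j : ℕ) : ∃ k < P.n, P.vtx (i + k) = P.vtx j := by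
  have hn := P.n_pos
  refine ⟨(j + (P.n - i % P.n)) % P.n, Nat.mod_lt _ hn, P.vtx_congr ?_⟩
  have h1 : i % P.n < P.n := Nat.mod_lt _ hn
  have h2 : i + (j + (P.n - i % P.n)) = j + P.n * (i / P.n + 1) := by
    have := Nat.div_add_mod i P.n
    rw [mul_add, mul_one]; omega
  rw [Nat.add_mod_mod, h2, Nat.add_mul_mod_self_left]

theorem mem_edges_iff (i : ℕ) {s : Seg} :
    s ∈ P.edges ↔ ∃ k < P.n, s = s(P.vtx (i + k), P.vtx (i + k + 1)) := by
  constructor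
  · rw [edges_eq]
    rintro ⟨j, rfl⟩
    obtain ⟨k, hk, h⟩ := P.exists_add_eq i j
    refine ⟨k, hk, ?_⟩
    have h2 : P.vtx (i + k + 1) = P.vtx (j + 1) :=
      P.vtx_eq_iff.2 (Nat.ModEq.add_right 1 (P.vtx_eq_iff.1 h))
    simp only [h, h2]
  · rintro ⟨k, -, rfl⟩
    exact P.edge_mem_edges _

theorem mem_verts_iff (i : ℕ) {x : Plane} : x ∈ P.verts ↔ ∃ k < P.n, x = P.vtx (i + k) := by
  constructor
  · rintro ⟨j, rfl⟩
    obtain ⟨k, hk, h⟩ := P.exists_add_eq i j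
    exact ⟨k, hk, h.symm⟩
  · rintro ⟨k, -, rfl⟩; exact P.vtx_mem_verts _

theorem mem_diagonals {d : Seg} : d ∈ P.diagonals ↔
    ∃ a ∈ P.verts, ∃ b ∈ P.verts, a ≠ b ∧ d = s(a, b) ∧ openSegment ℝ a b ⊆ P.inside := by
  simp only [diagonals, Finset.mem_image, Finset.mem_filter, Finset.mem_univ, true_and,
    Prod.exists]
  simp only [IsDiagonal, IsChord, relInterior_mk]
  constructor
  · rintro ⟨i, j, ⟨⟨hij, -, -⟩, hsub⟩, rfl⟩
    exact ⟨_, ⟨i, (P.toPolygon_eq_vtx i).symm⟩, _, ⟨j, (P.toPolygon_eq_vtx j).symm⟩,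
      fun h => hij (P.injective h), rfl, hsub⟩
  · rintro ⟨_, ⟨i, rfl⟩, _, ⟨j, rfl⟩, hij, rfl, hsub⟩
    have key : ∀ {s : Seg}, s.relInterior ⊆ P.inside → s ∉ P.edges := by
      intro s hs he
      induction s using Sym2.ind with
      | _ a b =>
        obtain ⟨x, hx⟩ := openSegment_nonempty a b
        exact (hs hx).1 (P.carrier_subset_curve he (openSegment_subset_segment _ _ _ hx))
    have hedge : ∀ i : Fin P.n, s(P.toPolygon i, P.toPolygon (finRotate P.n i)) ∈ P.edges :=
      fun i => ⟨i, rfl⟩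
    refine ⟨⟨i % P.n, Nat.mod_lt _ P.n_pos⟩, ⟨j % P.n, Nat.mod_lt _ P.n_pos⟩,
      ⟨⟨fun h => hij (by unfold vtx; rw [h]), fun h => ?_, fun h => ?_⟩, hsub⟩, rfl⟩
    · have := hedge ⟨i % P.n, Nat.mod_lt _ P.n_pos⟩
      rw [h] at this
      exact key (s := s(P.vtx i, P.vtx j)) hsub this
    · have := hedge ⟨j % P.n, Nat.mod_lt _ P.n_pos⟩
      rw [h, Sym2.eq_swap] at this
      exact key (s := s(P.vtx i, P.vtx j)) hsub this

theorem notMem_edges_of_mem_diagonals {d : Seg} (hd : d ∈ P.diagonals) : d ∉ P.edges := by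
  obtain ⟨a, -, b, -, -, rfl, hsub⟩ := P.mem_diagonals.1 hd
  intro he
  obtain ⟨x, hx⟩ := openSegment_nonempty a b
  exact (hsub hx).1 (P.carrier_subset_curve he (openSegment_subset_segment _ _ _ hx))

theorem relInterior_subset_inside {d : Seg} (hd : d ∈ P.diagonals) :
    d.relInterior ⊆ P.inside := by
  obtain ⟨a, -, b, -, -, rfl, hsub⟩ := P.mem_diagonals.1 hd
  exact hsub

/-- A diagonal joins vertex `i` to vertex `i + m` for some `m` between `2` and `n - 2`. -/
theorem exists_index_of_mem_diagonals {d : Seg} (hd : d ∈ P.diagonals) :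
    ∃ i m, 2 ≤ m ∧ m + 2 ≤ P.n ∧ d = s(P.vtx i, P.vtx (i + m)) := by
  have hne := P.notMem_edges_of_mem_diagonals hd
  obtain ⟨_, ⟨i, rfl⟩, b, hb, hab, rfl, hsub⟩ := P.mem_diagonals.1 hd
  obtain ⟨m, hm, rfl⟩ := (P.mem_verts_iff i).1 hb
  refine ⟨i, m, ?_, ?_, rfl⟩
  · by_contra! h
    interval_cases m
    · exact hab rfl
    · exact hne (P.edge_mem_edges i)
  · by_contra! h
    have hm' : m + 1 = P.n := by omega
    apply hne
    have := P.edge_mem_edges (i + m)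
    rw [add_assoc, hm', P.vtx_add_n, Sym2.eq_swap] at this
    exact this

/-- The polygon cut off by the chord from vertex `i` to vertex `i + m`. -/
noncomputable def arc (i m : ℕ) (hm : 2 ≤ m) (hmn : m < P.n)
    (hd : Disjoint (openSegment ℝ (P.vtx i) (P.vtx (i + m))) P.curve) : SimplePolygon :=
  ofSeq (m + 1) (by omega) (fun k => P.vtx (i + k))
    (fun k hk l hl h => (P.vtx_add_eq_iff (by omega) (by omega)).1 h)
    (fun j hj k hk l hl hjk hkl hjl => P.cross_ne_zero (P.vtx_mem_verts _) (P.vtx_mem_verts _)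
      (P.vtx_mem_verts _) (fun h => hjk ((P.vtx_add_eq_iff (by omega) (by omega)).1 h))
      (fun h => hkl ((P.vtx_add_eq_iff (by omega) (by omega)).1 h))
      (fun h => hjl ((P.vtx_add_eq_iff (by omega) (by omega)).1 h)))
    (by
      intro k l hkl hl x hxk hxl
      have hne : (i + k) % P.n ≠ (i + l) % P.n := fun h =>
        hkl.ne ((P.mod_add_eq_iff (by omega) (by omega)).1 h)
      rcases P.eq_of_mem_edge hne hxk hxl with ⟨h, hx⟩ | ⟨h, hx⟩
      · rw [add_assoc, P.mod_add_eq_iff (by omega) (by omega)] at h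
        exact ⟨h.symm, hx⟩
      · rw [add_assoc, P.mod_add_eq_iff (by omega) (by omega)] at h
        omega)
    (by
      intro k hk x hxk hxd
      rw [Nat.add_sub_cancel, add_zero, segment_symm, ← insert_endpoints_openSegment] at hxd
      rw [Nat.add_sub_cancel, add_zero]
      rcases hxd with rfl | rfl | hxd
      · right
        have := P.mem_of_vertex_mem_carrier (P.edge_mem_edges (i + k)) (P.vtx_mem_verts i) hxk
        rcases Sym2.mem_iff.1 this with h | h
        · exact ⟨((P.vtx_add_eq_iff (k := 0) P.n_pos (by omega)).1 h).symm, rfl⟩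
        · have := (P.vtx_add_eq_iff (k := 0) (l := k + 1) P.n_pos (by omega)).1 h
          omega
      · left
        have := P.mem_of_vertex_mem_carrier (P.edge_mem_edges (i + k))
          (P.vtx_mem_verts (i + m)) hxk
        rcases Sym2.mem_iff.1 this with h | h
        · have := (P.vtx_add_eq_iff (by omega) (by omega)).1 h
          omega
        · exact ⟨((P.vtx_add_eq_iff (l := k + 1) (by omega) (by omega)).1 h).symm, rfl⟩
      · exact absurd (P.edge_subset_curve _ hxk) (disjoint_left.1 hd hxd))

section arc

variable {P} {i m : ℕ} {hm : 2 ≤ m} {hmn : m < P.n}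
  {hd : Disjoint (openSegment ℝ (P.vtx i) (P.vtx (i + m))) P.curve}

@[simp] theorem arc_n : (P.arc i m hm hmn hd).n = m + 1 := rfl

theorem arc_vtx {k : ℕ} (hk : k ≤ m) : (P.arc i m hm hmn hd).vtx k = P.vtx (i + k) :=
  ofSeq_vtx (by omega)

theorem arc_vtx_succ : (P.arc i m hm hmn hd).vtx (m + 1) = P.vtx i := ofSeq_vtx_self

theorem mem_arc_verts {x : Plane} :
    x ∈ (P.arc i m hm hmn hd).verts ↔ ∃ k ≤ m, x = P.vtx (i + k) := by
  rw [mem_verts_iff _ 0]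
  constructor
  · rintro ⟨k, hk, rfl⟩
    rw [arc_n] at hk
    exact ⟨k, by omega, by rw [zero_add, arc_vtx (by omega)]⟩
  · rintro ⟨k, hk, rfl⟩
    exact ⟨k, by rw [arc_n]; omega, by rw [zero_add, arc_vtx hk]⟩

theorem mem_arc_edges {s : Seg} : s ∈ (P.arc i m hm hmn hd).edges ↔
    (∃ k < m, s = s(P.vtx (i + k), P.vtx (i + k + 1))) ∨ s = s(P.vtx i, P.vtx (i + m)) := by
  rw [mem_edges_iff _ 0]
  constructor
  · rintro ⟨k, hk, rfl⟩
    rw [arc_n] at hk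
    rw [zero_add]
    rcases Nat.lt_or_ge k m with h | h
    · left
      exact ⟨k, h, by rw [arc_vtx (by omega), arc_vtx (by omega)]; rfl⟩
    · obtain rfl : k = m := by omega
      right
      rw [arc_vtx_succ, arc_vtx le_rfl, Sym2.eq_swap]
  · rintro (⟨k, hk, rfl⟩ | rfl)
    · exact ⟨k, by rw [arc_n]; omega, by
        rw [zero_add, arc_vtx (by omega), arc_vtx (by omega)]; rfl⟩
    · exact ⟨m, by rw [arc_n]; omega, by
        rw [zero_add, arc_vtx_succ, arc_vtx le_rfl, Sym2.eq_swap]⟩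

theorem arc_wind (x : Plane) : (P.arc i m hm hmn hd).wind x =
    ∑ k ∈ Finset.range m, seenAngle (P.vtx (i + k)) (P.vtx (i + k + 1)) x +
      seenAngle (P.vtx (i + m)) (P.vtx i) x := by
  rw [wind, arc_n, Finset.sum_range_succ, arc_vtx_succ, arc_vtx le_rfl]
  congr 1
  refine Finset.sum_congr rfl fun k hk => ?_
  rw [Finset.mem_range] at hk
  rw [arc_vtx (by omega), arc_vtx (by omega)]; rfl

end arc

theorem wind_eq_sum_shift (i : ℕ) (x : Plane) : P.wind x =
    ∑ k ∈ Finset.range P.n, seenAngle (P.vtx (i + k)) (P.vtx (i + k + 1)) x := by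
  induction i with
  | zero => simp [wind]
  | succ i ih =>
    rw [ih]
    set f : ℕ → ℝ := fun k => seenAngle (P.vtx (i + k)) (P.vtx (i + k + 1)) x with hf
    have h1 : f P.n = f 0 := by
      simp only [hf, P.vtx_add_n, add_zero]
      rw [add_right_comm, P.vtx_add_n]
    have h2 := Finset.sum_range_succ f P.n
    rw [Finset.sum_range_succ', h1] at h2
    have h3 := add_right_cancel h2
    rw [← h3]
    refine Finset.sum_congr rfl fun k _ => ?_
    simp only [hf, add_assoc, add_comm 1]

/-- The diagonal `d` cuts `P` into the polygons `Q` and `R`. The fields are symmetric in `Q` and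
`R`, so every fact about `Q` has a counterpart for `R` through `IsSplit.symm`. -/
structure IsSplit (P : SimplePolygon) (d : Seg) (Q R : SimplePolygon) : Prop where
  n_add : Q.n + R.n = P.n + 2
  verts_union : Q.verts ∪ R.verts = P.verts
  verts_inter : ∀ x ∈ Q.verts, x ∈ R.verts → x ∈ d
  edges_union : Q.edges ∪ R.edges = insert d P.edges
  mem_left : d ∈ Q.edges
  mem_right : d ∈ R.edges
  inside_union : Q.inside ∪ R.inside = P.inside \ d.carrier
  disjoint : Disjoint Q.inside R.inside

theorem IsSplit.symm {P Q R : SimplePolygon} {d : Seg} (h : P.IsSplit d Q R) :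
    P.IsSplit d R Q where
  n_add := by rw [add_comm]; exact h.n_add
  verts_union := by rw [union_comm]; exact h.verts_union
  verts_inter := fun x hx hx' => h.verts_inter x hx' hx
  edges_union := by rw [union_comm]; exact h.edges_union
  mem_left := h.mem_right
  mem_right := h.mem_left
  inside_union := by rw [union_comm]; exact h.inside_union
  disjoint := h.disjoint.symm

theorem curve_union_of_edges {P Q R : SimplePolygon} {d : Seg}
    (h : Q.edges ∪ R.edges = insert d P.edges) : Q.curve ∪ R.curve = P.curve ∪ d.carrier := by
  have key : ∀ S : SimplePolygon, S.curve = ⋃ s ∈ S.edges, s.carrier := by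
    intro S
    ext x
    simp only [mem_iUnion]
    exact ⟨fun hx => by simpa using S.exists_edge_of_mem_curve hx,
      fun ⟨s, hs, hx⟩ => S.carrier_subset_curve hs hx⟩
  rw [key P, key Q, key R, ← biUnion_union, h, biUnion_insert, union_comm]

/-- Off the curve the winding number takes only two values. -/
theorem wind_eq_or {P : SimplePolygon} {σ : ℝ}
    (hσ : ∀ x ∈ P.inside, P.wind x = σ * (2 * Real.pi)) {x : Plane} (hx : x ∉ P.curve) :
    P.wind x = 0 ∨ P.wind x = σ * (2 * Real.pi) := by
  by_cases h : x ∈ P.inside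
  · exact Or.inr (hσ x h)
  · exact Or.inl (P.wind_eq_zero hx h)

theorem mem_inside_of_wind_ne_zero {x : Plane} (hx : x ∉ P.curve) (h : P.wind x ≠ 0) :
    x ∈ P.inside := by
  by_contra hn
  exact h (P.wind_eq_zero hx hn)

/-- The interiors of the two parts, from the additivity of winding numbers and the jump of one of
them across the common edge. -/
theorem inside_union_of_wind {P Q R : SimplePolygon} {a b : Plane}
    (hsub : openSegment ℝ a b ⊆ P.inside)
    (hedges : Q.edges ∪ R.edges = insert s(a, b) P.edges)
    (hQ : s(a, b) ∈ Q.edges) (hR : s(a, b) ∈ R.edges)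
    (hwind : ∀ x ∉ segment ℝ a b, Q.wind x + R.wind x = P.wind x)
    (hjump : ∀ c ∈ openSegment ℝ a b, ∃ n, cross (b - a) n ≠ 0 ∧ ∀ᶠ s : ℝ in 𝓝[>] 0,
      Q.wind (c + s • n) - Q.wind (c - s • n) = 2 * Real.pi) :
    Q.inside ∪ R.inside = P.inside \ segment ℝ a b ∧ Disjoint Q.inside R.inside := by
  have hcurve := curve_union_of_edges hedges
  rw [carrier_mk] at hcurve
  have hoff : ∀ x, x ∉ P.curve → x ∉ segment ℝ a b → x ∉ Q.curve ∧ x ∉ R.curve := by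
    intro x hx hx'
    constructor
    · intro h
      rcases hcurve.subset (Or.inl h) with h | h
      exacts [hx h, hx' h]
    · intro h
      rcases hcurve.subset (Or.inr h) with h | h
      exacts [hx h, hx' h]
  obtain ⟨σ, hσ, hP⟩ := P.exists_orientation
  obtain ⟨σq, hσq, hQw⟩ := Q.exists_orientation
  obtain ⟨σr, hσr, hRw⟩ := R.exists_orientation
  have hpi := Real.pi_pos
  -- The three polygons have the same orientation: near a point of the common edge the winding
  -- number of `P` is constant, while the one of `Q` jumps by one turn, and each winding number
  -- takes only two values.
  obtain ⟨rfl, rfl⟩ : σq = σ ∧ σr = σ := by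
    obtain ⟨c, hc⟩ := openSegment_nonempty a b
    obtain ⟨n, hn, hj⟩ := hjump c hc
    have hnhd : P.inside ∈ 𝓝 c := P.isOpen_inside.mem_nhds (hsub hc)
    obtain ⟨s, ⟨h1, h2, h3⟩, hs⟩ := ((hj.and (((tendsto_add_smul c n).eventually hnhd).and
      ((tendsto_sub_smul c n).eventually hnhd))).and eventually_pos).exists
    have hcc := cross_eq_zero_of_mem_segment (openSegment_subset_segment ℝ a b hc)
    have hplus : c + s • n ∉ segment ℝ a b := by
      intro h
      have := cross_eq_zero_of_mem_segment h
      rw [add_sub_right_comm, cross_add, hcc, cross_smul, zero_add] at this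
      exact (mul_ne_zero hs.ne' hn) this
    have hminus : c - s • n ∉ segment ℝ a b := by
      intro h
      have := cross_eq_zero_of_mem_segment h
      rw [sub_right_comm, cross_sub, hcc, cross_smul, zero_sub, neg_eq_zero] at this
      exact (mul_ne_zero hs.ne' hn) this
    have e1 := hwind _ hplus
    have e2 := hwind _ hminus
    rw [hP _ h2] at e1
    rw [hP _ h3] at e2
    obtain ⟨o1, o2⟩ := hoff _ h2.1 hplus
    obtain ⟨o3, o4⟩ := hoff _ h3.1 hminus
    have q1 := wind_eq_or hQw o1
    have q2 := wind_eq_or hQw o3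
    have r1 := wind_eq_or hRw o2
    have r2 := wind_eq_or hRw o4
    generalize Q.wind (c + s • n) = A at *
    generalize Q.wind (c - s • n) = B at *
    generalize R.wind (c + s • n) = C at *
    generalize R.wind (c - s • n) = D at *
    rcases hσ with rfl | rfl <;> rcases hσq with rfl | rfl <;> rcases hσr with rfl | rfl <;>
      first
        | exact ⟨rfl, rfl⟩
        | (exfalso; rcases q1 with q1 | q1 <;> rcases q2 with q2 | q2 <;>
            first
              | linarith
              | (rcases r1 with r1 | r1 <;> rcases r2 with r2 | r2 <;> linarith))
  have hσ0 : σr * (2 * Real.pi) ≠ 0 := by rcases hσ with rfl | rfl <;> norm_num [hpi.ne']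
  have hin : ∀ x, x ∉ P.curve → x ∉ segment ℝ a b →
      (x ∈ P.inside ↔ x ∈ Q.inside ∨ x ∈ R.inside) ∧ ¬ (x ∈ Q.inside ∧ x ∈ R.inside) := by
    intro x hx hx'
    obtain ⟨hq, hr⟩ := hoff x hx hx'
    have hw := hwind x hx'
    by_cases h1 : x ∈ Q.inside <;> by_cases h2 : x ∈ R.inside
    · exfalso
      rw [hQw x h1, hRw x h2] at hw
      rcases wind_eq_or hP hx with h | h <;> rw [h] at hw <;> apply hσ0 <;> linarith
    · rw [hQw x h1, R.wind_eq_zero hr h2, add_zero] at hw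
      have := P.mem_inside_of_wind_ne_zero hx (by rw [← hw]; exact hσ0)
      simp [h1, h2, this]
    · rw [hRw x h2, Q.wind_eq_zero hq h1, zero_add] at hw
      have := P.mem_inside_of_wind_ne_zero hx (by rw [← hw]; exact hσ0)
      simp [h1, h2, this]
    · rw [Q.wind_eq_zero hq h1, R.wind_eq_zero hr h2, add_zero] at hw
      have : x ∉ P.inside := fun h => hσ0 (by rw [← hP x h, ← hw])
      simp [h1, h2, this]
  have hcl : IsClosed (segment ℝ a b) := (isCompact_segment a b).isClosed
  -- a part does not meet the curve of `P`, because points outside `P` accumulate there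
  have hpart : ∀ S : SimplePolygon, S = Q ∨ S = R → s(a, b) ∈ S.edges →
      S.inside ⊆ P.curveᶜ ∩ (segment ℝ a b)ᶜ := by
    intro S hS hd x hx
    have hxd : x ∉ segment ℝ a b := fun h => hx.1 (S.carrier_subset_curve hd h)
    refine ⟨fun hxc => ?_, hxd⟩
    obtain ⟨y, hy, hyo⟩ := mem_closure_iff.1 (P.curve_subset_closure_outside hxc)
      (S.inside ∩ (segment ℝ a b)ᶜ) (S.isOpen_inside.inter hcl.isOpen_compl) ⟨hx, hxd⟩
    simp only [mem_compl_iff, mem_union, not_or] at hyo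
    apply hyo.1
    rw [(hin y hyo.2 hy.2).1]
    rcases hS with rfl | rfl
    exacts [Or.inl hy.1, Or.inr hy.1]
  have hQ' := hpart Q (Or.inl rfl) hQ
  have hR' := hpart R (Or.inr rfl) hR
  constructor
  · ext x
    constructor
    · rintro (hx | hx)
      · exact ⟨(hin x (hQ' hx).1 (hQ' hx).2).1.2 (Or.inl hx), (hQ' hx).2⟩
      · exact ⟨(hin x (hR' hx).1 (hR' hx).2).1.2 (Or.inr hx), (hR' hx).2⟩
    · rintro ⟨hx, hx'⟩
      exact (hin x hx.1 hx').1.1 hx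
  · rw [disjoint_left]
    intro x hx hx'
    exact (hin x (hQ' hx).1 (hQ' hx).2).2 ⟨hx, hx'⟩

/-- Every diagonal cuts the polygon into two polygons: `Q` has the vertices `i, …, i + m`, and `R`
the vertices `i + m, …, i + n`. Their winding numbers add up to the one of `P`, since the common
edge is run through in opposite directions. -/
theorem exists_isSplit_arc {i m : ℕ} (hm : 2 ≤ m) (hmn : m + 2 ≤ P.n)
    (hd : s(P.vtx i, P.vtx (i + m)) ∈ P.diagonals) :
    ∃ Q R : SimplePolygon, P.IsSplit s(P.vtx i, P.vtx (i + m)) Q R ∧ Q.n = m + 1 ∧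
      (∀ k ≤ m, Q.vtx k = P.vtx (i + k)) ∧
      ∀ x, x ∈ R.verts ↔ ∃ k, m ≤ k ∧ k ≤ P.n ∧ x = P.vtx (i + k) := by
  have hsub : openSegment ℝ (P.vtx i) (P.vtx (i + m)) ⊆ P.inside := P.relInterior_subset_inside hd
  have hd1 : Disjoint (openSegment ℝ (P.vtx i) (P.vtx (i + m))) P.curve :=
    disjoint_left.2 fun x hx hc => (hsub hx).1 hc
  have hend : P.vtx (i + m + (P.n - m)) = P.vtx i := by
    rw [show i + m + (P.n - m) = i + P.n by omega, P.vtx_add_n]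
  have hd2 : Disjoint (openSegment ℝ (P.vtx (i + m)) (P.vtx (i + m + (P.n - m)))) P.curve := by
    rw [hend, openSegment_symm]; exact hd1
  set Q := P.arc i m hm (by omega) hd1 with hQdef
  set R := P.arc (i + m) (P.n - m) (by omega) (by omega) hd2 with hRdef
  have hRv : ∀ x, x ∈ R.verts ↔ ∃ k, m ≤ k ∧ k ≤ P.n ∧ x = P.vtx (i + k) := by
    intro x
    rw [hRdef, mem_arc_verts]
    constructor
    · rintro ⟨k, hk, rfl⟩
      exact ⟨m + k, by omega, by omega, by rw [add_assoc]⟩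
    · rintro ⟨k, hk, hk', rfl⟩
      exact ⟨k - m, by omega, by rw [show i + m + (k - m) = i + k by omega]⟩
  have hedges : Q.edges ∪ R.edges = insert s(P.vtx i, P.vtx (i + m)) P.edges := by
    ext s
    rw [mem_union, hQdef, hRdef, mem_arc_edges, mem_arc_edges, mem_insert_iff,
      P.mem_edges_iff i, hend]
    constructor
    · rintro ((⟨k, hk, rfl⟩ | rfl) | (⟨k, hk, rfl⟩ | rfl))
      · exact Or.inr ⟨k, by omega, rfl⟩
      · exact Or.inl rfl
      · exact Or.inr ⟨m + k, by omega, by rw [add_assoc i m k]⟩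
      · exact Or.inl Sym2.eq_swap
    · rintro (rfl | ⟨k, hk, rfl⟩)
      · exact Or.inl (Or.inr rfl)
      · rcases Nat.lt_or_ge k m with h | h
        · exact Or.inl (Or.inl ⟨k, h, rfl⟩)
        · exact Or.inr (Or.inl ⟨k - m, by omega, by
            rw [show i + m + (k - m) = i + k by omega]⟩)
  have hQm : s(P.vtx i, P.vtx (i + m)) ∈ Q.edges := mem_arc_edges.2 (Or.inr rfl)
  have hRm : s(P.vtx i, P.vtx (i + m)) ∈ R.edges :=
    mem_arc_edges.2 (Or.inr (by rw [hend, Sym2.eq_swap]))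
  obtain ⟨h1, h2⟩ := inside_union_of_wind (R := R) hsub hedges hQm hRm (fun x hx => by
      rw [hQdef, hRdef, arc_wind, arc_wind, hend, P.wind_eq_sum_shift i,
        seenAngle_swap (a := P.vtx i) (b := P.vtx (i + m)) hx]
      conv_rhs => rw [show P.n = m + (P.n - m) by omega, Finset.sum_range_add]
      simp only [add_assoc]
      ring) (fun c hc => by
      have hc' : c ∈ openSegment ℝ (Q.vtx m) (Q.vtx (m + 1)) := by
        rw [hQdef, arc_vtx le_rfl, arc_vtx_succ, openSegment_symm]; exact hc
      refine ⟨_, ?_, Q.eventually_wind_jump hc'⟩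
      have := cross_perp_pos (sub_ne_zero.2 (Q.vtx_succ_ne m).symm)
      rw [hQdef, arc_vtx le_rfl, arc_vtx_succ] at this ⊢
      rw [← neg_sub, cross_neg_left]
      exact neg_ne_zero.2 this.ne')
  refine ⟨Q, R, ⟨?_, ?_, ?_, hedges, hQm, hRm, h1, h2⟩, rfl, fun k hk => arc_vtx hk, hRv⟩
  · rw [hQdef, hRdef, arc_n, arc_n]; omega
  · ext x
    rw [mem_union, hRv, hQdef, mem_arc_verts, P.mem_verts_iff i]
    constructor
    · rintro (⟨k, hk, rfl⟩ | ⟨k, hk, hk', rfl⟩)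
      · exact ⟨k, by omega, rfl⟩
      · rcases hk'.lt_or_eq with h | rfl
        · exact ⟨k, h, rfl⟩
        · exact ⟨0, P.n_pos, by rw [P.vtx_add_n, add_zero]⟩
    · rintro ⟨k, hk, rfl⟩
      rcases Nat.lt_or_ge k m with h | h
      · exact Or.inl ⟨k, h.le, rfl⟩
      · exact Or.inr ⟨k, h, hk.le, rfl⟩
  · intro x hx hx'
    rw [hQdef, mem_arc_verts] at hx
    rw [hRv] at hx'
    obtain ⟨k, hk, rfl⟩ := hx
    obtain ⟨l, hl, hln, h⟩ := hx'
    rw [Sym2.mem_iff]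
    rcases hln.lt_or_eq with h' | rfl
    · have := (P.vtx_add_eq_iff (by omega) h').1 h
      right; congr 2; omega
    · left; rw [h, P.vtx_add_n]

theorem exists_isSplit {d : Seg} (hd : d ∈ P.diagonals) :
    ∃ Q R : SimplePolygon, P.IsSplit d Q R := by
  obtain ⟨i, m, hm, hmn, rfl⟩ := P.exists_index_of_mem_diagonals hd
  obtain ⟨Q, R, h, -⟩ := P.exists_isSplit_arc hm hmn hd
  exact ⟨Q, R, h⟩

end SimplePolygon

/-! ### Regions and diagonals of the two parts -/

theorem Seg.relInterior_nonempty (s : Seg) : s.relInterior.Nonempty := by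
  induction s using Sym2.ind with
  | _ a b => exact openSegment_nonempty a b

theorem connectedComponentIn_union_left {A B : Set Plane} (hA : IsOpen A) (hB : IsOpen B)
    (hAB : Disjoint A B) {x : Plane} (hx : x ∈ A) :
    connectedComponentIn (A ∪ B) x = connectedComponentIn A x := by
  refine Subset.antisymm ?_ (connectedComponentIn_mono x subset_union_left)
  refine isPreconnected_connectedComponentIn.subset_connectedComponentIn
    (mem_connectedComponentIn (Or.inl hx)) ?_
  exact isPreconnected_connectedComponentIn.subset_left_of_subset_union hA hB hAB
    (connectedComponentIn_subset _ _) ⟨x, mem_connectedComponentIn (Or.inl hx), hx⟩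

namespace SimplePolygon

/-- The interior of the polygon with the segments of `I` removed. -/
def region (P : SimplePolygon) (I : Finset Seg) : Set Plane := P.inside \ ⋃ s ∈ I, carrier s

theorem mem_pieces {P : SimplePolygon} {I : Finset Seg} {U : Set Plane} :
    U ∈ P.pieces I ↔ ∃ x ∈ P.region I, U = connectedComponentIn (P.region I) x := Iff.rfl

theorem isOpen_region (P : SimplePolygon) (I : Finset Seg) : IsOpen (P.region I) :=
  P.isOpen_inside.sdiff (isClosed_biUnion_finset fun s _ => s.isClosed_carrier)

theorem mem_region {P : SimplePolygon} {I : Finset Seg} {x : Plane} :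
    x ∈ P.region I ↔ x ∈ P.inside ∧ ∀ s ∈ I, x ∉ s.carrier := by
  simp [region]

theorem region_empty (P : SimplePolygon) : P.region ∅ = P.inside := by simp [region]

theorem pieces_empty (P : SimplePolygon) : P.pieces ∅ = {P.inside} := by
  have key : ∀ x ∈ P.inside, connectedComponentIn P.inside x = P.inside := fun x hx =>
    P.isPreconnected_inside.connectedComponentIn hx
  ext U
  rw [mem_pieces, region_empty, mem_singleton_iff]
  constructor
  · rintro ⟨x, hx, rfl⟩; exact key x hx
  · rintro rfl
    obtain ⟨x, hx⟩ := P.inside_nonempty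
    exact ⟨x, hx, (key x hx).symm⟩

theorem subset_region_of_mem_pieces {P : SimplePolygon} {I : Finset Seg} {U : Set Plane}
    (hU : U ∈ P.pieces I) : U ⊆ P.region I := by
  obtain ⟨x, hx, rfl⟩ := mem_pieces.1 hU
  exact connectedComponentIn_subset _ _

theorem carrier_subset_closure {P : SimplePolygon} {d : Seg} (hd : d ∈ P.diagonals) :
    d.carrier ⊆ closure P.inside :=
  d.carrier_subset_closure_relInterior.trans (closure_mono (P.relInterior_subset_inside hd))

theorem verts_subset_closure {P : SimplePolygon} : P.verts ⊆ closure P.inside :=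
  P.verts_subset_curve.trans P.curve_subset_closure_inside

namespace IsSplit

variable {P Q R : SimplePolygon} {d : Seg}

theorem inside_left (h : P.IsSplit d Q R) : Q.inside ⊆ P.inside \ d.carrier := by
  rw [← h.inside_union]; exact subset_union_left

theorem inside_subset (h : P.IsSplit d Q R) : Q.inside ⊆ P.inside :=
  h.inside_left.trans sdiff_subset

theorem verts_left (h : P.IsSplit d Q R) : Q.verts ⊆ P.verts := by
  rw [← h.verts_union]; exact subset_union_left

theorem n_lt (h : P.IsSplit d Q R) : Q.n < P.n := by
  have := h.n_add; have := R.three_le; omega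

theorem diagonals_left (h : P.IsSplit d Q R) {e : Seg} (he : e ∈ Q.diagonals) :
    e ∈ P.diagonals ∧ e ≠ d ∧ NonCrossing d e := by
  refine ⟨?_, ?_, ?_⟩
  · obtain ⟨a, ha, b, hb, hab, rfl, hsub⟩ := Q.mem_diagonals.1 he
    exact P.mem_diagonals.2 ⟨a, h.verts_left ha, b, h.verts_left hb, hab, rfl,
      hsub.trans h.inside_subset⟩
  · rintro rfl
    exact Q.notMem_edges_of_mem_diagonals he h.mem_left
  · exact disjoint_left.2 fun x hx hx' =>
      (h.inside_left (Q.relInterior_subset_inside he hx')).2 (d.relInterior_subset_carrier hx)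

/-- A vertex of `P` in the closure of one part is a vertex of that part. -/
theorem mem_verts_left (h : P.IsSplit d Q R) {v : Plane} (hv : v ∈ P.verts)
    (hcl : v ∈ closure Q.inside) : v ∈ Q.verts := by
  rw [Q.closure_inside] at hcl
  rcases hcl with hin | hc
  · exact absurd (P.verts_subset_curve hv) (h.inside_subset hin).1
  · obtain ⟨s, hs, hvs⟩ := Q.exists_edge_of_mem_curve hc
    obtain ⟨a, ha, b, hb, hab, rfl⟩ := Q.exists_of_mem_edges hs
    have := P.not_mem_openSegment_of_verts (h.verts_left ha) (h.verts_left hb) hv hab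
    rw [carrier_mk, ← insert_endpoints_openSegment] at hvs
    rcases hvs with rfl | rfl | h'
    exacts [ha, hb, absurd h' this]

theorem mem_diagonals_left (h : P.IsSplit d Q R) {e : Seg}
    (he : e ∈ P.diagonals) (hsub : e.relInterior ⊆ Q.inside) : e ∈ Q.diagonals := by
  obtain ⟨a, ha, b, hb, hab, rfl, -⟩ := P.mem_diagonals.1 he
  have hcl : ∀ x ∈ segment ℝ a b, x ∈ closure Q.inside := fun x hx =>
    closure_mono hsub (carrier_subset_closure_relInterior s(a, b) hx)
  exact Q.mem_diagonals.2 ⟨a, h.mem_verts_left ha (hcl a (left_mem_segment _ _ _)), b,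
    h.mem_verts_left hb (hcl b (right_mem_segment _ _ _)), hab, rfl, hsub⟩

/-- A diagonal of `P` that does not cross `d` is a diagonal of one of the two parts. -/
theorem diagonals_or (h : P.IsSplit d Q R) (hd : d ∈ P.diagonals) {e : Seg}
    (he : e ∈ P.diagonals) (hed : e ≠ d) (hnc : NonCrossing d e) :
    e ∈ Q.diagonals ∨ e ∈ R.diagonals := by
  have hsub : e.relInterior ⊆ Q.inside ∪ R.inside := by
    rw [h.inside_union]
    refine fun x hx => ⟨P.relInterior_subset_inside he hx, fun hxd => ?_⟩
    rw [carrier_eq] at hxd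
    rcases hxd with hxd | hxd
    · obtain ⟨a, ha, b, hb, hab, rfl, -⟩ := P.mem_diagonals.1 hd
      have hin := P.relInterior_subset_inside he hx
      rcases Sym2.mem_iff.1 hxd with rfl | rfl
      exacts [hin.1 (P.verts_subset_curve ha), hin.1 (P.verts_subset_curve hb)]
    · exact disjoint_left.1 hnc hxd hx
  rcases (e.convex_relInterior.isPreconnected).subset_or_subset Q.isOpen_inside R.isOpen_inside
    h.disjoint hsub with h' | h'
  · exact Or.inl (h.mem_diagonals_left he h')
  · exact Or.inr (h.symm.mem_diagonals_left he h')

theorem disjoint_diagonals (h : P.IsSplit d Q R) : Disjoint Q.diagonals R.diagonals := by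
  rw [Finset.disjoint_left]
  intro e he he'
  obtain ⟨x, hx⟩ := e.relInterior_nonempty
  exact disjoint_left.1 h.disjoint (Q.relInterior_subset_inside he hx)
    (R.relInterior_subset_inside he' hx)

theorem nonCrossing (h : P.IsSplit d Q R) {e f : Seg} (he : e ∈ Q.diagonals)
    (hf : f ∈ R.diagonals) : NonCrossing e f :=
  h.disjoint.mono (Q.relInterior_subset_inside he) (R.relInterior_subset_inside hf)

theorem disjoint_carrier (h : P.IsSplit d Q R) {e : Seg} (he : e ∈ R.diagonals) :
    Disjoint Q.inside e.carrier :=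
  (h.disjoint.closure_right Q.isOpen_inside).mono_right (carrier_subset_closure he)

open Classical in
theorem region_insert (h : P.IsSplit d Q R) {I I₁ I₂ : Finset Seg} (hI : I = insert d (I₁ ∪ I₂))
    (h₁ : I₁ ⊆ Q.diagonals) (h₂ : I₂ ⊆ R.diagonals) :
    P.region I = Q.region I₁ ∪ R.region I₂ := by
  subst hI
  ext x
  simp only [mem_region, mem_union, Finset.mem_insert, Finset.mem_union]
  constructor
  · rintro ⟨hx, hxI⟩
    have : x ∈ Q.inside ∪ R.inside := by
      rw [h.inside_union]; exact ⟨hx, hxI d (Or.inl rfl)⟩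
    rcases this with hq | hr
    · exact Or.inl ⟨hq, fun s hs => hxI s (Or.inr (Or.inl hs))⟩
    · exact Or.inr ⟨hr, fun s hs => hxI s (Or.inr (Or.inr hs))⟩
  · rintro (⟨hx, hxI⟩ | ⟨hx, hxI⟩)
    · refine ⟨h.inside_subset hx, ?_⟩
      rintro s (rfl | hs | hs)
      · exact (h.inside_left hx).2
      · exact hxI s hs
      · exact disjoint_left.1 (h.disjoint_carrier (h₂ hs)) hx
    · refine ⟨h.symm.inside_subset hx, ?_⟩
      rintro s (rfl | hs | hs)
      · exact (h.symm.inside_left hx).2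
      · exact disjoint_left.1 (h.symm.disjoint_carrier (h₁ hs)) hx
      · exact hxI s hs

theorem disjoint_region (h : P.IsSplit d Q R) (I₁ I₂ : Finset Seg) :
    Disjoint (Q.region I₁) (R.region I₂) := h.disjoint.mono sdiff_subset sdiff_subset

open Classical in
/-- The regions of a set of diagonals that contains `d` are the regions of the two parts. -/
theorem pieces_insert (h : P.IsSplit d Q R) {I I₁ I₂ : Finset Seg} (hI : I = insert d (I₁ ∪ I₂))
    (h₁ : I₁ ⊆ Q.diagonals) (h₂ : I₂ ⊆ R.diagonals) :
    P.pieces I = Q.pieces I₁ ∪ R.pieces I₂ := by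
  have hreg := h.region_insert hI h₁ h₂
  have hl : ∀ x ∈ Q.region I₁,
      connectedComponentIn (P.region I) x = connectedComponentIn (Q.region I₁) x := fun x hx => by
    rw [hreg]
    exact connectedComponentIn_union_left (Q.isOpen_region _) (R.isOpen_region _)
      (h.disjoint_region _ _) hx
  have hr : ∀ x ∈ R.region I₂,
      connectedComponentIn (P.region I) x = connectedComponentIn (R.region I₂) x := fun x hx => by
    rw [hreg, union_comm]
    exact connectedComponentIn_union_left (R.isOpen_region _) (Q.isOpen_region _)
      (h.disjoint_region _ _).symm hx
  ext U
  rw [mem_union, mem_pieces, mem_pieces, mem_pieces]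
  constructor
  · rintro ⟨x, hx, rfl⟩
    have hx' := hx
    rw [hreg] at hx'
    rcases hx' with hx' | hx'
    · exact Or.inl ⟨x, hx', hl x hx'⟩
    · exact Or.inr ⟨x, hx', hr x hx'⟩
  · rintro (⟨x, hx, rfl⟩ | ⟨x, hx, rfl⟩)
    · exact ⟨x, by rw [hreg]; exact Or.inl hx, (hl x hx).symm⟩
    · exact ⟨x, by rw [hreg]; exact Or.inr hx, (hr x hx).symm⟩

open Classical in
theorem isConvexPartition_insert (h : P.IsSplit d Q R) {I I₁ I₂ : Finset Seg}
    (hI : I = insert d (I₁ ∪ I₂)) (h₁ : I₁ ⊆ Q.diagonals) (h₂ : I₂ ⊆ R.diagonals) :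
    P.IsConvexPartition I ↔ Q.IsConvexPartition I₁ ∧ R.IsConvexPartition I₂ := by
  unfold IsConvexPartition
  rw [h.pieces_insert hI h₁ h₂]
  simp only [mem_union, or_imp, forall_and]

open Classical in
/-- A non-crossing set of diagonals that contains `d` consists of `d` and of diagonals of the two
parts. -/
theorem eq_insert (h : P.IsSplit d Q R) (hd : d ∈ P.diagonals) {I : Finset Seg}
    (hI : I ⊆ P.diagonals) (hdI : d ∈ I) (hnc : (I : Set Seg).Pairwise NonCrossing) :
    I = insert d (I ∩ Q.diagonals ∪ I ∩ R.diagonals) := by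
  ext e
  simp only [Finset.mem_insert, Finset.mem_union, Finset.mem_inter]
  constructor
  · intro he
    by_cases hed : e = d
    · exact Or.inl hed
    · rcases h.diagonals_or hd (hI he) hed (hnc hdI he (Ne.symm hed)) with h' | h'
      exacts [Or.inr (Or.inl ⟨he, h'⟩), Or.inr (Or.inr ⟨he, h'⟩)]
  · rintro (rfl | h' | h')
    exacts [hdI, h'.1, h'.1]

end IsSplit

end SimplePolygon

/-! ### Existence of diagonals and ears -/

namespace SimplePolygon

variable (P : SimplePolygon)

/-- At an extreme vertex, the interior is locally the convex sector between the two edges. -/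
theorem exists_ball_sector {v u w n : Plane} (hv : v ∈ P.verts) (hn : n ≠ 0)
    (hmax : ∀ x ∈ P.verts, cross n x ≤ cross n v) (hu : s(v, u) ∈ P.edges)
    (huv : u ∈ P.verts) (hwv : w ∈ P.verts)
    (hw : s(v, w) ∈ P.edges) (hD : 0 < cross (u - v) (w - v))
    (hvs : ∀ s ∈ P.edges, v ∈ s.carrier → s = s(v, u) ∨ s = s(v, w)) :
    ∃ r > 0, ∀ x ∈ Metric.ball v r, cross (w - v) (x - v) < 0 → 0 < cross (u - v) (x - v) →
      x ∈ P.inside := by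
  obtain ⟨r, hr, A, B, hAiff, hA, hB, hAc, hBc, hAB, -⟩ := P.exists_local_sides_vertex hu hw hD hvs
  refine ⟨r, hr, fun x hx h1 h2 => ?_⟩
  have hxA : x ∈ A := (hAiff x).2 ⟨hx, h1, h2⟩
  obtain ⟨y, hyb, hyi⟩ := mem_closure_iff.1
    (P.curve_subset_closure_inside (P.verts_subset_curve hv)) _ Metric.isOpen_ball
    (Metric.mem_ball_self hr)
  rcases hAB ⟨hyb, hyi.1⟩ with hyA | hyB
  · exact P.subset_inside hA hAc hyA hyi hxA
  · exfalso
    have hBi := P.subset_inside hB hBc hyB hyi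
    obtain ⟨s, hsb, hs⟩ := (((tendsto_add_smul v (perp n)).eventually
      (Metric.ball_mem_nhds v hr)).and eventually_pos).exists
    have hgt : cross n v < cross n (v + s • perp n) := by
      rw [cross_add, cross_smul]
      have := mul_pos hs (cross_perp_pos hn)
      linarith
    have hoff : v + s • perp n ∉ P.curve := fun h =>
      absurd (P.cross_le_of_mem_curve hmax h) (not_le.2 hgt)
    rcases hAB ⟨hsb, hoff⟩ with h | h
    · obtain ⟨-, h3, h4⟩ := (hAiff _).1 h
      have hrep := eq_smul_add_smul hD.ne' (v + s • perp n - v)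
      have i1 := hmax u huv
      have i2 := hmax w hwv
      have i3 : 0 < cross (v + s • perp n - v) (w - v) / cross (u - v) (w - v) :=
        div_pos (by rw [cross_swap]; linarith) hD
      have i4 : 0 < cross (u - v) (v + s • perp n - v) / cross (u - v) (w - v) := div_pos h4 hD
      generalize cross (v + s • perp n - v) (w - v) / cross (u - v) (w - v) = α at hrep i3
      generalize cross (u - v) (v + s • perp n - v) / cross (u - v) (w - v) = β at hrep i4
      have e := congrArg (cross n) hrep
      rw [cross_add n (α • (u - v)), cross_smul, cross_smul] at e
      simp only [cross_sub] at e
      nlinarith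
    · exact absurd (P.cross_lt_of_mem_inside hn hmax (hBi h)) (not_lt.2 hgt.le)

theorem cross_line (u v x y : Plane) (t : ℝ) :
    cross u (x + t • (y - x) - v) = (1 - t) * cross u (x - v) + t * cross u (y - v) := by
  simp [cross]; ring

/-- The triangle at an extreme vertex `v` with neighbours `u` and `w`: an edge that does not
contain `v` cannot leave it through the sides `v u` and `v w`. -/
theorem not_exit_triangle {v u w : Plane} (hu : s(v, u) ∈ P.edges) (hw : s(v, w) ∈ P.edges)
    (hD : 0 < cross (u - v) (w - v)) {a b x : Plane} (he : s(a, b) ∈ P.edges) (hva : v ∉ s(a, b))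
    (hx : x ∈ segment ℝ a b) (hA : cross (w - v) (x - v) < 0) (hB : 0 < cross (u - v) (x - v))
    (hH : cross (u - v) (x - v) - cross (w - v) (x - v) ≤ cross (u - v) (w - v))
    (ha : 0 < cross (w - v) (a - v) ∨ cross (u - v) (a - v) < 0)
    (hHa : cross (u - v) (a - v) - cross (w - v) (a - v) < cross (u - v) (w - v)) : False := by
  set p := u - v with hp
  set q := w - v with hq
  set D := cross p q with hDdef
  set g : ℝ → ℝ := fun t => min (-cross q (x + t • (a - x) - v)) (cross p (x + t • (a - x) - v))
    with hg
  have hgc : ContinuousOn g (Icc 0 1) := by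
    rw [hg]
    exact Continuous.continuousOn (Continuous.min (by fun_prop) (by fun_prop))
  have hg0 : 0 < g 0 := by simp only [hg, zero_smul, add_zero]; exact lt_min (by linarith) hB
  have hg1 : g 1 < 0 := by
    simp only [hg, one_smul, add_sub_cancel]
    rcases ha with h | h
    · exact (min_le_left _ _).trans_lt (by linarith)
    · exact (min_le_right _ _).trans_lt h
  obtain ⟨t, ⟨ht0, ht1⟩, hgt⟩ := intermediate_value_Icc' zero_le_one hgc
    (show (0 : ℝ) ∈ Icc (g 1) (g 0) from ⟨hg1.le, hg0.le⟩)
  have htpos : 0 < t := lt_of_le_of_ne ht0 fun h => by rw [← h] at hgt; linarith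
  set y := x + t • (a - x) with hy
  have hyseg : y ∈ segment ℝ a b := by
    have : y ∈ segment ℝ x a := by rw [segment_eq_image']; exact ⟨t, ⟨ht0, ht1⟩, rfl⟩
    exact (convex_segment a b).segment_subset hx (left_mem_segment _ _ _) this
  have hHy : cross p (y - v) - cross q (y - v) < D := by
    rw [hy, cross_line, cross_line]
    nlinarith
  have hyA : 0 ≤ -cross q (y - v) := by rw [← hgt]; exact min_le_left _ _
  have hyB : 0 ≤ cross p (y - v) := by rw [← hgt]; exact min_le_right _ _
  have hrep := eq_smul_add_smul hD.ne' (y - v)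
  rw [cross_swap q] at hrep
  have hyv : ∀ c : Plane, s(v, c) ∈ P.edges → y ∈ segment ℝ v c → y = c := by
    intro c hc hyc
    have hne : s(a, b) ≠ s(v, c) := fun h => hva (h ▸ Sym2.mem_mk_left v c)
    obtain ⟨h1, h2⟩ := P.mem_of_mem_carrier he hc hne hyseg hyc
    rcases Sym2.mem_iff.1 h2 with h | h
    · rw [h] at h1; exact absurd h1 hva
    · exact h
  rcases min_choice (-cross q (y - v)) (cross p (y - v)) with hc | hc
  · have h0 : -cross q (y - v) = 0 := by rw [← hc]; exact hgt
    rw [h0, zero_div, zero_smul, zero_add] at hrep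
    have hyw : y ∈ segment ℝ v w := by
      rw [segment_eq_image']
      refine ⟨cross p (y - v) / D, ⟨div_nonneg hyB hD.le, (div_le_one hD).2 (by linarith)⟩, ?_⟩
      change v + (cross p (y - v) / cross p q) • q = y
      rw [← hrep]; abel
    rw [hyv w hw hyw, ← hq, Plane.cross_self] at hHy
    simp only [hDdef] at hHy
    linarith
  · have h0 : cross p (y - v) = 0 := by rw [← hc]; exact hgt
    rw [h0, zero_div, zero_smul, add_zero] at hrep
    have hyu : y ∈ segment ℝ v u := by
      rw [segment_eq_image']
      refine ⟨-cross q (y - v) / D, ⟨div_nonneg hyA hD.le, (div_le_one hD).2 (by linarith)⟩, ?_⟩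
      change v + (-cross q (y - v) / cross p q) • p = y
      rw [← hrep]; abel
    rw [hyv u hu hyu, ← hp, Plane.cross_self, cross_swap p q] at hHy
    simp only [hDdef] at hHy
    linarith

/-- There is a diagonal at the vertex `v`, or one that joins its neighbours `u` and `w`. In
coordinates with respect to `u - v` and `w - v`, let `H` be the sum of the coordinates (times the
determinant `D`), so that the line `u w` is `H = D`, and let `z` be a vertex of `P`, other than
`v`, with minimal `H` among those in the triangle `v u w`. The curve does not meet the open
triangle `T` that is cut off at `v` by the parallel to `u w` through `z`. If `z` is in front of
the line `u w`, then `v z` is a diagonal, and otherwise `u w` is one. -/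
theorem exists_diagonal_of_extreme {v u w n : Plane} (hv : v ∈ P.verts)
    (hn : n ≠ 0) (hmax : ∀ x ∈ P.verts, cross n x ≤ cross n v) (hu : s(v, u) ∈ P.edges)
    (huv : u ∈ P.verts) (hwv : w ∈ P.verts)
    (hw : s(v, w) ∈ P.edges) (hD : 0 < cross (u - v) (w - v))
    (hvs : ∀ s ∈ P.edges, v ∈ s.carrier → s = s(v, u) ∨ s = s(v, w))
    (huw : s(u, w) ∉ P.edges) : P.diagonals.Nonempty := by
  obtain ⟨r, hr, hsector⟩ := P.exists_ball_sector hv hn hmax hu huv hwv hw hD hvs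
  have hqp : cross (w - v) (u - v) = -cross (u - v) (w - v) := cross_swap _ _
  have hne_uv : u ≠ v := by rintro rfl; simp [cross] at hD
  have hne_wv : w ≠ v := by rintro rfl; simp [cross] at hD
  have hne_uw : u ≠ w := by rintro rfl; simp at hD
  have hexit := fun {a b x : Plane} => P.not_exit_triangle hu hw hD (a := a) (b := b) (x := x)
  have hline := cross_line
  set p := u - v with hp
  set q := w - v with hq
  set D := cross p q with hDdef
  set H : Plane → ℝ := fun x => cross p (x - v) - cross q (x - v) with hH
  have hHline : ∀ x y t, H (x + t • (y - x)) = (1 - t) * H x + t * H y := by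
    intro x y t; simp only [hH, hline]; ring
  set S : Set Plane := {z ∈ P.verts | z ≠ v ∧ cross q (z - v) ≤ 0 ∧ 0 ≤ cross p (z - v) ∧ H z ≤ D}
    with hS
  have hHu : H u = D := by simp [hH, ← hp, hqp]
  have hHw : H w = D := by simp [hH, ← hq, hDdef]
  have huS : u ∈ S := ⟨huv, hne_uv, by rw [← hp, hqp]; linarith, by simp [← hp], hHu.le⟩
  obtain ⟨z, hzS, hzmin⟩ := Set.exists_min_image S H (P.finite_verts.subset (sep_subset _ _))
    ⟨u, huS⟩
  obtain ⟨hzv, hzne, hzA, hzB, hzD⟩ := hzS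
  have hzpos : 0 < H z := by
    refine lt_of_le_of_ne (by simp only [hH]; linarith) fun h0 => hzne ?_
    have e1 : cross p (z - v) = 0 := by simp only [hH] at h0; linarith
    have e2 : cross q (z - v) = 0 := by simp only [hH] at h0; linarith
    have hrep := eq_smul_add_smul hD.ne' (z - v)
    rw [cross_swap q, e1, e2, neg_zero, zero_div, zero_smul, zero_smul, add_zero] at hrep
    exact sub_eq_zero.1 hrep
  -- the edge through a point of the open cone at `v` does not contain `v`
  have hedge : ∀ x ∈ P.curve, cross q (x - v) < 0 → 0 < cross p (x - v) →
      ∃ a b, s(a, b) ∈ P.edges ∧ v ∉ s(a, b) ∧ x ∈ segment ℝ a b ∧ H a ≤ H x ∧ a ∈ P.verts ∧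
        b ∈ P.verts ∧ a ≠ b := by
    intro x hx h1 h2
    obtain ⟨s, hs, hxs⟩ := P.exists_edge_of_mem_curve hx
    have hvs' : v ∉ s := by
      intro h
      rcases hvs s hs (mem_carrier_of_mem h) with rfl | rfl
      · exact h2.ne' (cross_eq_zero_of_mem_segment hxs)
      · exact h1.ne (cross_eq_zero_of_mem_segment hxs)
    obtain ⟨a, ha, b, hb, hab, rfl⟩ := P.exists_of_mem_edges hs
    by_cases hle : H a ≤ H x
    · exact ⟨a, b, hs, hvs', hxs, hle, ha, hb, hab⟩
    · refine ⟨b, a, by rwa [Sym2.eq_swap], by rwa [Sym2.eq_swap], by rwa [segment_symm], ?_,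
        hb, ha, hab.symm⟩
      have hxs' : x ∈ segment ℝ a b := hxs
      rw [segment_eq_image'] at hxs'
      obtain ⟨t, ⟨h0, h1'⟩, hxt⟩ := hxs'
      simp only at hxt
      rw [← hxt, hHline] at hle ⊢
      have hlt : H b < H a := by by_contra! hge; nlinarith
      nlinarith
  -- an edge through the triangle does not have an end-point in front of `z`: inside the triangle
  -- this contradicts the choice of `z`, and outside it the edge would leave through a side at `v`
  have hout : ∀ x a b, s(a, b) ∈ P.edges → v ∉ s(a, b) → x ∈ segment ℝ a b →
      cross q (x - v) < 0 → 0 < cross p (x - v) → H x ≤ D → a ∈ P.verts → ¬ H a < H z := by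
    intro x a b he hvab hx h1 h2 hHx ha hlt
    by_cases hin : cross q (a - v) ≤ 0 ∧ 0 ≤ cross p (a - v)
    · have hav : a ≠ v := by rintro rfl; exact hvab (Sym2.mem_mk_left _ _)
      exact absurd (hzmin a ⟨ha, hav, hin.1, hin.2, (hlt.trans_le hzD).le⟩) (not_le.2 hlt)
    · refine hexit he hvab hx h1 h2 hHx ?_ (hlt.trans_le hzD)
      by_contra! hc
      exact hin hc
  set T : Set Plane := {x | cross q (x - v) < 0} ∩ {x | 0 < cross p (x - v)} ∩ {x | H x < H z}
    with hT
  have hTconv : Convex ℝ T := by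
    refine ((convex_lt_cross q v 0).inter (convex_cross_lt p v 0)).inter ?_
    have : {x | H x < H z} = {x | cross (p - q) (x - v) < H z} := by
      ext x; simp only [hH, cross, mem_ofPred_eq]
      rw [show (p 0 * (x - v) 1 - p 1 * (x - v) 0 - (q 0 * (x - v) 1 - q 1 * (x - v) 0)) =
        (p - q) 0 * (x - v) 1 - (p - q) 1 * (x - v) 0 by simp; ring]
    rw [this]
    exact convex_lt_cross _ _ _
  have hTc : T ⊆ P.curveᶜ := by
    rintro x ⟨⟨h1, h2⟩, h3⟩ hx
    simp only [mem_ofPred_eq] at h1 h2 h3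
    obtain ⟨a, b, he, hvab, hxs, hle, ha, hb, hab⟩ := hedge x hx h1 h2
    exact hout x a b he hvab hxs h1 h2 (h3.le.trans hzD) ha (hle.trans_lt h3)
  -- close to `v`, the triangle lies in the sector that is inside
  have hTi : T ⊆ P.inside := by
    have hsm : ∀ᶠ s : ℝ in 𝓝[>] 0, s < H z / (2 * D) :=
      nhdsWithin_le_nhds (gt_mem_nhds (by positivity))
    obtain ⟨s, ⟨hsb, hs2⟩, hs⟩ := (((tendsto_add_smul v (p + q)).eventually
      (Metric.ball_mem_nhds v hr)).and hsm |>.and eventually_pos).exists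
    rw [lt_div_iff₀ (by positivity)] at hs2
    have e1 : cross q (v + s • (p + q) - v) = -(s * D) := by
      rw [add_sub_cancel_left, cross_smul, cross_add, Plane.cross_self, hqp]; ring
    have e2 : cross p (v + s • (p + q) - v) = s * D := by
      rw [add_sub_cancel_left, cross_smul, cross_add, Plane.cross_self]; ring
    have hsD := mul_pos hs hD
    refine P.subset_inside hTconv.isPreconnected hTc
      (x := v + s • (p + q)) ⟨⟨?_, ?_⟩, ?_⟩ (hsector _ hsb ?_ ?_)
    · simp only [mem_ofPred_eq, e1]; linarith
    · simp only [mem_ofPred_eq, e2]; linarith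
    · simp only [mem_ofPred_eq, hH, e1, e2]; linarith
    · rw [e1]; linarith
    · rw [e2]; linarith
  rcases hzD.lt_or_eq with hlt | heq
  · have hzu : z ≠ u := by rintro rfl; exact hlt.ne hHu
    have hzw : z ≠ w := by rintro rfl; exact hlt.ne hHw
    have hzA' : cross q (z - v) < 0 :=
      lt_of_le_of_ne hzA (P.cross_ne_zero hv hwv hzv hne_wv.symm hzw.symm hzne.symm)
    have hzB' : 0 < cross p (z - v) :=
      lt_of_le_of_ne hzB (P.cross_ne_zero hv huv hzv hne_uv.symm hzu.symm hzne.symm).symm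
    refine ⟨s(v, z), P.mem_diagonals.2 ⟨v, hv, z, hzv, hzne.symm, rfl, fun x hx => hTi ?_⟩⟩
    rw [openSegment_eq_image'] at hx
    obtain ⟨t, ⟨h0, h1⟩, rfl⟩ := hx
    refine ⟨⟨?_, ?_⟩, ?_⟩
    · simp only [mem_ofPred_eq, add_sub_cancel_left, cross_smul]; nlinarith
    · simp only [mem_ofPred_eq, add_sub_cancel_left, cross_smul]; nlinarith
    · simp only [mem_ofPred_eq, hHline]
      have : H v = 0 := by simp [hH]
      rw [this]; nlinarith
  · refine ⟨s(u, w), P.mem_diagonals.2 ⟨u, huv, w, hwv, hne_uw, rfl, fun x hx => ?_⟩⟩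
    rw [openSegment_eq_image'] at hx
    obtain ⟨t, ⟨h0, h1⟩, rfl⟩ := hx
    set x := u + t • (w - u) with hxdef
    have hxA : cross q (x - v) < 0 := by
      rw [hxdef, hline, ← hp, ← hq, Plane.cross_self, hqp]; nlinarith
    have hxB : 0 < cross p (x - v) := by
      rw [hxdef, hline, ← hp, ← hq, Plane.cross_self, ← hDdef]; nlinarith
    have hxH : H x = D := by rw [hxdef, hHline, hHu, hHw]; ring
    -- an edge through `x` would lie on the line `u w`, hence be `u w`
    have hxoff : x ∉ P.curve := by
      intro hxc
      obtain ⟨a, b, he, hvab, hxs, hle, ha, hb, hab⟩ := hedge x hxc hxA hxB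
      have hHa : H a = D := le_antisymm (hle.trans hxH.le)
        (heq ▸ not_lt.1 (hout x a b he hvab hxs hxA hxB hxH.le ha))
      have hend : ∀ c ∈ P.verts, H c = D → c = u ∨ c = w := by
        intro c hc hHc
        by_contra! hcon
        refine P.cross_ne_zero huv hwv hc hne_uw hcon.2.symm hcon.1.symm ?_
        have : cross (w - u) (c - u) = D - H c := by
          simp only [hDdef, hH, hp, hq, cross, PiLp.sub_apply]; ring
        rw [this, hHc, sub_self]
      have hHb : H b = D := by
        rw [segment_eq_image'] at hxs
        obtain ⟨τ, ⟨hτ0, hτ1⟩, hτ⟩ := hxs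
        rcases hτ0.eq_or_lt with rfl | hτpos
        · simp only [zero_smul, add_zero] at hτ
          rcases hend a ha hHa with h | h
          · rw [← hτ, h, ← hp, Plane.cross_self] at hxB; exact absurd hxB (lt_irrefl _)
          · rw [← hτ, h, ← hq, Plane.cross_self] at hxA; exact absurd hxA (lt_irrefl _)
        · have := hHline a b τ
          simp only at hτ
          rw [hτ, hxH, hHa] at this
          nlinarith
      rcases hend a ha hHa with rfl | rfl <;> rcases hend b hb hHb with rfl | rfl
      · exact hab rfl
      · exact huw he
      · exact huw (by rwa [Sym2.eq_swap])
      · exact hab rfl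
    have hxcl : x ∈ closure T := by
      refine mem_closure_of_tendsto (tendsto_add_smul x (v - x)) ?_
      have hsm : ∀ᶠ s : ℝ in 𝓝[>] 0, s < 1 := nhdsWithin_le_nhds (gt_mem_nhds one_pos)
      filter_upwards [hsm, eventually_pos] with s hs1 hs
      refine ⟨⟨?_, ?_⟩, ?_⟩
      · simp only [mem_ofPred_eq, hline, sub_self, cross_zero]; nlinarith
      · simp only [mem_ofPred_eq, hline, sub_self, cross_zero]; nlinarith
      · simp only [mem_ofPred_eq, hHline, hxH, heq]
        have : H v = 0 := by simp [hH]
        rw [this]; nlinarith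
    have hpre : IsPreconnected (insert x T) :=
      hTconv.isPreconnected.subset_closure (subset_insert _ _)
        (insert_subset hxcl subset_closure)
    obtain ⟨y, hy⟩ : T.Nonempty := closure_nonempty_iff.1 ⟨x, hxcl⟩
    exact P.subset_inside hpre (insert_subset hxoff hTc) (mem_insert_of_mem _ hy) (hTi hy)
      (mem_insert _ _)

/-- Every polygon with at least four vertices has a diagonal, found at a vertex that is extreme in
the direction of the second coordinate. -/
theorem exists_diagonal (h4 : 4 ≤ P.n) : P.diagonals.Nonempty := by
  set n : Plane := !₂[1, 0] with hn
  have hn0 : n ≠ 0 := fun h => by simpa [hn] using congrArg (fun x : Plane => x 0) h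
  obtain ⟨v, hv, hmax⟩ := Set.exists_max_image P.verts (cross n) P.finite_verts
    ⟨_, P.vtx_mem_verts 0⟩
  obtain ⟨u, hu, w, hw, huv, hwv, huw, heu, hew, hvs, hne⟩ := P.exists_neighbours hv
  have hD := P.cross_ne_zero hv hu hw huv.symm huw hwv.symm
  rcases lt_or_gt_of_ne hD with h | h
  · exact P.exists_diagonal_of_extreme hv hn0 hmax hew hw hu heu
      (by rw [cross_swap]; linarith) (fun s hs hcs => (hvs s hs hcs).symm)
      (by rw [Sym2.eq_swap]; exact hne h4)
  · exact P.exists_diagonal_of_extreme hv hn0 hmax heu hu hw hew h hvs (hne h4)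

theorem diagonals_eq_empty (h3 : P.n = 3) : P.diagonals = ∅ := by
  rw [Finset.eq_empty_iff_forall_notMem]
  intro d hd
  obtain ⟨i, m, hm, hmn, -⟩ := P.exists_index_of_mem_diagonals hd
  omega

/-- Every polygon with at least four vertices has an ear: a diagonal that cuts off a triangle. -/
theorem exists_ear (h4 : 4 ≤ P.n) :
    ∃ d ∈ P.diagonals, ∃ Q R : SimplePolygon, P.IsSplit d Q R ∧ Q.n = 3 ∧
      ∃ v ∈ Q.verts, v ∉ R.verts ∧ ∀ x ∈ Q.verts, x = v ∨ x ∈ d := by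
  have hex : ∃ m, ∃ i, 2 ≤ m ∧ m + 2 ≤ P.n ∧ s(P.vtx i, P.vtx (i + m)) ∈ P.diagonals := by
    obtain ⟨d, hd⟩ := P.exists_diagonal h4
    obtain ⟨i, m, hm, hmn, rfl⟩ := P.exists_index_of_mem_diagonals hd
    exact ⟨m, i, hm, hmn, hd⟩
  classical
  obtain ⟨i, hm, hmn, hd⟩ := Nat.find_spec hex
  have hmin := fun k (hk : k < Nat.find hex) => Nat.find_min hex hk
  set m := Nat.find hex
  obtain ⟨Q, R, hsplit, hQn, hQv, hRv⟩ := P.exists_isSplit_arc hm hmn hd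
  refine ⟨_, hd, Q, R, hsplit, ?_⟩
  -- the diagonal spans the least number `m` of edges; if `m` were greater than `2`, then a
  -- diagonal of the polygon that it cuts off would span fewer edges
  have hm2 : m = 2 := by
    by_contra hne
    obtain ⟨e, he⟩ := Q.exists_diagonal (by omega)
    have heP := (hsplit.diagonals_left he).1
    have hnotP := P.notMem_edges_of_mem_diagonals heP
    have hnotQ := Q.notMem_edges_of_mem_diagonals he
    obtain ⟨a, ha, b, hb, hab, rfl, -⟩ := Q.mem_diagonals.1 he
    obtain ⟨k, hk, rfl⟩ := (Q.mem_verts_iff 0).1 ha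
    obtain ⟨l, hl, rfl⟩ := (Q.mem_verts_iff 0).1 hb
    rw [zero_add, zero_add] at *
    wlog hkl : k < l generalizing k l
    · refine this l hl hb k hk ha hab.symm ?_ ?_ ?_ ?_ ?_
      · rwa [Sym2.eq_swap]
      · rwa [Sym2.eq_swap]
      · rwa [Sym2.eq_swap]
      · rwa [Sym2.eq_swap]
      · have : k ≠ l := by rintro rfl; exact hab rfl
        omega
    rw [hQn] at hk hl
    rw [hQv k (by omega), hQv l (by omega)] at heP hnotP hnotQ
    refine hmin (l - k) ?_ ⟨i + k, ?_, ?_, ?_⟩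
    · by_contra! hge
      obtain rfl : k = 0 := by omega
      obtain rfl : l = m := by omega
      exact hnotQ hsplit.mem_left
    · by_contra! hlt
      obtain rfl : l = k + 1 := by omega
      exact hnotP (P.edge_mem_edges (i + k))
    · omega
    · rwa [show i + k + (l - k) = i + l by omega]
  have h3 := P.three_le
  rw [hm2] at hQn hQv hRv ⊢
  refine ⟨hQn, P.vtx (i + 1), ?_, ?_, ?_⟩
  · rw [← hQv 1 (by omega)]; exact Q.vtx_mem_verts 1
  · rw [hRv]
    rintro ⟨k, hk2, hkn, h⟩
    rcases hkn.lt_or_eq with h' | rfl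
    · have := (P.vtx_add_eq_iff (by omega) h').1 h
      omega
    · rw [P.vtx_add_n] at h
      exact P.vtx_succ_ne i h.symm
  · intro x hx
    obtain ⟨k, hk, rfl⟩ := (Q.mem_verts_iff 0).1 hx
    rw [hQn] at hk
    rw [zero_add, hQv k (by omega)]
    interval_cases k
    · exact Or.inr (Sym2.mem_mk_left _ _)
    · exact Or.inl rfl
    · exact Or.inr (Sym2.mem_mk_right _ _)

end SimplePolygon

/-! ### Convexity and half-discs -/

namespace Plane

/-- `A` contains an open half-disc centered at `v`. For a vertex `v` and the region that is left
by a set of diagonals, this says that one of the angles at `v` is at least `π`. -/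
def HasHalfDisc (A : Set Plane) (v : Plane) : Prop :=
  ∃ n : Plane, n ≠ 0 ∧ ∃ r > 0, ∀ x ∈ Metric.ball v r, 0 < cross n (x - v) → x ∈ A

theorem HasHalfDisc.mono {A B : Set Plane} {v : Plane} (h : HasHalfDisc A v) (hAB : A ⊆ B) :
    HasHalfDisc B v := by
  obtain ⟨n, hn, r, hr, h⟩ := h
  exact ⟨n, hn, r, hr, fun x hx hx' => hAB (h x hx hx')⟩

/-- A convex open set contains the open triangle spanned by one of its points and two points of
its closure. -/
theorem add_mem_of_convex {C : Set Plane} (hC : Convex ℝ C) (ho : IsOpen C) {a b x : Plane}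
    (ha : a ∈ closure C) (hb : b ∈ closure C) (hx : x ∈ C) {α β : ℝ} (hα : 0 ≤ α) (hβ : 0 < β)
    (hαβ : α + β < 1) : a + (α • (b - a) + β • (x - a)) ∈ C := by
  have h1 : 0 < 1 - β := by linarith
  have he : a + (α / (1 - β)) • (b - a) ∈ closure C := by
    apply hC.closure.segment_subset ha hb
    rw [segment_eq_image']
    exact ⟨_, ⟨by positivity, (div_le_one h1).2 (by linarith)⟩, rfl⟩
  have := hC.openSegment_closure_interior_subset_interior he (by rwa [ho.interior_eq])
  rw [ho.interior_eq] at this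
  apply this
  refine ⟨1 - β, β, h1, hβ, by ring, ?_⟩
  rw [smul_add, smul_smul, mul_div_cancel₀ _ h1.ne']
  module

/-- A connected set that does not meet a line lies on one side of it. -/
theorem cross_pos_of_isPreconnected {C : Set Plane} (hC : IsPreconnected C) {u c : Plane}
    (h : ∀ x ∈ C, cross u (x - c) ≠ 0) {x y : Plane} (hx : x ∈ C) (hy : y ∈ C)
    (hpos : 0 < cross u (x - c)) : 0 < cross u (y - c) := by
  by_contra! hle
  obtain ⟨z, hz, hz0⟩ := hC.intermediate_value hy hx
    (f := fun z => cross u (z - c)) (by fun_prop) (show (0 : ℝ) ∈ Icc _ _ from ⟨hle, hpos.le⟩)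
  exact h z hz hz0

end Plane

namespace SimplePolygon

variable (P : SimplePolygon)

/-- The interior of a triangle is the intersection `T` of three half-planes. -/
theorem convex_inside_of_n_eq_three (h3 : P.n = 3) : Convex ℝ P.inside := by
  set D : ℕ → ℝ := fun k => cross (P.vtx (k + 1) - P.vtx k) (P.vtx (k + 2) - P.vtx k) with hD
  have hD0 : ∀ k, D k ≠ 0 := by
    intro k
    refine P.cross_ne_zero (P.vtx_mem_verts _) (P.vtx_mem_verts _) (P.vtx_mem_verts _)
      (P.vtx_succ_ne k) (P.vtx_succ_ne (k + 1)) fun h => ?_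
    have := (P.vtx_add_eq_iff (i := k) (k := 0) (l := 2) (by omega) (by omega)).1 h
    omega
  set T : Set Plane := ⋂ k : ℕ, {x | 0 < D k * cross (P.vtx (k + 1) - P.vtx k) (x - P.vtx k)}
    with hT
  have hTconv : Convex ℝ T := by
    refine convex_iInter fun k => ?_
    have := convex_cross_lt (D k • (P.vtx (k + 1) - P.vtx k)) (P.vtx k) 0
    simpa only [cross_smul_left] using this
  have hsub : P.inside ⊆ T := by
    intro x hx
    rw [hT, mem_iInter]
    intro k
    have hne : -(D k • (P.vtx (k + 1) - P.vtx k)) ≠ 0 :=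
      neg_ne_zero.2 (smul_ne_zero (hD0 k) (sub_ne_zero.2 (P.vtx_succ_ne k).symm))
    have := P.cross_lt_of_mem_inside hne (c := cross (-(D k • (P.vtx (k + 1) - P.vtx k)))
      (P.vtx k)) (fun v hv => ?_) hx
    · rw [cross_neg_left, cross_neg_left, cross_smul_left, cross_smul_left] at this
      rw [mem_ofPred_eq, cross_sub, mul_sub]
      linarith
    · obtain ⟨j, hj, rfl⟩ := (P.mem_verts_iff k).1 hv
      rw [← sub_nonpos, ← cross_sub, cross_neg_left, cross_smul_left]
      have hj3 : j < 3 := by omega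
      interval_cases j
      · simp
      · simp
      · have := mul_self_nonneg (D k)
        linarith
  have hTc : T ⊆ P.curveᶜ := by
    intro x hx hxc
    rw [curve_eq, mem_iUnion] at hxc
    obtain ⟨k, hk⟩ := hxc
    rw [hT, mem_iInter] at hx
    have := hx k
    rw [mem_ofPred_eq, cross_eq_zero_of_mem_segment hk, mul_zero] at this
    exact lt_irrefl _ this
  obtain ⟨x, hx⟩ := P.inside_nonempty
  rw [hsub.antisymm (P.subset_inside hTconv.isPreconnected hTc (hsub hx) hx)]
  exact hTconv

/-- Let `C` and `C'` be convex sets along the segment `a b`. If a segment from `x` in `C` to `y`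
in `C'` meets the line `a b` beyond `a`, then the union of the triangles `a b x` and `a b y` has
an angle of at least `π` at `a`, and hence contains a half-disc there. -/
theorem hasHalfDisc_of_cross {A C C' : Set Plane} (hC : Convex ℝ C) (hC' : Convex ℝ C')
    (ho : IsOpen C) (ho' : IsOpen C') (hCA : C ⊆ A) (hCA' : C' ⊆ A) {a b x y : Plane}
    (ha : a ∈ closure C) (hb : b ∈ closure C) (ha' : a ∈ closure C') (hb' : b ∈ closure C')
    (hab : openSegment ℝ a b ⊆ A) (hx : x ∈ C) (hy : y ∈ C') (hne : cross (y - x) (b - a) ≠ 0)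
    {l t : ℝ} (hl0 : 0 < l) (hl1 : l < 1) (ht : t ≤ 0)
    (hc : x + l • (y - x) = a + t • (b - a)) : HasHalfDisc A a := by
  set κ := cross (y - x) (b - a) with hκ
  have hyx : y - x ≠ 0 := by
    intro h; rw [hκ, h] at hne; simp [cross] at hne
  have hκ' : cross (b - a) (y - x) = -κ := by rw [hκ, cross_swap]
  have hκ0 : cross (b - a) (y - x) ≠ 0 := by rw [hκ']; exact neg_ne_zero.2 hne
  have hl1' : 0 < 1 - l := by linarith
  -- `f` and `g` are the coordinates with respect to `b - a` and `y - x`; close to `a`, the points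
  -- with `f > 0` lie in the triangle `a b x` if `g < 0`, in the triangle `a b y` if `g > 0`, and
  -- on the segment `a b` if `g = 0`, and `K` controls how close they have to be
  set K : ℝ := (1 - t) * (1 / l + 1 / (1 - l)) with hK
  set f : Plane → ℝ := fun p => cross (p - a) (y - x) / cross (b - a) (y - x) with hf
  set g : Plane → ℝ := fun p => cross (b - a) (p - a) / cross (b - a) (y - x) with hg
  have hcont : Continuous fun p => f p + |g p| * K := by
    simp only [hf, hg]; fun_prop
  have hlt : ∀ᶠ p in 𝓝 a, f p + |g p| * K < 1 := by
    refine hcont.continuousAt.eventually (gt_mem_nhds ?_)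
    simp [hf, hg, cross]
  obtain ⟨r, hr, hball⟩ := Metric.eventually_nhds_iff_ball.1 hlt
  refine ⟨κ • (y - x), smul_ne_zero hne hyx, r, hr, fun p hp hpos => ?_⟩
  have hsm := hball p hp
  have hrep := eq_smul_add_smul hκ0 (p - a)
  rw [cross_smul_left] at hpos
  have hα : 0 < f p := by
    have : f p = κ * cross (y - x) (p - a) / (κ * κ) := by
      simp only [hf]
      rw [hκ', cross_swap (y - x) (p - a)]
      field_simp
    rw [this]
    exact div_pos hpos (mul_self_pos.2 hne)
  have hrep' : p - a = f p • (b - a) + g p • (y - x) := hrep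
  generalize f p = α at *
  generalize g p = β at *
  have hp' : p = a + (α • (b - a) + β • (y - x)) := by rw [← hrep']; abel
  have h1l : 0 < 1 / l := by positivity
  have h1l' : 0 < 1 / (1 - l) := by positivity
  rcases lt_trichotomy β 0 with hβ | rfl | hβ
  · have e : x - a = t • (b - a) - l • (y - x) := by
      rw [eq_sub_iff_add_eq, sub_add_eq_add_sub, hc]; abel
    have : p = a + ((α + β * t / l) • (b - a) + (-β / l) • (x - a)) := by
      rw [hp', e]
      congr 1
      match_scalars <;> field_simp <;> ring
    rw [this]
    apply hCA
    refine add_mem_of_convex hC ho ha hb hx ?_ (div_pos (by linarith) hl0) ?_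
    · have := div_nonneg (mul_nonneg_of_nonpos_of_nonpos hβ.le ht) hl0.le
      linarith
    · rw [abs_of_neg hβ, hK] at hsm
      have : α + β * t / l + -β / l = α + -β * ((1 - t) * (1 / l)) := by field_simp; ring
      rw [this]
      refine lt_of_le_of_lt ?_ hsm
      have h2 : 0 ≤ -β * ((1 - t) * (1 / (1 - l))) :=
        mul_nonneg (by linarith) (mul_nonneg (by linarith) h1l'.le)
      linarith
  · rw [hp', zero_smul, add_zero]
    rw [abs_zero, zero_mul, add_zero] at hsm
    apply hab
    rw [openSegment_eq_image']
    exact ⟨α, ⟨hα, hsm⟩, rfl⟩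
  · have e : y - a = t • (b - a) + (1 - l) • (y - x) := by
      have : y - a = (x + l • (y - x)) - a + (1 - l) • (y - x) := by module
      rw [this, hc]; abel
    have : p = a + ((α - β * t / (1 - l)) • (b - a) + (β / (1 - l)) • (y - a)) := by
      rw [hp', e]
      congr 1
      rw [smul_add, smul_smul, smul_smul, div_mul_cancel₀ _ hl1'.ne']
      module
    rw [this]
    apply hCA'
    refine add_mem_of_convex hC' ho' ha' hb' hy ?_ (div_pos hβ hl1') ?_
    · have := div_nonneg (mul_nonneg hβ.le (neg_nonneg.2 ht)) hl1'.le
      rw [mul_neg, neg_div] at this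
      linarith
    · rw [abs_of_pos hβ, hK] at hsm
      have : α - β * t / (1 - l) + β / (1 - l) = α + β * ((1 - t) * (1 / (1 - l))) := by
        field_simp; ring
      rw [this]
      refine lt_of_le_of_lt ?_ hsm
      have h2 : 0 ≤ β * ((1 - t) * (1 / l)) :=
        mul_nonneg hβ.le (mul_nonneg (by linarith) h1l.le)
      linarith

/-- A convex polygon does not meet the line through an edge. -/
theorem cross_ne_zero_of_mem_inside {S : SimplePolygon} {a b : Plane} (hab : a ≠ b)
    (hS : s(a, b) ∈ S.edges) (hconv : Convex ℝ S.inside) {x : Plane} (hx : x ∈ S.inside) :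
    cross (b - a) (x - a) ≠ 0 := by
  intro h0
  have hu : b - a ≠ 0 := sub_ne_zero.2 hab.symm
  obtain ⟨t, ht⟩ := exists_smul_of_cross_eq_zero hu h0
  have hcl : ∀ z ∈ segment ℝ a b, z ∈ closure S.inside ∧ z ∉ S.inside := fun z hz =>
    ⟨S.curve_subset_closure_inside (S.carrier_subset_curve hS hz),
      fun hz' => hz'.1 (S.carrier_subset_curve hS hz)⟩
  have ha' := hcl a (left_mem_segment _ _ _)
  have hb' := hcl b (right_mem_segment _ _ _)
  have hx' : x = a + t • (b - a) := by rw [← ht]; abel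
  have hopen : ∀ z, z ∈ closure S.inside → openSegment ℝ z x ⊆ S.inside := fun z hz => by
    have := hconv.openSegment_closure_interior_subset_interior hz
      (by rwa [S.isOpen_inside.interior_eq])
    rwa [S.isOpen_inside.interior_eq] at this
  rcases lt_or_ge t 0 with h1 | h1
  · apply ha'.2
    apply hopen b hb'.1
    refine ⟨-t / (1 - t), 1 / (1 - t), div_pos (by linarith) (by linarith),
      div_pos one_pos (by linarith), ?_, ?_⟩
    · rw [← add_div, div_eq_one_iff_eq (by linarith)]; ring
    · have h1' : (1 - t) ≠ 0 := by linarith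
      rw [hx']
      match_scalars <;> field_simp <;> ring
  · rcases lt_or_ge 1 t with h2 | h2
    · apply hb'.2
      apply hopen a ha'.1
      refine ⟨1 - 1 / t, 1 / t, ?_, by positivity, by ring, ?_⟩
      · rw [sub_pos, div_lt_one (by linarith)]; exact h2
      · have h1' : t ≠ 0 := by linarith
        rw [hx']
        match_scalars <;> field_simp <;> ring
    · exact (hcl x (by rw [segment_eq_image']; exact ⟨t, ⟨h1, h2⟩, hx'.symm⟩)).2 hx

/-- Two convex parts along the diagonal `a b` form a convex polygon unless there is a half-disc
at `a` or `b`. -/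
theorem IsSplit.convex_inside {P Q R : SimplePolygon} {a b : Plane} (hab : a ≠ b)
    (h : P.IsSplit s(a, b) Q R) (hsub : openSegment ℝ a b ⊆ P.inside)
    (hQ : Convex ℝ Q.inside) (hR : Convex ℝ R.inside) (ha : ¬ HasHalfDisc P.inside a)
    (hb : ¬ HasHalfDisc P.inside b) : Convex ℝ P.inside := by
  have hu : b - a ≠ 0 := sub_ne_zero.2 hab.symm
  have hoffQ := fun x hx => cross_ne_zero_of_mem_inside hab h.mem_left hQ (x := x) hx
  have hoffR := fun x hx => cross_ne_zero_of_mem_inside hab h.mem_right hR (x := x) hx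
  -- the two parts lie on opposite sides of the line `a b`
  have hopp : ∀ x ∈ Q.inside, ∀ y ∈ R.inside,
      cross (b - a) (x - a) * cross (b - a) (y - a) < 0 := by
    obtain ⟨c, hc⟩ := openSegment_nonempty a b
    have hcc := cross_eq_zero_of_mem_segment (openSegment_subset_segment ℝ a b hc)
    have hnhd : P.inside ∈ 𝓝 c := P.isOpen_inside.mem_nhds (hsub hc)
    obtain ⟨s, ⟨h1, h2⟩, hs⟩ := ((((tendsto_add_smul c (perp (b - a))).eventually hnhd).and
      ((tendsto_sub_smul c (perp (b - a))).eventually hnhd)).and eventually_pos).exists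
    have hp := mul_pos hs (cross_perp_pos hu)
    have e1 : cross (b - a) (c + s • perp (b - a) - a) = s * cross (b - a) (perp (b - a)) := by
      rw [add_sub_right_comm, cross_add, hcc, cross_smul, zero_add]
    have e2 : cross (b - a) (c - s • perp (b - a) - a) = -(s * cross (b - a) (perp (b - a))) := by
      rw [sub_right_comm, cross_sub, hcc, cross_smul, zero_sub]
    generalize hzp : c + s • perp (b - a) = z₁ at *
    generalize hzm : c - s • perp (b - a) = z₂ at *
    have hcz : c ∈ segment ℝ z₁ z₂ := by
      rw [← hzp, ← hzm]
      exact ⟨2⁻¹, 2⁻¹, by norm_num, by norm_num, by norm_num, by module⟩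
    have hin : ∀ z ∈ P.inside, cross (b - a) (z - a) ≠ 0 → z ∈ Q.inside ∨ z ∈ R.inside := by
      intro z hz hz0
      have : z ∈ Q.inside ∪ R.inside := by
        rw [h.inside_union]
        exact ⟨hz, fun hzd => hz0 (cross_eq_zero_of_mem_segment hzd)⟩
      exact this
    have hboth : ∀ S : SimplePolygon, s(a, b) ∈ S.edges → Convex ℝ S.inside →
        ¬ (z₁ ∈ S.inside ∧ z₂ ∈ S.inside) := fun S hS hconv hzz =>
      (hconv.segment_subset hzz.1 hzz.2 hcz).1
        (S.carrier_subset_curve hS (openSegment_subset_segment _ _ _ hc))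
    have hpos : ∀ {S : SimplePolygon}, Convex ℝ S.inside →
        (∀ x ∈ S.inside, cross (b - a) (x - a) ≠ 0) → z₁ ∈ S.inside →
        ∀ x ∈ S.inside, 0 < cross (b - a) (x - a) := fun hconv ho hz x hx =>
      cross_pos_of_isPreconnected hconv.isPreconnected ho hz hx (by rw [e1]; exact hp)
    have hneg : ∀ {S : SimplePolygon}, Convex ℝ S.inside →
        (∀ x ∈ S.inside, cross (b - a) (x - a) ≠ 0) → z₂ ∈ S.inside →
        ∀ x ∈ S.inside, cross (b - a) (x - a) < 0 := fun hconv ho hz x hx => by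
      by_contra! hge
      have := cross_pos_of_isPreconnected hconv.isPreconnected ho hx hz
        (lt_of_le_of_ne hge (ho x hx).symm)
      linarith
    intro x hx y hy
    rcases hin z₁ h1 (by rw [e1]; exact hp.ne') with hz1 | hz1 <;>
      rcases hin z₂ h2 (by rw [e2]; exact (neg_neg_of_pos hp).ne) with hz2 | hz2
    · exact absurd ⟨hz1, hz2⟩ (hboth Q h.mem_left hQ)
    · exact mul_neg_of_pos_of_neg (hpos hQ hoffQ hz1 x hx) (hneg hR hoffR hz2 y hy)
    · exact mul_neg_of_neg_of_pos (hneg hQ hoffQ hz2 x hx) (hpos hR hoffR hz1 y hy)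
    · exact absurd ⟨hz1, hz2⟩ (hboth R h.mem_right hR)
  have hclQ : ∀ z ∈ segment ℝ a b, z ∈ closure Q.inside := fun z hz =>
    Q.curve_subset_closure_inside (Q.carrier_subset_curve h.mem_left hz)
  have hclR : ∀ z ∈ segment ℝ a b, z ∈ closure R.inside := fun z hz =>
    R.curve_subset_closure_inside (R.carrier_subset_curve h.mem_right hz)
  have hopenQ : ∀ z x, z ∈ segment ℝ a b → x ∈ Q.inside → openSegment ℝ z x ⊆ P.inside :=
    fun z x hz hx => by
      have := hQ.openSegment_closure_interior_subset_interior (hclQ z hz)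
        (by rwa [Q.isOpen_inside.interior_eq])
      rw [Q.isOpen_inside.interior_eq] at this
      exact this.trans h.inside_subset
  have hopenR : ∀ z x, z ∈ segment ℝ a b → x ∈ R.inside → openSegment ℝ z x ⊆ P.inside :=
    fun z x hz hx => by
      have := hR.openSegment_closure_interior_subset_interior (hclR z hz)
        (by rwa [R.isOpen_inside.interior_eq])
      rw [R.isOpen_inside.interior_eq] at this
      exact this.trans h.symm.inside_subset
  -- a segment from one part to the other one crosses the line `a b` between `a` and `b`
  have hmain : ∀ x ∈ Q.inside, ∀ y ∈ R.inside, openSegment ℝ x y ⊆ P.inside := by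
    intro x hx y hy
    have ho := hopp x hx y hy
    set A := cross (b - a) (x - a) with hA
    set B := cross (b - a) (y - a) with hB
    have hAB : A - B ≠ 0 := fun h0 => by
      have : A = B := by linarith
      rw [this] at ho; nlinarith [mul_self_nonneg B]
    set l := A / (A - B) with hl
    have hl0 : 0 < l := by
      rw [hl, div_pos_iff]
      rcases mul_neg_iff.1 ho with ⟨h1, h2⟩ | ⟨h1, h2⟩
      · exact Or.inl ⟨h1, by linarith⟩
      · exact Or.inr ⟨h1, by linarith⟩
    have hl1 : l < 1 := by
      have : 1 - l = B / (B - A) := by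
        rw [hl]; have : B - A ≠ 0 := fun h0 => hAB (by linarith)
        field_simp; ring
      have h' : 0 < B / (B - A) := by
        rw [div_pos_iff]
        rcases mul_neg_iff.1 ho with ⟨h1, h2⟩ | ⟨h1, h2⟩
        · exact Or.inr ⟨h2, by linarith⟩
        · exact Or.inl ⟨h2, by linarith⟩
      linarith
    have hzero : cross (b - a) (x + l • (y - x) - a) = 0 := by
      rw [cross_line, ← hA, ← hB, hl]; field_simp; ring
    obtain ⟨t, ht⟩ := exists_smul_of_cross_eq_zero hu hzero
    have hc : x + l • (y - x) = a + t • (b - a) := by rw [← ht]; abel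
    have hκ : cross (y - x) (b - a) = A - B := by
      rw [hA, hB]; simp only [cross, PiLp.sub_apply]; ring
    have hκ0 : cross (y - x) (b - a) ≠ 0 := by rw [hκ]; exact hAB
    have hal := left_mem_segment ℝ a b
    have hbl := right_mem_segment ℝ a b
    -- crossing it beyond `a` or beyond `b` would produce a half-disc there
    have ht0 : 0 < t := by
      by_contra! ht0
      exact ha (hasHalfDisc_of_cross hQ hR Q.isOpen_inside R.isOpen_inside h.inside_subset
        h.symm.inside_subset (hclQ a hal) (hclQ b hbl) (hclR a hal) (hclR b hbl) hsub hx hy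
        hκ0 hl0 hl1 ht0 hc)
    have ht1 : t < 1 := by
      by_contra! ht1
      refine hb (hasHalfDisc_of_cross (t := 1 - t) hQ hR Q.isOpen_inside R.isOpen_inside
        h.inside_subset h.symm.inside_subset (hclQ b hbl) (hclQ a hal) (hclR b hbl) (hclR a hal)
        (by rwa [openSegment_symm]) hx hy ?_ hl0 hl1 (by linarith) ?_)
      · rw [← neg_sub b a, cross_neg]; exact neg_ne_zero.2 hκ0
      · rw [hc]; module
    set c := x + l • (y - x) with hcdef
    have hcs : c ∈ openSegment ℝ a b := by
      rw [openSegment_eq_image', hc]; exact ⟨t, ⟨ht0, ht1⟩, rfl⟩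
    have hcs' := openSegment_subset_segment _ _ _ hcs
    intro z hz
    rw [openSegment_eq_image'] at hz
    obtain ⟨τ, ⟨hτ0, hτ1⟩, rfl⟩ := hz
    rcases lt_trichotomy τ l with hτ | rfl | hτ
    · apply hopenQ c x hcs' hx
      refine ⟨τ / l, 1 - τ / l, by positivity, ?_, by ring, ?_⟩
      · rw [sub_pos, div_lt_one hl0]; exact hτ
      · rw [hcdef]; match_scalars <;> field_simp <;> ring
    · exact hsub hcs
    · apply hopenR c y hcs' hy
      have h1 : 0 < 1 - l := by linarith
      refine ⟨(1 - τ) / (1 - l), (τ - l) / (1 - l), div_pos (by linarith) h1,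
        div_pos (by linarith) h1, ?_, ?_⟩
      · rw [← add_div, div_eq_one_iff_eq h1.ne']; ring
      · rw [hcdef]; match_scalars <;> field_simp <;> ring
  have hcases : ∀ x ∈ P.inside, x ∈ Q.inside ∨ x ∈ R.inside ∨ x ∈ segment ℝ a b := by
    intro x hx
    by_cases hxs : x ∈ segment ℝ a b
    · exact Or.inr (Or.inr hxs)
    · have : x ∈ Q.inside ∪ R.inside := by rw [h.inside_union]; exact ⟨hx, hxs⟩
      rcases this with h' | h'
      exacts [Or.inl h', Or.inr (Or.inl h')]
  rw [convex_iff_openSegment_subset]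
  intro x hx y hy
  rcases hcases x hx with h1 | h1 | h1 <;> rcases hcases y hy with h2 | h2 | h2
  · exact (hQ.openSegment_subset h1 h2).trans h.inside_subset
  · exact hmain x h1 y h2
  · rw [openSegment_symm]; exact hopenQ y x h2 h1
  · rw [openSegment_symm]; exact hmain y h2 x h1
  · exact (hR.openSegment_subset h1 h2).trans h.symm.inside_subset
  · rw [openSegment_symm]; exact hopenR y x h2 h1
  · exact hopenQ x y h1 h2
  · exact hopenR x y h1 h2
  · have hconv : Convex ℝ (segment ℝ a b ∩ P.inside) := by
      have heq : segment ℝ a b ∩ P.inside = openSegment ℝ a b := by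
        ext z
        constructor
        · rintro ⟨hz, hzi⟩
          rw [← insert_endpoints_openSegment] at hz
          have hend : ∀ e ∈ s(a, b), e ∉ P.inside := by
            intro e he hei
            have hev : e ∈ P.verts := by
              obtain ⟨a', ha', b', hb', -, hs⟩ := Q.exists_of_mem_edges h.mem_left
              rw [hs] at he
              rcases Sym2.mem_iff.1 he with rfl | rfl
              exacts [h.verts_left ha', h.verts_left hb']
            exact hei.1 (P.verts_subset_curve hev)
          rcases hz with rfl | rfl | hz
          · exact absurd hzi (hend _ (Sym2.mem_mk_left _ _))
          · exact absurd hzi (hend _ (Sym2.mem_mk_right _ _))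
          · exact hz
        · exact fun hz => ⟨openSegment_subset_segment _ _ _ hz, hsub hz⟩
      rw [heq]; exact convex_openSegment a b
    exact (hconv.openSegment_subset ⟨h1, hx⟩ ⟨h2, hy⟩).trans inter_subset_right

/-- A polygon without half-discs at its vertices is convex. Cut along a diagonal, both parts are
convex by induction. -/
theorem convex_inside_of_not_hasHalfDisc (P : SimplePolygon)
    (hP : ∀ v ∈ P.verts, ¬ HasHalfDisc P.inside v) : Convex ℝ P.inside := by
  induction hn : P.n using Nat.strong_induction_on generalizing P with
  | _ n ih =>
    rcases P.three_le.eq_or_lt with h3 | h3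
    · exact P.convex_inside_of_n_eq_three h3.symm
    · obtain ⟨d, hd⟩ := P.exists_diagonal h3
      obtain ⟨Q, R, h⟩ := P.exists_isSplit hd
      obtain ⟨a, ha, b, hb, hab, rfl, hsub⟩ := P.mem_diagonals.1 hd
      exact h.convex_inside hab hsub
        (ih Q.n (hn ▸ h.n_lt) Q (fun v hv hh =>
          hP v (h.verts_left hv) (hh.mono h.inside_subset)) rfl)
        (ih R.n (hn ▸ h.symm.n_lt) R (fun v hv hh =>
          hP v (h.symm.verts_left hv) (hh.mono h.symm.inside_subset)) rfl)
        (hP a ha) (hP b hb)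

end SimplePolygon

/-! ### The local criterion for convex partitions -/

namespace SimplePolygon

variable (P : SimplePolygon)

theorem region_anti {I I' : Finset Seg} (h : I ⊆ I') : P.region I' ⊆ P.region I := by
  intro x hx
  rw [mem_region] at hx ⊢
  exact ⟨hx.1, fun s hs => hx.2 s (h hs)⟩

theorem exists_of_mem_diagonals {d : Seg} (hd : d ∈ P.diagonals) :
    ∃ a ∈ P.verts, ∃ b ∈ P.verts, a ≠ b ∧ d = s(a, b) := by
  obtain ⟨a, ha, b, hb, hab, rfl, -⟩ := P.mem_diagonals.1 hd
  exact ⟨a, ha, b, hb, hab, rfl⟩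

/-- A segment between vertices that contains the vertex `v` ends at `v`. -/
theorem exists_eq_of_mem_carrier {s : Seg} (hs : ∃ a ∈ P.verts, ∃ b ∈ P.verts, a ≠ b ∧ s = s(a, b))
    {v : Plane} (hv : v ∈ P.verts) (hvs : v ∈ s.carrier) : ∃ p ∈ P.verts, p ≠ v ∧ s = s(v, p) := by
  obtain ⟨a, ha, b, hb, hab, rfl⟩ := hs
  rw [carrier_mk, ← insert_endpoints_openSegment] at hvs
  rcases hvs with rfl | rfl | h
  · exact ⟨b, hb, hab.symm, rfl⟩
  · exact ⟨a, ha, hab, Sym2.eq_swap⟩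
  · exact absurd h (P.not_mem_openSegment_of_verts ha hb hv hab)

/-- Since no three vertices are collinear, one of the two radii that bound a half-disc at `v` is
free, so the half-disc can be enlarged beyond it. The enlarged set `U` contains two points with
midpoint `v`, so it lies in no convex region. -/
theorem exists_add_eq_of_hasHalfDisc {I : Finset Seg} (hI : I ⊆ P.diagonals) {v : Plane}
    (hv : v ∈ P.verts) (h : HasHalfDisc (P.region I) v) :
    ∃ U ⊆ P.region I, IsPreconnected U ∧ ∃ x ∈ U, ∃ y ∈ U, x + y = v + v := by
  obtain ⟨n, hn, r, hr, hH⟩ := h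
  have hp := cross_perp_pos hn
  set S : Set Seg := P.edges ∪ I with hS
  have hSv : ∀ s ∈ S, ∃ a ∈ P.verts, ∃ b ∈ P.verts, a ≠ b ∧ s = s(a, b) := by
    rintro s (hs | hs)
    · exact P.exists_of_mem_edges hs
    · exact P.exists_of_mem_diagonals (hI hs)
  obtain ⟨r₁, hr₁, hb⟩ := exists_ball_avoiding (P.finite_edges.union I.finite_toSet) v
  have hball : ∀ {c : Plane} {m : Plane} {ρ : ℝ}, 0 < ρ →
      ∀ᶠ t : ℝ in 𝓝[>] 0, c + t • m ∈ Metric.ball c ρ := fun {c m ρ} hρ =>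
    (tendsto_add_smul c m).eventually (Metric.ball_mem_nhds c hρ)
  -- one of the two radii avoids the segments
  have hblock : ∀ m : Plane, ∀ t : ℝ, 0 < t → v + t • m ∈ Metric.ball v r₁ →
      (∃ s ∈ S, v + t • m ∈ s.carrier) → ∃ p ∈ P.verts, p ≠ v ∧ ∃ τ : ℝ, 0 ≤ τ ∧
        t • m = τ • (p - v) := by
    rintro m t ht hmem ⟨s, hs, hms⟩
    obtain ⟨p, hpv, hne, rfl⟩ := P.exists_eq_of_mem_carrier (hSv s hs) hv (hb _ hmem s hs hms)
    rw [carrier_mk, segment_eq_image'] at hms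
    obtain ⟨τ, hτ, he⟩ := hms
    exact ⟨p, hpv, hne, τ, hτ.1, (add_left_cancel he).symm⟩
  have hfree : ∃ m : Plane, cross n m = 0 ∧ ∀ᶠ t : ℝ in 𝓝[>] 0,
      ∀ s ∈ S, v + t • m ∉ s.carrier := by
    by_contra! hcon
    have hcon' : ∀ m : Plane, cross n m = 0 → ∃ t : ℝ, 0 < t ∧ v + t • m ∈ Metric.ball v r₁ ∧
        ∃ s ∈ S, v + t • m ∈ s.carrier := by
      intro m hm
      obtain ⟨t, h1, h2, h3⟩ :=
        ((hcon m hm).and_eventually (eventually_pos.and (hball hr₁))).exists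
      exact ⟨t, h2, h3, h1⟩
    obtain ⟨t, ht0, h2, s, hs, h3⟩ := hcon' n (cross_self n)
    obtain ⟨t', ht0', h2', s', hs', h3'⟩ := hcon' (-n) (by rw [cross_neg, cross_self, neg_zero])
    obtain ⟨p, hpv, hpne, τ, hτ, he⟩ := hblock n t ht0 h2 ⟨s, hs, h3⟩
    obtain ⟨p', hpv', hpne', τ', hτ', he'⟩ := hblock (-n) t' ht0' h2' ⟨s', hs', h3'⟩
    have hτ0 : 0 < τ := by
      rcases hτ.eq_or_lt with rfl | h
      · rw [zero_smul] at he
        exact absurd he (smul_ne_zero ht0.ne' hn)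
      · exact h
    have hτ0' : 0 < τ' := by
      rcases hτ'.eq_or_lt with rfl | h
      · rw [zero_smul] at he'
        exact absurd he' (smul_ne_zero ht0'.ne' (neg_ne_zero.2 hn))
      · exact h
    have e : p - v = (t / τ) • n := by
      rw [div_eq_inv_mul, mul_smul, he, smul_smul, inv_mul_cancel₀ hτ0.ne', one_smul]
    have e' : p' - v = -((t' / τ') • n) := by
      rw [← smul_neg, div_eq_inv_mul, mul_smul, he', smul_smul, inv_mul_cancel₀ hτ0'.ne', one_smul]
    have hpp : p ≠ p' := by
      rintro rfl
      have : (t / τ + t' / τ') • n = 0 := by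
        rw [add_smul, ← e, ← neg_neg ((t' / τ') • n), ← e', add_neg_cancel]
      have h0 : 0 < t / τ + t' / τ' := by positivity
      exact smul_ne_zero h0.ne' hn this
    refine P.cross_ne_zero hv hpv hpv' hpne.symm hpp hpne'.symm ?_
    rw [e, e', cross_neg, cross_smul, cross_smul_left, cross_self, mul_zero, mul_zero, neg_zero]
  -- `y` is a point on the free radius; a small disc around it is added to the half-disc `H`, and
  -- a point of this disc below the radius is opposite to a point of `H`
  obtain ⟨m, hm, hev⟩ := hfree
  obtain ⟨t, ht, hyr, hyS⟩ := (eventually_mem_nhdsWithin.and ((hball (m := m) (c := v) hr).and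
    hev)).exists
  set y := v + t • m with hy
  have hyn : cross n (y - v) = 0 := by rw [hy, add_sub_cancel_left, cross_smul, hm, mul_zero]
  have hnear : ∀ᶠ ε : ℝ in 𝓝[>] 0, y + ε • perp n ∈ P.region I := by
    filter_upwards [eventually_mem_nhdsWithin, (tendsto_add_smul y (perp n)).eventually
      (Metric.isOpen_ball.mem_nhds hyr)] with ε hε hε'
    refine hH _ hε' ?_
    rw [add_sub_right_comm, cross_add, hyn, zero_add, cross_smul]
    exact mul_pos hε hp
  have hyin : y ∈ P.inside := by
    have hcl : y ∈ closure P.inside :=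
      mem_closure_of_tendsto (tendsto_add_smul y (perp n)) (hnear.mono fun ε h => h.1)
    rw [P.closure_inside] at hcl
    refine hcl.resolve_right fun hc => ?_
    obtain ⟨s, hs, hys⟩ := P.exists_edge_of_mem_curve hc
    exact hyS s (Or.inl hs) hys
  have hyreg : y ∈ P.region I := mem_region.2 ⟨hyin, fun s hs => hyS s (Or.inr hs)⟩
  obtain ⟨ρ, hρ, hball'⟩ := Metric.isOpen_iff.1 (P.isOpen_region I) y hyreg
  obtain ⟨ε, hε, h1, h2, h3⟩ := (eventually_mem_nhdsWithin.and
    ((hball (m := perp n) (c := y) hρ).and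
    (((tendsto_sub_smul y (perp n)).eventually (Metric.ball_mem_nhds y hρ)).and
    ((tendsto_sub_smul y (perp n)).eventually (Metric.isOpen_ball.mem_nhds hyr))))).exists
  have h4 : ∀ᶠ ε : ℝ in 𝓝[>] 0, y + ε • perp n ∈ Metric.ball v r :=
    (tendsto_add_smul y (perp n)).eventually (Metric.isOpen_ball.mem_nhds hyr)
  obtain ⟨δ, hδ, h5, h6⟩ := (eventually_mem_nhdsWithin.and (h4.and
    (hball (m := perp n) (c := y) hρ))).exists
  set H := Metric.ball v r ∩ {x | 0 < cross n (x - v)} with hHdef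
  have hHpre : IsPreconnected H := ((convex_ball v r).inter (convex_cross_lt n v 0)).isPreconnected
  refine ⟨H ∪ Metric.ball y ρ, union_subset (fun x hx => hH x hx.1 hx.2) hball',
    hHpre.union (y + δ • perp n) ⟨h5, ?_⟩ h6 (convex_ball y ρ).isPreconnected,
    v + v - (y - ε • perp n), Or.inl ⟨?_, ?_⟩, y - ε • perp n, Or.inr h2, by abel⟩
  · show 0 < cross n _
    rw [add_sub_right_comm, cross_add, hyn, zero_add, cross_smul]
    exact mul_pos hδ hp
  · rw [Metric.mem_ball, dist_eq_norm]
    change dist _ _ < _ at h3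
    rw [dist_eq_norm] at h3
    rwa [show v + v - (y - ε • perp n) - v = -(y - ε • perp n - v) by abel, norm_neg]
  · show 0 < cross n _
    rw [show v + v - (y - ε • perp n) - v = ε • perp n - (y - v) by abel, cross_sub, hyn, sub_zero,
      cross_smul]
    exact mul_pos hε hp

/-- A vertex that is extreme in some direction has no half-disc in the interior. -/
theorem not_hasHalfDisc_of_cross_le {n v : Plane} (hn : n ≠ 0) (hv : v ∈ P.verts)
    (hmax : ∀ w ∈ P.verts, cross n w ≤ cross n v) : ¬ HasHalfDisc P.inside v := by
  intro h
  rw [← region_empty] at h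
  obtain ⟨U, hU, -, x, hx, y, hy, hxy⟩ :=
    P.exists_add_eq_of_hasHalfDisc (Finset.empty_subset _) hv h
  have h1 := P.cross_lt_of_mem_inside hn hmax (hU hx).1
  have h2 := P.cross_lt_of_mem_inside hn hmax (hU hy).1
  have := congrArg (cross n) hxy
  rw [cross_add, cross_add] at this
  linarith

/-- The regions of a non-crossing set of diagonals are convex if and only if no vertex is the
center of a half-disc in the remaining part of the interior. -/
theorem isConvexPartition_iff {I : Finset Seg} (hI : I ⊆ P.diagonals)
    (hnc : (I : Set Seg).Pairwise NonCrossing) :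
    P.IsConvexPartition I ↔ ∀ v ∈ P.verts, ¬ HasHalfDisc (P.region I) v := by
  classical
  constructor
  · intro hconv v hv h
    obtain ⟨U, hU, hUp, x, hx, y, hy, hxy⟩ := P.exists_add_eq_of_hasHalfDisc hI hv h
    have hsub : U ⊆ connectedComponentIn (P.region I) x := hUp.subset_connectedComponentIn hx hU
    have hc := hconv _ (mem_pieces.2 ⟨x, hU hx, rfl⟩)
    have hvm : v ∈ connectedComponentIn (P.region I) x := by
      have : v = (1 / 2 : ℝ) • x + (1 / 2 : ℝ) • y := by
        rw [← smul_add, hxy]; module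
      rw [this]
      exact hc (hsub hx) (hsub hy) (by norm_num) (by norm_num) (by norm_num)
    exact (connectedComponentIn_subset _ _ hvm).1.1 (P.verts_subset_curve hv)
  · intro h
    induction hk : I.card using Nat.strong_induction_on generalizing P I with
    | _ k ih =>
      rcases I.eq_empty_or_nonempty with rfl | ⟨d, hd⟩
      · intro U hU
        rw [pieces_empty, mem_singleton_iff] at hU
        rw [region_empty] at h
        rw [hU]; exact P.convex_inside_of_not_hasHalfDisc h
      · obtain ⟨Q, R, hs⟩ := P.exists_isSplit (hI hd)
        have e := hs.eq_insert (hI hd) hI hd hnc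
        have hreg := hs.region_insert e Finset.inter_subset_right Finset.inter_subset_right
        have key : ∀ T : SimplePolygon, d ∉ T.diagonals → T.verts ⊆ P.verts →
            T.region (I ∩ T.diagonals) ⊆ P.region I → T.IsConvexPartition (I ∩ T.diagonals) := by
          intro T hdT hv hr
          refine ih _ ?_ T Finset.inter_subset_right
            (hnc.mono (by exact_mod_cast Finset.inter_subset_left))
            (fun v hvT hh => h v (hv hvT) (hh.mono hr)) rfl
          rw [← hk]
          refine Finset.card_lt_card ((Finset.ssubset_iff_of_subset Finset.inter_subset_left).2
            ⟨d, hd, fun hd' => hdT (Finset.mem_inter.1 hd').2⟩)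
        rw [hs.isConvexPartition_insert e Finset.inter_subset_right Finset.inter_subset_right]
        exact ⟨key Q (fun hd' => Q.notMem_edges_of_mem_diagonals hd' hs.mem_left) hs.verts_left
            (by rw [hreg]; exact subset_union_left),
          key R (fun hd' => R.notMem_edges_of_mem_diagonals hd' hs.mem_right) hs.symm.verts_left
            (by rw [hreg]; exact subset_union_right)⟩

/-- Convex partitions are closed under adding diagonals, because half-discs get lost but do not
appear. -/
theorem IsConvexPartition.mono {P : SimplePolygon} {I I' : Finset Seg} (h : P.IsConvexPartition I)
    (hII : I ⊆ I') (hI' : I' ⊆ P.diagonals) (hnc : (I' : Set Seg).Pairwise NonCrossing) :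
    P.IsConvexPartition I' := by
  rw [P.isConvexPartition_iff hI' hnc]
  intro v hv hh
  exact (P.isConvexPartition_iff (hII.trans hI') (hnc.mono (by exact_mod_cast hII))).1 h v hv
    (hh.mono (P.region_anti hII))

end SimplePolygon

/-! ### Alternating sums over non-crossing sets and convex partitions -/

/-- A family of sets that is invariant under adding and removing `d` has alternating sum `0`. -/
theorem Finset.sum_neg_one_pow_card_eq_zero {α : Type*} [DecidableEq α] {F : Finset (Finset α)}
    (d : α) (h : ∀ I, insert d I ∈ F ↔ I.erase d ∈ F) : ∑ I ∈ F, (-1 : ℤ) ^ I.card = 0 := by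
  refine Finset.sum_involution (fun I _ => if d ∈ I then I.erase d else insert d I) ?_ ?_ ?_ ?_
  · intro I _
    split_ifs with hd
    · rw [← Finset.card_erase_add_one hd, pow_succ]; ring
    · rw [Finset.card_insert_of_notMem hd, pow_succ]; ring
  · intro I _ _
    split_ifs with hd
    · exact fun he => (Finset.erase_eq_self.1 he) hd
    · exact fun he => hd (he ▸ Finset.mem_insert_self d I)
  · intro I hI
    split_ifs with hd
    · exact (h I).1 (by rwa [Finset.insert_eq_of_mem hd])
    · exact (h I).2 (by rwa [Finset.erase_eq_of_notMem hd])
  · intro I _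
    by_cases hd : d ∈ I
    · simp [hd]
    · simp [hd]

namespace Seg

theorem mem_NC {M K : Finset Seg} :
    K ∈ NC M ↔ K ⊆ M ∧ (K : Set Seg).Pairwise NonCrossing := by
  simp [NC]

theorem mem_NC_of_subset {M K L : Finset Seg} (hK : K ∈ NC M) (h : L ⊆ K) : L ∈ NC M :=
  mem_NC.2 ⟨h.trans (mem_NC.1 hK).1, (mem_NC.1 hK).2.mono (by exact_mod_cast h)⟩

theorem χ_eq_sum (M : Finset Seg) : χ M = ∑ K ∈ NC M, (-1) ^ K.card := by
  have hmaps : ∀ K ∈ NC M, K.card ∈ Finset.range (M.card + 1) := fun K hK =>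
    Finset.mem_range.2 (Nat.lt_succ_of_le (Finset.card_le_card (mem_NC.1 hK).1))
  rw [χ, ← Finset.sum_fiberwise_of_maps_to hmaps]
  refine Finset.sum_congr rfl fun i _ => ?_
  rw [Finset.sum_congr rfl fun K hK => by rw [(Finset.mem_filter.1 hK).2], Finset.sum_const,
    nsmul_eq_mul, mul_comm, f]

theorem χ_empty : χ ∅ = 1 := by
  have : NC ∅ = {∅} := by
    ext K
    simp only [mem_NC, Finset.subset_empty, Finset.mem_singleton]
    exact ⟨fun h => h.1, by rintro rfl; simp⟩
  simp [χ_eq_sum, this]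

instance : Std.Symm NonCrossing := ⟨fun _ _ h => h.symm⟩

theorem pairwise_insert {d : Seg} {K : Finset Seg} :
    (insert d (K : Set Seg)).Pairwise NonCrossing ↔
      (K : Set Seg).Pairwise NonCrossing ∧ ∀ e ∈ K, d ≠ e → NonCrossing d e :=
  Set.pairwise_insert_of_symm

open Classical in
/-- The non-crossing sets with `d` correspond to those of the segments that do not cross `d`. -/
theorem χ_insert {M : Finset Seg} {d : Seg} (hd : d ∉ M) :
    χ (insert d M) = χ M - χ (M.filter (NonCrossing d)) := by
  simp only [χ_eq_sum]
  rw [← Finset.sum_filter_add_sum_filter_not (NC (insert d M)) (d ∈ ·), add_comm, sub_eq_add_neg,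
    ← Finset.sum_neg_distrib]
  congr 1
  · refine Finset.sum_congr (Finset.ext fun K => ?_) fun _ _ => rfl
    rw [Finset.mem_filter, mem_NC, mem_NC]
    constructor
    · rintro ⟨⟨h1, h2⟩, h3⟩
      exact ⟨(Finset.subset_insert_iff_of_notMem h3).1 h1, h2⟩
    · rintro ⟨h1, h2⟩
      exact ⟨⟨h1.trans (Finset.subset_insert _ _), h2⟩, fun h => hd (h1 h)⟩
  · refine Finset.sum_nbij' (fun K => K.erase d) (fun K => insert d K) ?_ ?_ ?_ ?_ ?_
    · intro K hK
      rw [Finset.mem_filter, mem_NC] at hK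
      obtain ⟨⟨h1, h2⟩, h3⟩ := hK
      refine mem_NC.2 ⟨fun e he => ?_, h2.mono (by exact_mod_cast Finset.erase_subset _ _)⟩
      obtain ⟨hne, heK⟩ := Finset.mem_erase.1 he
      refine Finset.mem_filter.2 ⟨?_, h2 h3 heK hne.symm⟩
      exact Finset.mem_of_mem_insert_of_ne (h1 heK) hne
    · intro K hK
      rw [mem_NC] at hK
      refine Finset.mem_filter.2 ⟨mem_NC.2 ⟨Finset.insert_subset_insert _ (hK.1.trans
        (Finset.filter_subset _ _)), ?_⟩, Finset.mem_insert_self _ _⟩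
      rw [Finset.coe_insert, pairwise_insert]
      exact ⟨hK.2, fun e he _ => (Finset.mem_filter.1 (hK.1 he)).2⟩
    · intro K hK
      exact Finset.insert_erase (Finset.mem_filter.1 hK).2
    · intro K hK
      rw [mem_NC] at hK
      exact Finset.erase_insert fun h => hd (Finset.mem_filter.1 (hK.1 h)).1
    · intro K hK
      rw [← Finset.card_erase_add_one (Finset.mem_filter.1 hK).2, pow_succ]; ring

open Classical in
/-- If no segment of `M` crosses a segment of `N`, the complex of non-crossing sets is a join. -/
theorem χ_union {M N : Finset Seg} (hMN : Disjoint M N)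
    (hnc : ∀ e ∈ M, ∀ f ∈ N, NonCrossing e f) : χ (M ∪ N) = χ M * χ N := by
  simp only [χ_eq_sum]
  rw [Finset.sum_mul_sum, ← Finset.sum_product']
  symm
  refine Finset.sum_nbij' (fun p => p.1 ∪ p.2) (fun K => (K ∩ M, K ∩ N)) ?_ ?_ ?_ ?_ ?_
  · rintro ⟨K, L⟩ h
    obtain ⟨⟨h1, h2⟩, h3, h4⟩ := (Finset.mem_product.1 h).imp mem_NC.1 mem_NC.1
    refine mem_NC.2 ⟨Finset.union_subset_union h1 h3, ?_⟩
    rw [Finset.coe_union, Set.pairwise_union_of_symm]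
    exact ⟨h2, h4, fun e he f hf _ => hnc e (h1 he) f (h3 hf)⟩
  · intro K hK
    rw [mem_NC] at hK
    exact Finset.mem_product.2 ⟨mem_NC.2 ⟨Finset.inter_subset_right,
      hK.2.mono (by exact_mod_cast Finset.inter_subset_left)⟩, mem_NC.2
      ⟨Finset.inter_subset_right, hK.2.mono (by exact_mod_cast Finset.inter_subset_left)⟩⟩
  · rintro ⟨K, L⟩ h
    obtain ⟨⟨h1, -⟩, h3, -⟩ := (Finset.mem_product.1 h).imp mem_NC.1 mem_NC.1
    simp only at h1 h3
    ext e
    · simp only [Finset.mem_inter, Finset.mem_union]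
      exact ⟨fun he => he.1.resolve_right fun hL => Finset.disjoint_left.1 hMN he.2 (h3 hL),
        fun he => ⟨Or.inl he, h1 he⟩⟩
    · simp only [Finset.mem_inter, Finset.mem_union]
      exact ⟨fun he => he.1.resolve_left fun hK => Finset.disjoint_left.1 hMN (h1 hK) he.2,
        fun he => ⟨Or.inr he, h3 he⟩⟩
  · intro K hK
    rw [mem_NC] at hK
    simp only
    rw [← Finset.inter_union_distrib_left, Finset.inter_eq_left.2 hK.1]
  · rintro ⟨K, L⟩ h
    obtain ⟨⟨h1, -⟩, h3, -⟩ := (Finset.mem_product.1 h).imp mem_NC.1 mem_NC.1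
    rw [Finset.card_union_of_disjoint (hMN.mono h1 h3), pow_add]

/-- A segment that crosses no other one makes the complex of non-crossing sets a cone. -/
theorem χ_eq_zero {M : Finset Seg} {d : Seg} (hd : d ∈ M)
    (h : ∀ e ∈ M, e ≠ d → NonCrossing d e) : χ M = 0 := by
  classical
  rw [← Finset.insert_erase hd, χ_insert (Finset.notMem_erase d M), Finset.filter_true_of_mem,
    sub_self]
  exact fun e he => h e (Finset.mem_of_mem_erase he) (Finset.ne_of_mem_erase he)

end Seg

namespace SimplePolygon

theorem mem_NCc {P : SimplePolygon} {M I : Finset Seg} :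
    I ∈ P.NCc M ↔ I ⊆ M ∧ (I : Set Seg).Pairwise NonCrossing ∧ P.IsConvexPartition I := by
  classical
  simp only [NCc, Finset.mem_filter, mem_NC, and_assoc]

/-- Sets between a convex partition and a non-crossing set of diagonals are convex partitions. -/
theorem mem_NCc_of_subset {P : SimplePolygon} {J I I' : Finset Seg} (hJ : J ∈ NC P.diagonals)
    (hI : I ∈ P.NCc J) (hII : I ⊆ I') (hI' : I' ⊆ J) : I' ∈ P.NCc J := by
  rw [mem_NC] at hJ
  rw [mem_NCc] at hI
  have h := hJ.2.mono (show (I' : Set Seg) ⊆ J by exact_mod_cast hI')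
  exact mem_NCc.2 ⟨hI', h, hI.2.2.mono hII (hI'.trans hJ.1) h⟩

/-- The signed alternating sum over the convex partitions within `J`, which is the value of
`χ (P.diagonals \ J)`. -/
noncomputable def convexSum (P : SimplePolygon) (J : Finset Seg) : ℤ :=
  (-1) ^ (P.n + 1) * ∑ I ∈ P.NCc J, (-1) ^ I.card

namespace IsSplit

variable {P Q R : SimplePolygon} {d : Seg}

theorem subset_diagonals (h : P.IsSplit d Q R) : Q.diagonals ⊆ P.diagonals := fun _ he =>
  (h.diagonals_left he).1

theorem notMem_left (h : P.IsSplit d Q R) : d ∉ Q.diagonals := fun hd =>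
  (h.diagonals_left hd).2.1 rfl

open Classical in
/-- The recursion of the left-hand side of the formula: the non-crossing sets that contain `d`
consist of `d` and of diagonals of the two parts. -/
theorem χ_erase (h : P.IsSplit d Q R) {J : Finset Seg} (hJ : J ∈ NC P.diagonals) (hd : d ∈ J) :
    χ (P.diagonals \ J.erase d) =
      χ (P.diagonals \ J) - χ (Q.diagonals \ J) * χ (R.diagonals \ J) := by
  have hdP := (mem_NC.1 hJ).1 hd
  have e : P.diagonals \ J.erase d = insert d (P.diagonals \ J) := by
    ext x
    simp only [Finset.mem_sdiff, Finset.mem_erase, Finset.mem_insert, not_and]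
    by_cases hx : x = d
    · subst hx; simp [hdP]
    · simp [hx]
  rw [e, χ_insert (fun hh => (Finset.mem_sdiff.1 hh).2 hd), ← χ_union]
  · congr 2
    ext x
    simp only [Finset.mem_filter, Finset.mem_union, Finset.mem_sdiff]
    constructor
    · rintro ⟨⟨h1, h2⟩, h3⟩
      exact (h.diagonals_or hdP h1 (by rintro rfl; exact h2 hd) h3).imp (⟨·, h2⟩) (⟨·, h2⟩)
    · rintro (⟨h1, h2⟩ | ⟨h1, h2⟩)
      · exact ⟨⟨h.subset_diagonals h1, h2⟩, (h.diagonals_left h1).2.2⟩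
      · exact ⟨⟨h.symm.subset_diagonals h1, h2⟩, (h.symm.diagonals_left h1).2.2⟩
  · exact h.disjoint_diagonals.mono Finset.sdiff_subset Finset.sdiff_subset
  · exact fun e he f hf => h.nonCrossing (Finset.sdiff_subset he) (Finset.sdiff_subset hf)

open Classical in
/-- The convex partitions of `P` within `J` that contain `d` come from pairs of convex partitions
of the two parts. -/
theorem insert_union_mem_NCc (h : P.IsSplit d Q R) {J : Finset Seg} (hJ : J ∈ NC P.diagonals)
    (hd : d ∈ J) {I₁ I₂ : Finset Seg} (h₁ : I₁ ∈ Q.NCc (J ∩ Q.diagonals))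
    (h₂ : I₂ ∈ R.NCc (J ∩ R.diagonals)) : insert d (I₁ ∪ I₂) ∈ P.NCc J := by
  rw [mem_NC] at hJ
  rw [mem_NCc, Finset.subset_inter_iff] at h₁ h₂
  have hs : insert d (I₁ ∪ I₂) ⊆ J :=
    Finset.insert_subset hd (Finset.union_subset h₁.1.1 h₂.1.1)
  exact mem_NCc.2 ⟨hs, hJ.2.mono (by exact_mod_cast hs),
    (h.isConvexPartition_insert rfl h₁.1.2 h₂.1.2).2 ⟨h₁.2.2, h₂.2.2⟩⟩

open Classical in
theorem inter_mem_NCc (h : P.IsSplit d Q R) {J : Finset Seg} (hJ : J ∈ NC P.diagonals)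
    {I : Finset Seg} (hI : I ∈ P.NCc J) (hdI : d ∈ I) :
    I ∩ Q.diagonals ∈ Q.NCc (J ∩ Q.diagonals) := by
  rw [mem_NC] at hJ
  rw [mem_NCc] at hI
  have e := h.eq_insert (hJ.1 (hI.1 hdI)) (hI.1.trans hJ.1) hdI hI.2.1
  refine mem_NCc.2 ⟨Finset.inter_subset_inter_right hI.1,
    hI.2.1.mono (by exact_mod_cast Finset.inter_subset_left), ?_⟩
  exact ((h.isConvexPartition_insert e Finset.inter_subset_right Finset.inter_subset_right).1
    hI.2.2).1

open Classical in
/-- The recursion of the right-hand side of the formula. -/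
theorem convexSum_erase (h : P.IsSplit d Q R) {J : Finset Seg} (hJ : J ∈ NC P.diagonals)
    (hd : d ∈ J) : P.convexSum (J.erase d) =
      P.convexSum J - Q.convexSum (J ∩ Q.diagonals) * R.convexSum (J ∩ R.diagonals) := by
  have hJ' := mem_NC.1 hJ
  have e1 : ∑ I ∈ P.NCc J with d ∉ I, (-1 : ℤ) ^ I.card =
      ∑ I ∈ P.NCc (J.erase d), (-1) ^ I.card := by
    refine Finset.sum_congr (Finset.ext fun I => ?_) fun _ _ => rfl
    rw [Finset.mem_filter, mem_NCc, mem_NCc, Finset.subset_erase]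
    tauto
  have e2 : ∑ I ∈ P.NCc J with d ∈ I, (-1 : ℤ) ^ I.card =
      -((∑ I ∈ Q.NCc (J ∩ Q.diagonals), (-1) ^ I.card) *
        ∑ I ∈ R.NCc (J ∩ R.diagonals), (-1) ^ I.card) := by
    rw [Finset.sum_mul_sum, ← Finset.sum_product', ← Finset.sum_neg_distrib]
    refine Finset.sum_nbij' (fun I => (I ∩ Q.diagonals, I ∩ R.diagonals))
      (fun p => insert d (p.1 ∪ p.2)) ?_ ?_ ?_ ?_ ?_
    · intro I hI
      obtain ⟨hI, hdI⟩ := Finset.mem_filter.1 hI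
      exact Finset.mem_product.2 ⟨h.inter_mem_NCc hJ hI hdI, h.symm.inter_mem_NCc hJ hI hdI⟩
    · rintro ⟨I₁, I₂⟩ hI
      obtain ⟨h₁, h₂⟩ := Finset.mem_product.1 hI
      exact Finset.mem_filter.2 ⟨h.insert_union_mem_NCc hJ hd h₁ h₂, Finset.mem_insert_self _ _⟩
    · intro I hI
      obtain ⟨hI, hdI⟩ := Finset.mem_filter.1 hI
      rw [mem_NCc] at hI
      exact (h.eq_insert (hJ'.1 hd) (hI.1.trans hJ'.1) hdI hI.2.1).symm
    · rintro ⟨I₁, I₂⟩ hI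
      obtain ⟨h₁, h₂⟩ := (Finset.mem_product.1 hI).imp mem_NCc.1 mem_NCc.1
      rw [Finset.subset_inter_iff] at h₁ h₂
      have key : ∀ {S T : SimplePolygon}, P.IsSplit d S T → ∀ {A B : Finset Seg},
          A ⊆ S.diagonals → B ⊆ T.diagonals → insert d (A ∪ B) ∩ S.diagonals = A := by
        intro S T hST A B hA hB
        ext x
        simp only [Finset.mem_inter, Finset.mem_insert, Finset.mem_union]
        constructor
        · rintro ⟨rfl | hx | hx, hxS⟩
          · exact absurd hxS hST.notMem_left
          · exact hx
          · exact absurd (hB hx) (Finset.disjoint_left.1 hST.disjoint_diagonals hxS)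
        · exact fun hx => ⟨Or.inr (Or.inl hx), hA hx⟩
      refine Prod.ext (key h h₁.1.2 h₂.1.2) ?_
      simp only
      rw [Finset.union_comm, key h.symm h₂.1.2 h₁.1.2]
    · intro I hI
      obtain ⟨hI, hdI⟩ := Finset.mem_filter.1 hI
      rw [mem_NCc] at hI
      have e := h.eq_insert (hJ'.1 hd) (hI.1.trans hJ'.1) hdI hI.2.1
      have hcard : I.card = (I ∩ Q.diagonals).card + (I ∩ R.diagonals).card + 1 := by
        conv_lhs => rw [e]
        rw [Finset.card_insert_of_notMem, Finset.card_union_of_disjoint]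
        · exact h.disjoint_diagonals.mono Finset.inter_subset_right Finset.inter_subset_right
        · rw [Finset.mem_union, not_or]
          exact ⟨fun hh => h.notMem_left (Finset.mem_inter.1 hh).2,
            fun hh => h.symm.notMem_left (Finset.mem_inter.1 hh).2⟩
      rw [hcard, pow_succ, pow_add]; ring
  have e3 := Finset.sum_filter_add_sum_filter_not (P.NCc J) (d ∈ ·) fun I => (-1 : ℤ) ^ I.card
  have hn : (-1 : ℤ) ^ (Q.n + 1) * (-1) ^ (R.n + 1) = (-1) ^ P.n := by
    rw [← pow_add, show Q.n + 1 + (R.n + 1) = P.n + 4 by have := h.n_add; omega, pow_add]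
    norm_num
  rw [convexSum, convexSum, convexSum, convexSum, ← e3, e1, e2, mul_mul_mul_comm, hn, pow_succ]
  ring

open Classical in
theorem inter_mem_NC (_ : P.IsSplit d Q R) {J : Finset Seg} (hJ : J ∈ NC P.diagonals) :
    J ∩ Q.diagonals ∈ NC Q.diagonals :=
  mem_NC.2 ⟨Finset.inter_subset_right, (mem_NC.1 hJ).2.mono
    (by exact_mod_cast Finset.inter_subset_left)⟩

end IsSplit

end SimplePolygon

/-! ### Fans of diagonals and crossing diagonals -/

theorem Plane.openSegment_subset_of_mem {p q x : Plane} (hx : x ∈ openSegment ℝ p q) :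
    openSegment ℝ x q ⊆ openSegment ℝ p q := by
  obtain ⟨α, β, hα, hβ, hαβ, rfl⟩ := hx
  rintro _ ⟨γ, δ, hγ, hδ, hγδ, rfl⟩
  refine ⟨γ * α, γ * β + δ, mul_pos hγ hα, by positivity, ?_, by module⟩
  rw [← add_assoc, ← mul_add, hαβ, mul_one, hγδ]

namespace SimplePolygon

/-- In a convex polygon, two vertices that are not joined by an edge are joined by a diagonal. -/
theorem openSegment_subset_inside_of_convex {P : SimplePolygon} (hconv : Convex ℝ P.inside)
    {v p : Plane} (hv : v ∈ P.verts) (hp : p ∈ P.verts) (hvp : v ≠ p) (he : s(v, p) ∉ P.edges) :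
    openSegment ℝ v p ⊆ P.inside := by
  intro x hx
  have hcl : x ∈ closure P.inside := hconv.closure.segment_subset (verts_subset_closure hv)
    (verts_subset_closure hp) (openSegment_subset_segment _ _ _ hx)
  rw [P.closure_inside] at hcl
  refine hcl.resolve_right fun hc => ?_
  obtain ⟨s, hs, hxs⟩ := P.exists_edge_of_mem_curve hc
  obtain ⟨a, ha, b, hb, hab, rfl⟩ := P.exists_of_mem_edges hs
  have hx0 : cross (b - a) (x - a) = 0 := cross_eq_zero_of_mem_segment hxs
  obtain ⟨y, hy⟩ := P.inside_nonempty
  -- the polygon lies on one side of the edge `a b`, so the segment `v p` lies on this edge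
  have key : ∀ n : Plane, (∀ z : Plane, cross n (z - a) = 0 ↔ cross (b - a) (z - a) = 0) →
      0 < cross n (y - a) → False := by
    intro n hn hpos
    have hpos' : ∀ z ∈ P.inside, 0 < cross n (z - a) := fun z hz =>
      cross_pos_of_isPreconnected P.isPreconnected_inside
        (fun z hz h => cross_ne_zero_of_mem_inside hab hs hconv hz ((hn z).1 h)) hy hz hpos
    have hge : ∀ z ∈ P.verts, 0 ≤ cross n (z - a) := fun z hz => by
      have hclosed : IsClosed {z : Plane | 0 ≤ cross n (z - a)} :=
        isClosed_le continuous_const (by fun_prop)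
      exact closure_minimal (fun z hz => (hpos' z hz).le) hclosed (verts_subset_closure hz)
    obtain ⟨α, β, hα, hβ, hαβ, rfl⟩ := hx
    have e : cross n (α • v + β • p - a) = α * cross n (v - a) + β * cross n (p - a) := by
      rw [← cross_smul, ← cross_smul, ← cross_add]
      congr 1
      have : a = (α + β) • a := by rw [hαβ, one_smul]
      nth_rewrite 1 [this]
      module
    rw [← hn, e] at hx0
    have h1 := mul_nonneg hα.le (hge v hv)
    have h2 := mul_nonneg hβ.le (hge p hp)
    have h3 : ∀ z ∈ P.verts, cross n (z - a) = 0 → z = a ∨ z = b := by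
      intro z hz h0
      by_contra! hne
      exact P.cross_ne_zero ha hb hz hab hne.2.symm hne.1.symm ((hn z).1 h0)
    rcases h3 v hv (by nlinarith) with rfl | rfl <;> rcases h3 p hp (by nlinarith) with rfl | rfl
    · exact hvp rfl
    · exact he hs
    · exact he (by rw [Sym2.eq_swap]; exact hs)
    · exact hvp rfl
  rcases (cross_ne_zero_of_mem_inside hab hs hconv hy).lt_or_gt with h | h
  · exact key (-(b - a)) (fun z => by rw [cross_neg_left, neg_eq_zero])
      (by rw [cross_neg_left]; linarith)
  · exact key (b - a) (fun z => Iff.rfl) h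

theorem mem_verts_of_mem_edge {P : SimplePolygon} {s : Seg} (hs : s ∈ P.edges) {x : Plane}
    (hx : x ∈ s) : x ∈ P.verts := by
  obtain ⟨a, ha, b, hb, -, rfl⟩ := P.exists_of_mem_edges hs
  rcases Sym2.mem_iff.1 hx with rfl | rfl
  exacts [ha, hb]

/-- If diagonals from the vertex `v` alone cut `P` into convex parts, then `v` is joined by edges
or diagonals to all other vertices. -/
theorem openSegment_subset_inside_of_fan {P : SimplePolygon} {I : Finset Seg}
    (hI : I ⊆ P.diagonals) (hnc : (I : Set Seg).Pairwise NonCrossing)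
    (hconv : P.IsConvexPartition I) {v p : Plane} (hvI : ∀ e ∈ I, v ∈ e) (hv : v ∈ P.verts)
    (hp : p ∈ P.verts) (hvp : v ≠ p) : s(v, p) ∈ P.edges ∨ openSegment ℝ v p ⊆ P.inside := by
  classical
  induction hk : I.card using Nat.strong_induction_on generalizing P I with
  | _ k ih =>
    rcases I.eq_empty_or_nonempty with rfl | ⟨d, hd⟩
    · by_cases he : s(v, p) ∈ P.edges
      · exact Or.inl he
      · refine Or.inr (openSegment_subset_inside_of_convex ?_ hv hp hvp he)
        exact hconv _ (by rw [pieces_empty]; rfl)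
    · have key : ∀ {Q R : SimplePolygon}, P.IsSplit d Q R → p ∈ Q.verts →
          s(v, p) ∈ P.edges ∨ openSegment ℝ v p ⊆ P.inside := by
        intro Q R h hpQ
        have e := h.eq_insert (hI hd) hI hd hnc
        have hcQ := ((h.isConvexPartition_insert e Finset.inter_subset_right
          Finset.inter_subset_right).1 hconv).1
        have hlt : (I ∩ Q.diagonals).card < k := by
          rw [← hk]
          exact Finset.card_lt_card ((Finset.ssubset_iff_of_subset Finset.inter_subset_left).2
            ⟨d, hd, fun hd' => h.notMem_left (Finset.mem_inter.1 hd').2⟩)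
        rcases ih _ hlt Finset.inter_subset_right
          (hnc.mono (by exact_mod_cast Finset.inter_subset_left)) hcQ
          (fun e he => hvI e (Finset.mem_inter.1 he).1)
          (mem_verts_of_mem_edge h.mem_left (hvI d hd)) hpQ rfl with h' | h'
        · have : s(v, p) ∈ insert d P.edges := by
            rw [← h.edges_union]; exact Or.inl h'
          rcases this with h1 | h1
          · right
            rw [← relInterior_mk, h1]
            exact P.relInterior_subset_inside (hI hd)
          · exact Or.inl h1
        · exact Or.inr (h'.trans h.inside_subset)
      obtain ⟨Q, R, h⟩ := P.exists_isSplit (hI hd)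
      have : p ∈ Q.verts ∪ R.verts := by rw [h.verts_union]; exact hp
      rcases this with hpQ | hpR
      · exact key h hpQ
      · exact key h.symm hpR

/-- The interior of a polygon lies, locally, on one side of an edge. -/
theorem exists_side {P : SimplePolygon} {a b x : Plane} (h : s(a, b) ∈ P.edges)
    (hx : x ∈ openSegment ℝ a b) : ∃ σ : ℝ, σ ≠ 0 ∧ ∀ m : Plane, 0 < σ * cross (b - a) m →
      ∀ᶠ t : ℝ in 𝓝[>] 0, x + t • m ∈ P.inside := by
  have key : ∀ k : ℕ, x ∈ openSegment ℝ (P.vtx k) (P.vtx (k + 1)) → ∃ σ : ℝ, σ ≠ 0 ∧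
      ∀ m : Plane, 0 < σ * cross (P.vtx (k + 1) - P.vtx k) m →
      ∀ᶠ t : ℝ in 𝓝[>] 0, x + t • m ∈ P.inside := by
    intro k hx
    obtain ⟨r, hr, σ, hσ, -, hin, -⟩ := P.exists_sides hx
    refine ⟨σ, by rcases hσ with rfl | rfl <;> norm_num, fun m hm => ?_⟩
    filter_upwards [(tendsto_add_smul x m).eventually (Metric.ball_mem_nhds x hr), eventually_pos]
      with t ht ht0
    refine hin _ ht ?_
    rw [add_sub_cancel_left, cross_smul, mul_left_comm]
    exact mul_pos ht0 hm
  rw [edges_eq] at h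
  obtain ⟨k, hk⟩ := h
  rcases Sym2.eq_iff.1 hk with ⟨rfl, rfl⟩ | ⟨rfl, rfl⟩
  · exact key k hx
  · rw [openSegment_symm] at hx
    obtain ⟨σ, hσ, h⟩ := key k hx
    refine ⟨-σ, neg_ne_zero.2 hσ, fun m hm => h m ?_⟩
    rwa [← neg_sub, cross_neg_left, neg_mul_neg] at hm

namespace IsSplit

variable {P Q R : SimplePolygon} {d : Seg}

theorem subset_or_subset (h : P.IsSplit d Q R) {S : Set Plane} (hS : IsPreconnected S)
    (hSP : S ⊆ P.inside) (hSd : Disjoint S d.carrier) : S ⊆ Q.inside ∨ S ⊆ R.inside := by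
  refine hS.subset_or_subset Q.isOpen_inside R.isOpen_inside h.disjoint ?_
  rw [h.inside_union]
  exact fun x hx => ⟨hSP hx, disjoint_left.1 hSd hx⟩

/-- A diagonal that crosses `d` has an end-point in either part. -/
theorem exists_mem_of_crossing (h : P.IsSplit d Q R) (hd : d ∈ P.diagonals) {e : Seg}
    (he : e ∈ P.diagonals) (hed : e ≠ d) (hcr : ¬ NonCrossing d e) :
    ∃ q ∈ Q.verts, q ∈ e ∧ q ∉ d := by
  obtain ⟨a, ha, b, hb, hab, rfl⟩ := P.exists_of_mem_diagonals hd
  obtain ⟨p, hp, q, hq, hpq, rfl⟩ := P.exists_of_mem_diagonals he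
  obtain ⟨x, hxd, hxe⟩ := Set.not_disjoint_iff.1 hcr
  have hx0 : cross (b - a) (x - a) = 0 :=
    cross_eq_zero_of_mem_segment (openSegment_subset_segment _ _ _ hxd)
  have hline : ∀ z ∈ P.verts, cross (b - a) (z - x) = 0 → z = a ∨ z = b := by
    intro z hz h0
    by_contra! hne
    refine P.cross_ne_zero ha hb hz hab hne.2.symm hne.1.symm ?_
    rw [← sub_add_sub_cancel z x a, cross_add, h0, hx0, add_zero]
  obtain ⟨σ, hσ, hside⟩ := exists_side h.mem_left hxd
  -- the end-point of `e` on the side of `Q` is a vertex of `Q`: the half of `e` from the crossing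
  -- point `x` to it starts in `Q` and does not meet `d` again
  have half : ∀ z ∈ P.verts, openSegment ℝ x z ⊆ P.inside → 0 < σ * cross (b - a) (z - x) →
      z ∈ Q.verts ∧ z ∉ s(a, b) := by
    intro z hz hsub hpos
    have h0 : cross (b - a) (z - x) ≠ 0 := (mul_ne_zero_iff.1 hpos.ne').2
    refine ⟨h.mem_verts_left hz ?_, fun hzd => h0 ?_⟩
    · have hdisj : Disjoint (openSegment ℝ x z) (carrier s(a, b)) := by
        rw [disjoint_left]
        intro y hy hyd
        have hy0 := cross_eq_zero_of_mem_segment hyd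
        rw [openSegment_eq_image'] at hy
        obtain ⟨t, ht, rfl⟩ := hy
        rw [add_sub_right_comm, cross_add, hx0, zero_add, cross_smul] at hy0
        exact mul_ne_zero ht.1.ne' h0 hy0
      have hsubs := h.subset_or_subset (convex_openSegment x z).isPreconnected hsub hdisj
      have hQ : openSegment ℝ x z ⊆ Q.inside := by
        refine hsubs.resolve_right fun hR => ?_
        obtain ⟨t, ht, ht0, ht1⟩ := ((hside _ hpos).and (eventually_pos.and
          (Ioo_mem_nhdsGT (zero_lt_one' ℝ)))).exists
        refine disjoint_left.1 h.disjoint ht (hR ?_)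
        rw [openSegment_eq_image']
        exact ⟨t, ht1, rfl⟩
      exact closure_mono hQ (segment_subset_closure_openSegment (right_mem_segment ℝ x z))
    · have hza : cross (b - a) (z - a) = 0 := cross_eq_zero_of_mem_segment
        (mem_carrier_of_mem hzd)
      rw [← sub_sub_sub_cancel_right z x a, cross_sub, hza, hx0, sub_zero]
  have hsub : openSegment ℝ p q ⊆ P.inside := P.relInterior_subset_inside he
  have hxpq : x ∈ openSegment ℝ p q := hxe
  obtain ⟨α, β, hα, hβ, hαβ, hxe'⟩ := hxpq
  have hzero : α * cross (b - a) (p - x) + β * cross (b - a) (q - x) = 0 := by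
    rw [← cross_smul, ← cross_smul, ← cross_add]
    have : α • (p - x) + β • (q - x) = 0 := by
      have : α • (p - x) + β • (q - x) = α • p + β • q - (α + β) • x := by module
      rw [this, hxe', hαβ, one_smul, sub_self]
    rw [this, cross_zero]
  have hsubp : openSegment ℝ x p ⊆ P.inside :=
    (openSegment_subset_of_mem (by rw [openSegment_symm]; exact hxe)).trans
      (by rw [openSegment_symm]; exact hsub)
  have hsubq : openSegment ℝ x q ⊆ P.inside :=
    (openSegment_subset_of_mem hxe).trans hsub
  by_cases hq0 : cross (b - a) (q - x) = 0
  · exfalso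
    rw [hq0, mul_zero, add_zero, mul_eq_zero, or_iff_right hα.ne'] at hzero
    rcases hline p hp hzero with rfl | rfl <;> rcases hline q hq hq0 with rfl | rfl
    · exact hpq rfl
    · exact hed rfl
    · exact hed Sym2.eq_swap
    · exact hpq rfl
  · rcases lt_or_gt_of_ne (mul_ne_zero hσ hq0) with hneg | hpos
    · have hp' : 0 < σ * cross (b - a) (p - x) := by
        by_contra! hle
        have h1 : α * (σ * cross (b - a) (p - x)) + β * (σ * cross (b - a) (q - x)) = 0 := by
          linear_combination σ * hzero
        nlinarith
      exact ⟨p, (half p hp hsubp hp').1, by simp, (half p hp hsubp hp').2⟩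
    · exact ⟨q, (half q hq hsubq hpos).1, by simp, (half q hq hsubq hpos).2⟩

end IsSplit

end SimplePolygon

/-! ### The formula for the characteristic -/

namespace SimplePolygon

theorem exists_verts_notMem (P : SimplePolygon) (s : Seg) : ∃ p ∈ P.verts, p ∉ s := by
  induction s using Sym2.ind with
  | _ a b =>
  by_contra! h
  have h3 := P.three_le
  have hne : ∀ i j : ℕ, i < 3 → j < 3 → i ≠ j → P.vtx i ≠ P.vtx j := fun i j hi hj hij he => by
    have := (P.vtx_add_eq_iff (i := 0) (k := i) (l := j) (by omega) (by omega)).1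
      (by simpa using he)
    exact hij this
  have h0 := Sym2.mem_iff.1 (h _ (P.vtx_mem_verts 0))
  have h1 := Sym2.mem_iff.1 (h _ (P.vtx_mem_verts 1))
  have h2 := Sym2.mem_iff.1 (h _ (P.vtx_mem_verts 2))
  have h01 := hne 0 1 (by norm_num) (by norm_num) (by norm_num)
  have h02 := hne 0 2 (by norm_num) (by norm_num) (by norm_num)
  have h12 := hne 1 2 (by norm_num) (by norm_num) (by norm_num)
  rcases h0 with h0 | h0 <;> rcases h1 with h1 | h1 <;> rcases h2 with h2 | h2 <;>
    simp_all

theorem exists_eq_of_mem_diagonal {P : SimplePolygon} {d : Seg} (hd : d ∈ P.diagonals) {v : Plane}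
    (hv : v ∈ d) : ∃ p ∈ P.verts, p ≠ v ∧ d = s(v, p) := by
  obtain ⟨a, ha, b, hb, hab, rfl⟩ := P.exists_of_mem_diagonals hd
  rcases Sym2.mem_iff.1 hv with rfl | rfl
  · exact ⟨b, hb, hab.symm, rfl⟩
  · exact ⟨a, ha, hab, Sym2.eq_swap⟩

open Classical in
/-- The diagonals that start at the vertex `v`. -/
noncomputable def diagonalsAt (P : SimplePolygon) (v : Plane) : Finset Seg :=
  P.diagonals.filter (v ∈ ·)

theorem mem_diagonalsAt {P : SimplePolygon} {v : Plane} {e : Seg} :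
    e ∈ P.diagonalsAt v ↔ e ∈ P.diagonals ∧ v ∈ e := by
  simp [diagonalsAt]

theorem diagonalsAt_mem_NC {P : SimplePolygon} {v : Plane} (hv : v ∈ P.verts) :
    P.diagonalsAt v ∈ NC P.diagonals := by
  refine mem_NC.2 ⟨fun e he => (mem_diagonalsAt.1 he).1, fun e he e' he' hne => ?_⟩
  obtain ⟨he, hve⟩ := mem_diagonalsAt.1 he
  obtain ⟨he', hve'⟩ := mem_diagonalsAt.1 he'
  obtain ⟨p, hp, hpv, rfl⟩ := exists_eq_of_mem_diagonal he hve
  obtain ⟨p', hp', hpv', rfl⟩ := exists_eq_of_mem_diagonal he' hve'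
  have hpp : p ≠ p' := by rintro rfl; exact hne rfl
  refine disjoint_left.2 fun x hx hx' => ?_
  rw [relInterior_mk, openSegment_eq_image'] at hx hx'
  obtain ⟨t, ht, rfl⟩ := hx
  obtain ⟨t', ht', h⟩ := hx'
  have h' : t' • (p' - v) = t • (p - v) := add_left_cancel h
  have hc := congrArg (cross (p - v)) h'
  rw [cross_smul, cross_smul, cross_self, mul_zero, mul_eq_zero, or_iff_right ht'.1.ne'] at hc
  exact P.cross_ne_zero hv hp hp' hpv.symm hpp hpv'.symm hc

namespace IsSplit

variable {P Q R : SimplePolygon} {d : Seg} {v : Plane}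

/-- The diagonal that cuts off the ear at `v` crosses no diagonal that does not start at `v`. -/
theorem χ_sdiff_diagonalsAt (h : P.IsSplit d Q R) (hd : d ∈ P.diagonals) (hvR : v ∉ R.verts)
    (hQ : ∀ x ∈ Q.verts, x = v ∨ x ∈ d) [DecidableEq Seg] :
    χ (P.diagonals \ P.diagonalsAt v) = 0 := by
  refine χ_eq_zero (d := d) (Finset.mem_sdiff.2 ⟨hd, fun hdv => hvR ?_⟩) fun e he hed => ?_
  · exact mem_verts_of_mem_edge h.mem_right (mem_diagonalsAt.1 hdv).2
  · by_contra hcr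
    obtain ⟨heP, hev⟩ := Finset.mem_sdiff.1 he
    obtain ⟨q, hq, hqe, hqd⟩ := h.exists_mem_of_crossing hd heP hed hcr
    obtain rfl := (hQ q hq).resolve_right hqd
    exact hev (mem_diagonalsAt.2 ⟨heP, hqe⟩)

/-- The tip of an ear is not the center of a half-disc in the interior. -/
theorem not_hasHalfDisc_of_ear (h : P.IsSplit d Q R) (hd : d ∈ P.diagonals) (hQn : Q.n = 3)
    (hvQ : v ∈ Q.verts) (hvR : v ∉ R.verts) : ¬ HasHalfDisc P.inside v := by
  rintro ⟨n, hn, r, hr, hH⟩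
  have hvP := h.verts_left hvQ
  have hRv : (closure R.inside)ᶜ ∈ 𝓝 v := isClosed_closure.isOpen_compl.mem_nhds
    fun hcl => hvR (h.symm.mem_verts_left hvP hcl)
  have hdv : (d.carrier)ᶜ ∈ 𝓝 v := by
    refine d.isClosed_carrier.isOpen_compl.mem_nhds fun hcl => hvR ?_
    obtain ⟨p, -, -, rfl⟩ := P.exists_eq_of_mem_carrier (P.exists_of_mem_diagonals hd) hvP hcl
    exact mem_verts_of_mem_edge h.mem_right (Sym2.mem_mk_left _ _)
  obtain ⟨ρ, hρ, hball⟩ := Metric.mem_nhds_iff.1 (inter_mem hRv hdv)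
  have hconv : Q.IsConvexPartition ∅ := fun U hU => by
    rw [pieces_empty, mem_singleton_iff] at hU
    rw [hU]; exact Q.convex_inside_of_n_eq_three hQn
  refine (Q.isConvexPartition_iff (Finset.empty_subset _) (by simp)).1 hconv v hvQ ?_
  rw [region_empty]
  refine ⟨n, hn, min r ρ, lt_min hr hρ, fun x hx hpos => ?_⟩
  have h1 := hH x (Metric.ball_subset_ball (min_le_left _ _) hx) hpos
  have h2 := hball (Metric.ball_subset_ball (min_le_right _ _) hx)
  have : x ∈ Q.inside ∪ R.inside := by rw [h.inside_union]; exact ⟨h1, h2.2⟩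
  exact this.resolve_right fun hxR => h2.1 (subset_closure hxR)

/-- Unless there are no convex partitions by diagonals from the tip `v` of the ear, the tip sees
all vertices outside the ear. Let `z` be the vertex farthest beyond the diagonal that cuts off the
ear. Neither `v` nor `z` is the center of a half-disc in the interior, so the diagonal `v z` can
be added to or removed from a convex partition, and the convex partitions cancel in pairs. -/
theorem convexSum_diagonalsAt (h : P.IsSplit d Q R) (hd : d ∈ P.diagonals) (hQn : Q.n = 3)
    (hvQ : v ∈ Q.verts) (hvR : v ∉ R.verts) (hQ : ∀ x ∈ Q.verts, x = v ∨ x ∈ d) :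
    P.convexSum (P.diagonalsAt v) = 0 := by
  classical
  have hvP := h.verts_left hvQ
  have hNC := diagonalsAt_mem_NC hvP
  have hNC' := mem_NC.1 hNC
  rcases (P.NCc (P.diagonalsAt v)).eq_empty_or_nonempty with hemp | ⟨I₀, hI₀⟩
  · rw [convexSum, hemp, Finset.sum_empty, mul_zero]
  have hfull := (mem_NCc.1 (mem_NCc_of_subset hNC hI₀ (mem_NCc.1 hI₀).1 Finset.Subset.rfl)).2.2
  obtain ⟨u, hu, w, hw, huw, hduw⟩ := P.exists_of_mem_diagonals hd
  have huR : u ∈ R.verts := mem_verts_of_mem_edge h.mem_right (hduw ▸ Sym2.mem_mk_left _ _)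
  have hwR : w ∈ R.verts := mem_verts_of_mem_edge h.mem_right (hduw ▸ Sym2.mem_mk_right _ _)
  have huv : v ≠ u := fun e => hvR (e ▸ huR)
  have hwv : v ≠ w := fun e => hvR (e ▸ hwR)
  -- the tip sees all vertices outside the ear
  have hsee : ∀ p ∈ P.verts, p ≠ v → p ∉ d → s(v, p) ∈ P.diagonalsAt v := by
    intro p hp hpv hpd
    refine mem_diagonalsAt.2 ⟨P.mem_diagonals.2 ⟨v, hvP, p, hp, hpv.symm, rfl, ?_⟩,
      Sym2.mem_mk_left _ _⟩
    refine (openSegment_subset_inside_of_fan hNC'.1 hNC'.2 hfull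
      (fun e he => (mem_diagonalsAt.1 he).2) hvP hp hpv.symm).resolve_left fun he => ?_
    have : s(v, p) ∈ Q.edges ∪ R.edges := by rw [h.edges_union]; exact Or.inr he
    rcases this with h' | h'
    · rcases hQ p (mem_verts_of_mem_edge h' (Sym2.mem_mk_right _ _)) with h1 | h1
      exacts [hpv h1, hpd h1]
    · exact hvR (mem_verts_of_mem_edge h' (Sym2.mem_mk_left _ _))
  -- these vertices lie beyond the line through `u` and `w`
  set c := cross (w - u) (v - u) with hc
  have hc0 : c ≠ 0 := P.cross_ne_zero hu hw hvP huw hwv.symm huv.symm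
  have hbeyond : ∀ p ∈ P.verts, p ≠ v → p ∉ d → c * cross (w - u) (p - u) < 0 := by
    intro p hp hpv hpd
    have hsub := P.relInterior_subset_inside (mem_diagonalsAt.1 (hsee p hp hpv hpd)).1
    rw [relInterior_mk] at hsub
    have hmeet : ¬ Disjoint (openSegment ℝ v p) d.carrier := by
      intro hdisj
      have hcl := segment_subset_closure_openSegment (𝕜 := ℝ) (x := v) (y := p)
      rcases h.subset_or_subset (convex_openSegment v p).isPreconnected hsub hdisj with h' | h'
      · rcases hQ p (h.mem_verts_left hp (closure_mono h' (hcl (right_mem_segment _ _ _))))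
          with h1 | h1
        exacts [hpv h1, hpd h1]
      · exact hvR (h.symm.mem_verts_left hvP (closure_mono h' (hcl (left_mem_segment _ _ _))))
    obtain ⟨x, ⟨α, β, hα, hβ, hαβ, rfl⟩, hxd⟩ := Set.not_disjoint_iff.1 hmeet
    rw [hduw, carrier_mk] at hxd
    have h0 := cross_eq_zero_of_mem_segment hxd
    have e : α • v + β • p - u = α • (v - u) + β • (p - u) := by
      have : u = (α + β) • u := by rw [hαβ, one_smul]
      nth_rewrite 1 [this]
      module
    rw [e, cross_add, cross_smul, cross_smul, ← hc] at h0
    have : 0 < c * c := mul_self_pos.2 hc0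
    have h1 : β * (c * cross (w - u) (p - u)) = -(α * (c * c)) := by linear_combination c * h0
    have h2 : 0 < α * (c * c) := mul_pos hα this
    by_contra! hle
    have := mul_nonneg hβ.le hle
    linarith
  set n : Plane := (-c) • (w - u) with hn
  have hn0 : n ≠ 0 := smul_ne_zero (neg_ne_zero.2 hc0) (sub_ne_zero.2 huw.symm)
  have hcross : ∀ p, cross n p - cross n u = -(c * cross (w - u) (p - u)) := fun p => by
    rw [← cross_sub, hn, cross_smul_left, neg_mul]
  obtain ⟨z, hz, hmax⟩ := Set.exists_max_image P.verts (cross n) P.finite_verts ⟨v, hvP⟩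
  obtain ⟨p₀, hp₀R, hp₀d⟩ := R.exists_verts_notMem d
  have hp₀ := hmax p₀ (h.symm.verts_left hp₀R)
  have hp₀' := hbeyond p₀ (h.symm.verts_left hp₀R) (fun e => hvR (e ▸ hp₀R)) hp₀d
  have hzpos : c * cross (w - u) (z - u) < 0 := by
    have h1 := hcross p₀; have h2 := hcross z; linarith
  have hzv : z ≠ v := by
    rintro rfl
    rw [← hc] at hzpos
    exact absurd hzpos (mul_self_nonneg c).not_gt
  have hzd : z ∉ d := by
    intro hzd
    rw [hduw] at hzd
    have h0 : cross (w - u) (z - u) = 0 := by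
      rcases Sym2.mem_iff.1 hzd with rfl | rfl
      · rw [sub_self, cross_zero]
      · exact cross_self _
    rw [h0, mul_zero] at hzpos
    exact lt_irrefl _ hzpos
  have hdz := hsee z hz hzv hzd
  have hvd := h.not_hasHalfDisc_of_ear hd hQn hvQ hvR
  have hzh := P.not_hasHalfDisc_of_cross_le hn0 hz hmax
  rw [convexSum, Finset.sum_neg_one_pow_card_eq_zero s(v, z), mul_zero]
  intro I
  constructor
  · intro hI
    rw [mem_NCc, Finset.insert_subset_iff] at hI
    have hsub : I.erase s(v, z) ⊆ P.diagonalsAt v := (Finset.erase_subset _ _).trans hI.1.2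
    have hnc := hNC'.2.mono (show ((I.erase s(v, z) : Finset Seg) : Set Seg) ⊆ _ by
      exact_mod_cast hsub)
    refine mem_NCc.2 ⟨hsub, hnc, (P.isConvexPartition_iff (hsub.trans hNC'.1) hnc).2 ?_⟩
    rintro p hp ⟨m, hm, r, hr, hH⟩
    by_cases hpv : p = v
    · exact hvd (hpv ▸ HasHalfDisc.mono ⟨m, hm, r, hr, hH⟩ sdiff_subset)
    by_cases hpz : p = z
    · exact hzh (hpz ▸ HasHalfDisc.mono ⟨m, hm, r, hr, hH⟩ sdiff_subset)
    have hps : (carrier s(v, z))ᶜ ∈ 𝓝 p := by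
      refine (isClosed_carrier _).isOpen_compl.mem_nhds fun hcl => ?_
      rw [carrier_mk, ← insert_endpoints_openSegment] at hcl
      rcases hcl with h1 | h1 | h1
      exacts [hpv h1, hpz h1, P.not_mem_openSegment_of_verts hvP hz hp hzv.symm h1]
    obtain ⟨ρ, hρ, hball⟩ := Metric.mem_nhds_iff.1 hps
    refine (P.isConvexPartition_iff (Finset.insert_subset (hNC'.1 hI.1.1)
      (hI.1.2.trans hNC'.1)) hI.2.1).1 hI.2.2 p hp ⟨m, hm, min r ρ, lt_min hr hρ,
        fun x hx hpos => mem_region.2 ?_⟩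
    have h1 := mem_region.1 (hH x (Metric.ball_subset_ball (min_le_left _ _) hx) hpos)
    refine ⟨h1.1, fun s hs hxs => ?_⟩
    by_cases hsz : s = s(v, z)
    · subst hsz
      exact hball (Metric.ball_subset_ball (min_le_right _ _) hx) hxs
    · exact h1.2 s (Finset.mem_erase.2 ⟨hsz, Finset.mem_of_mem_insert_of_ne hs hsz⟩) hxs
  · intro hI
    have hI' := (mem_NCc.1 hI).1
    refine mem_NCc_of_subset hNC hI ((Finset.erase_subset _ _).trans (Finset.subset_insert _ _)) ?_
    refine Finset.insert_subset hdz fun e he => ?_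
    by_cases hez : e = s(v, z)
    · rw [hez]; exact hdz
    · exact hI' (Finset.mem_erase.2 ⟨hez, he⟩)

end IsSplit

theorem convexSum_empty_of_n_eq_three {P : SimplePolygon} (h3 : P.n = 3) : P.convexSum ∅ = 1 := by
  have : P.NCc ∅ = {∅} := by
    ext I
    rw [mem_NCc, Finset.subset_empty, Finset.mem_singleton]
    refine ⟨fun h => h.1, ?_⟩
    rintro rfl
    refine ⟨rfl, by simp, fun U hU => ?_⟩
    rw [pieces_empty, mem_singleton_iff] at hU
    rw [hU]; exact P.convex_inside_of_n_eq_three h3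
  rw [convexSum, this, h3]
  simp

open Classical in
/-- Both sides of the formula satisfy the same recursion for the removal of a diagonal from `J`,
so by induction on the number of vertices their difference does not depend on `J`. Both sides
vanish if `J` consists of all diagonals from the tip of an ear. -/
theorem χ_sdiff_eq_convexSum (P : SimplePolygon) {J : Finset Seg} (hJ : J ∈ NC P.diagonals) :
    χ (P.diagonals \ J) = P.convexSum J := by
  induction hk : P.n using Nat.strong_induction_on generalizing P J with
  | _ k ih =>
    have part : ∀ {K : Finset Seg} {d : Seg} {Q R : SimplePolygon}, K ∈ NC P.diagonals →
        P.IsSplit d Q R → χ (Q.diagonals \ K) = Q.convexSum (K ∩ Q.diagonals) := by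
      intro K d Q R hK h
      rw [← ih Q.n (hk ▸ h.n_lt) Q (h.inter_mem_NC hK) rfl, Finset.sdiff_inter_self_right]
    have step : ∀ K ∈ NC P.diagonals, ∀ d ∈ K, χ (P.diagonals \ K.erase d) -
        P.convexSum (K.erase d) = χ (P.diagonals \ K) - P.convexSum K := by
      intro K hK d hd
      obtain ⟨Q, R, h⟩ := P.exists_isSplit ((mem_NC.1 hK).1 hd)
      rw [h.χ_erase hK hd, h.convexSum_erase hK hd, part hK h, part hK h.symm]
      ring
    have hempty : ∀ K ∈ NC P.diagonals, χ (P.diagonals \ ∅) - P.convexSum ∅ =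
        χ (P.diagonals \ K) - P.convexSum K := by
      intro K
      induction K using Finset.induction_on with
      | empty => exact fun _ => rfl
      | insert d K hd ihK =>
        intro hK
        rw [ihK (mem_NC_of_subset hK (Finset.subset_insert _ _)),
          ← step _ hK d (Finset.mem_insert_self _ _), Finset.erase_insert hd]
    have h0 : χ (P.diagonals \ ∅) - P.convexSum ∅ = 0 := by
      rcases P.three_le.eq_or_lt with h3 | h4
      · rw [P.diagonals_eq_empty h3.symm, Finset.sdiff_empty, χ_empty,
          convexSum_empty_of_n_eq_three h3.symm, sub_self]
      · obtain ⟨d, hd, Q, R, h, hQn, v, hvQ, hvR, hQ⟩ := P.exists_ear h4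
        rw [hempty _ (diagonalsAt_mem_NC (h.verts_left hvQ)), h.χ_sdiff_diagonalsAt hd hvR hQ,
          h.convexSum_diagonalsAt hd hQn hvQ hvR hQ, sub_self]
    rw [hempty J hJ] at h0
    linarith

open Classical in
/-- If all convex partitions within `J` use the diagonal `d`, then there are none within `J`
without `d`, so the left-hand side of the recursion for `d` vanishes. -/
theorem IsSplit.χ_sdiff_eq_mul {P Q R : SimplePolygon} {d : Seg} (h : P.IsSplit d Q R)
    {J : Finset Seg} (hJ : J ∈ NC P.diagonals) (hd : d ∈ J) (hall : ∀ I ∈ P.NCc J, d ∈ I) :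
    χ (P.diagonals \ J) = χ (Q.diagonals \ J) * χ (R.diagonals \ J) := by
  have h1 := P.χ_sdiff_eq_convexSum (mem_NC_of_subset hJ (Finset.erase_subset d J))
  have h2 : P.NCc (J.erase d) = ∅ := by
    refine Finset.eq_empty_of_forall_notMem fun I hI => ?_
    rw [mem_NCc, Finset.subset_erase] at hI
    exact hI.1.2 (hall I (mem_NCc.2 ⟨hI.1.1, hI.2⟩))
  rw [convexSum, h2, Finset.sum_empty, mul_zero, h.χ_erase hJ hd] at h1
  linarith

end SimplePolygon

/-! ### Minimal convex partitions and divisions -/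

namespace SimplePolygon

section Minimal

variable {P : SimplePolygon} {J : Finset Seg}

theorem mem_minimalNCc {K : Finset Seg} :
    K ∈ P.minimalNCc J ↔ Minimal (fun K => K ∈ P.NCc J) K := by
  classical
  simp only [minimalNCc, Finset.mem_filter, and_iff_right_iff_imp]
  exact fun h => h.prop

theorem exists_mem_minimalNCc {I : Finset Seg} (hI : I ∈ P.NCc J) :
    ∃ K ∈ P.minimalNCc J, K ⊆ I := by
  obtain ⟨K, hK, hmin⟩ := exists_minimal_le_of_wellFoundedLT (fun K => K ∈ P.NCc J) I hI
  exact ⟨K, mem_minimalNCc.2 hmin, hK⟩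

theorem convexSum_eq_zero_of_notMem (hJ : J ∈ NC P.diagonals) (h : J ∉ P.NCc J) :
    P.convexSum J = 0 := by
  have : P.NCc J = ∅ := Finset.eq_empty_of_forall_notMem fun I hI =>
    h (mem_NCc_of_subset hJ hI (mem_NCc.1 hI).1 Finset.Subset.rfl)
  rw [convexSum, this, Finset.sum_empty, mul_zero]

/-- A diagonal in no minimal convex partition can be added and removed freely. -/
theorem convexSum_eq_zero_of_forall_notMem (hJ : J ∈ NC P.diagonals) {d : Seg} (hd : d ∈ J)
    (h : ∀ K ∈ P.minimalNCc J, d ∉ K) : P.convexSum J = 0 := by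
  classical
  rw [convexSum, Finset.sum_neg_one_pow_card_eq_zero d, mul_zero]
  intro I
  constructor
  · intro hI
    obtain ⟨K, hK, hKI⟩ := exists_mem_minimalNCc hI
    refine mem_NCc_of_subset hJ (mem_minimalNCc.1 hK).prop
      (Finset.subset_erase.2 ⟨?_, h K hK⟩)
      ((Finset.erase_subset _ _).trans ((Finset.subset_insert _ _).trans (mem_NCc.1 hI).1))
    exact (Finset.subset_insert_iff_of_notMem (h K hK)).1 hKI
  · intro hI
    refine mem_NCc_of_subset hJ hI ((Finset.erase_subset _ _).trans (Finset.subset_insert _ _))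
      (Finset.insert_subset hd fun e he => ?_)
    by_cases hed : e = d
    · exact hed ▸ hd
    · exact (mem_NCc.1 hI).1 (Finset.mem_erase.2 ⟨hed, he⟩)

theorem convexSum_of_minimalNCc_eq_singleton_self (h : P.minimalNCc J = {J}) :
    P.convexSum J = (-1) ^ (P.n + 1 + J.card) := by
  have hJ : J ∈ P.NCc J := (mem_minimalNCc.1 (by rw [h]; exact Finset.mem_singleton_self J)).prop
  have : P.NCc J = {J} := by
    refine Finset.eq_singleton_iff_unique_mem.2 ⟨hJ, fun I hI => ?_⟩
    obtain ⟨K, hK, hKI⟩ := exists_mem_minimalNCc hI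
    rw [h, Finset.mem_singleton] at hK
    exact (mem_NCc.1 hI).1.antisymm (hK ▸ hKI)
  rw [convexSum, this, Finset.sum_singleton, pow_add _ (P.n + 1)]

end Minimal

section Division

open Classical in
/-- A polygon is divided along the diagonals of `I` one by one. They belong to all convex
partitions within `J`, so the characteristic is multiplicative at each step. -/
theorem exists_division (P : SimplePolygon) {J I : Finset Seg} (hJ : J ∈ NC P.diagonals)
    (hJc : J ∈ P.NCc J) (hI : ∀ K ∈ P.NCc J, I ⊆ K) :
    ∃ (ι : Type) (_ : Fintype ι) (Q : ι → SimplePolygon), Fintype.card ι = I.card + 1 ∧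
      (∀ k, (Q k).edges ⊆ P.edges ∪ (I : Set Seg) ∧ (Q k).diagonals ⊆ P.diagonals) ∧
      BijOn (fun k => (Q k).inside) univ (P.pieces I) ∧
      χ (P.diagonals \ J) = ∏ k, χ ((Q k).diagonals \ J) := by
  induction hk : I.card using Nat.strong_induction_on generalizing P J I with
  | _ k ih =>
    rcases I.eq_empty_or_nonempty with rfl | ⟨d, hd⟩
    · refine ⟨Unit, inferInstance, fun _ => P, by simp [← hk],
        fun _ => ⟨subset_union_left, Finset.Subset.rfl⟩, ?_, by simp⟩
      rw [pieces_empty]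
      exact ⟨fun _ _ => rfl, fun _ _ _ _ _ => rfl, fun x hx => ⟨(), trivial, hx.symm⟩⟩
    · have hIJ := hI J hJc
      have hJ' := mem_NC.1 hJ
      obtain ⟨S, T, h⟩ := P.exists_isSplit (hJ'.1 (hIJ hd))
      have e := h.eq_insert (hJ'.1 (hIJ hd)) (hIJ.trans hJ'.1) hd
        (hJ'.2.mono (by exact_mod_cast hIJ))
      have part : ∀ {S T : SimplePolygon}, P.IsSplit d S T → ∃ (ι : Type) (_ : Fintype ι)
          (Q : ι → SimplePolygon), Fintype.card ι = (I ∩ S.diagonals).card + 1 ∧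
          (∀ k, (Q k).edges ⊆ P.edges ∪ (I : Set Seg) ∧ (Q k).diagonals ⊆ P.diagonals) ∧
          BijOn (fun k => (Q k).inside) univ (S.pieces (I ∩ S.diagonals)) ∧
          χ (S.diagonals \ J) = ∏ k, χ ((Q k).diagonals \ J) := by
        intro S T h
        have hlt : (I ∩ S.diagonals).card < k := by
          rw [← hk]
          exact Finset.card_lt_card ((Finset.ssubset_iff_of_subset Finset.inter_subset_left).2
            ⟨d, hd, fun hd' => h.notMem_left (Finset.mem_inter.1 hd').2⟩)
        obtain ⟨ι, hι, Q, h1, h2, h3, h4⟩ := ih _ hlt S (h.inter_mem_NC hJ)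
          (h.inter_mem_NCc hJ hJc (hIJ hd)) (I := I ∩ S.diagonals) (by
            intro K hK x hx
            obtain ⟨hxI, hxS⟩ := Finset.mem_inter.1 hx
            have hm := h.insert_union_mem_NCc hJ (hIJ hd) hK
              (h.symm.inter_mem_NCc hJ hJc (hIJ hd))
            have hx' := hI _ hm hxI
            simp only [Finset.mem_insert, Finset.mem_union, Finset.mem_inter] at hx'
            rcases hx' with rfl | hx' | hx'
            · exact absurd hxS h.notMem_left
            · exact hx'
            · exact absurd hx'.2 (Finset.disjoint_left.1 h.disjoint_diagonals hxS)) rfl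
        have hQS : ∀ k, (Q k).inside ⊆ S.inside := fun k =>
          (subset_region_of_mem_pieces (h3.mapsTo (mem_univ k))).trans sdiff_subset
        refine ⟨ι, hι, Q, h1, fun k => ⟨fun s hs => ?_,
          (h2 k).2.trans h.subset_diagonals⟩, h3, ?_⟩
        · rcases (h2 k).1 hs with hs | hs
          · have : s ∈ insert d P.edges := by rw [← h.edges_union]; exact Or.inl hs
            rcases this with rfl | hs
            · exact Or.inr hd
            · exact Or.inl hs
          · exact Or.inr (Finset.mem_inter.1 hs).1
        · rw [Finset.sdiff_inter_self_right] at h4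
          rw [h4]
          refine Finset.prod_congr rfl fun k _ => ?_
          congr 1
          ext x
          simp only [Finset.mem_sdiff, Finset.mem_inter, not_and]
          refine and_congr_right fun hx => ⟨fun hh hxJ => hh hxJ ((h2 k).2 hx),
            fun hh hxJ => absurd hxJ hh⟩
      obtain ⟨ι₁, hι₁, Q₁, h1, h2, h3, h4⟩ := part h
      obtain ⟨ι₂, hι₂, Q₂, h1', h2', h3', h4'⟩ := part h.symm
      refine ⟨ι₁ ⊕ ι₂, inferInstance, Sum.elim Q₁ Q₂, ?_, ?_, ?_, ?_⟩
      · have : I.card = (I ∩ S.diagonals).card + (I ∩ T.diagonals).card + 1 := by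
          conv_lhs => rw [e]
          rw [Finset.card_insert_of_notMem, Finset.card_union_of_disjoint]
          · exact h.disjoint_diagonals.mono Finset.inter_subset_right Finset.inter_subset_right
          · rw [Finset.mem_union, not_or]
            exact ⟨fun hh => h.notMem_left (Finset.mem_inter.1 hh).2,
              fun hh => h.symm.notMem_left (Finset.mem_inter.1 hh).2⟩
        rw [Fintype.card_sum, h1, h1']; omega
      · rintro (k | k)
        exacts [h2 k, h2' k]
      · rw [h.pieces_insert e Finset.inter_subset_right Finset.inter_subset_right]
        have hS : ∀ k, (Q₁ k).inside ⊆ S.inside := fun k =>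
          (subset_region_of_mem_pieces (h3.mapsTo (mem_univ k))).trans sdiff_subset
        have hT : ∀ k, (Q₂ k).inside ⊆ T.inside := fun k =>
          (subset_region_of_mem_pieces (h3'.mapsTo (mem_univ k))).trans sdiff_subset
        have hne : ∀ k l, (Q₁ k).inside ≠ (Q₂ l).inside := fun k l he => by
          obtain ⟨x, hx⟩ := (Q₁ k).inside_nonempty
          exact disjoint_left.1 h.disjoint (hS k hx) (hT l (he ▸ hx))
        refine ⟨?_, ?_, ?_⟩
        · rintro (k | k) -
          exacts [Or.inl (h3.mapsTo (mem_univ k)), Or.inr (h3'.mapsTo (mem_univ k))]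
        · rintro (k | k) - (l | l) - he
          · exact congrArg _ (h3.injOn (mem_univ _) (mem_univ _) he)
          · exact absurd he (hne k l)
          · exact absurd he.symm (hne l k)
          · exact congrArg _ (h3'.injOn (mem_univ _) (mem_univ _) he)
        · rintro U (hU | hU)
          · obtain ⟨k, -, hk⟩ := h3.surjOn hU
            exact ⟨Sum.inl k, trivial, hk⟩
          · obtain ⟨k, -, hk⟩ := h3'.surjOn hU
            exact ⟨Sum.inr k, trivial, hk⟩
      · rw [Fintype.prod_sum_type, h.χ_sdiff_eq_mul hJ (hIJ hd) (fun K hK => hI K hK hd), h4, h4']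
        rfl

/-- A polygon in a division of `P` has as vertices the vertices of `P` on its boundary, because no
vertex of `P` lies in the relative interior of one of its edges. -/
theorem mem_verts_iff_of_edges_subset {P Q : SimplePolygon} {I : Finset Seg}
    (hI : I ⊆ P.diagonals) (hQ : Q.edges ⊆ P.edges ∪ (I : Set Seg)) {v : Plane} :
    v ∈ Q.verts ↔ v ∈ P.verts ∧ v ∈ Q.curve := by
  have hs : ∀ s ∈ Q.edges, ∃ a ∈ P.verts, ∃ b ∈ P.verts, a ≠ b ∧ s = s(a, b) := by
    intro s hs
    rcases hQ hs with hs | hs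
    · exact P.exists_of_mem_edges hs
    · exact P.exists_of_mem_diagonals (hI hs)
  constructor
  · rintro ⟨k, rfl⟩
    refine ⟨?_, Q.verts_subset_curve (Q.vtx_mem_verts k)⟩
    obtain ⟨a, ha, b, hb, -, he⟩ := hs _ (Q.edge_mem_edges k)
    have : Q.vtx k ∈ s(a, b) := he ▸ Sym2.mem_mk_left _ _
    rcases Sym2.mem_iff.1 this with h | h <;> rw [h] <;> assumption
  · rintro ⟨hv, hc⟩
    obtain ⟨s, hsQ, hvs⟩ := Q.exists_edge_of_mem_curve hc
    obtain ⟨p, -, -, rfl⟩ := P.exists_eq_of_mem_carrier (hs s hsQ) hv hvs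
    exact mem_verts_of_mem_edge hsQ (Sym2.mem_mk_left _ _)

/-- Polygons of two divisions with the same interior have the same diagonals, although they may
differ in the numbering of their vertices. -/
theorem diagonals_eq_of_inside_eq {P Q R : SimplePolygon} {I : Finset Seg}
    (hI : I ⊆ P.diagonals) (hQ : Q.edges ⊆ P.edges ∪ (I : Set Seg))
    (hR : R.edges ⊆ P.edges ∪ (I : Set Seg)) (h : Q.inside = R.inside) :
    Q.diagonals = R.diagonals := by
  have hv : Q.verts = R.verts := by
    ext v
    rw [mem_verts_iff_of_edges_subset hI hQ, mem_verts_iff_of_edges_subset hI hR,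
      curve_eq_of_inside_eq h]
  ext d
  rw [mem_diagonals, mem_diagonals, hv, h]

open Classical in
theorem χ_eq_prod_of_isDivision {P : SimplePolygon} {J I : Finset Seg} (hJ : J ∈ NC P.diagonals)
    (hJc : J ∈ P.NCc J) (hI : ∀ K ∈ P.NCc J, I ⊆ K) :
    (∃ Q : Fin (I.card + 1) → SimplePolygon, P.IsDivision I Q) ∧
      ∀ (m : ℕ) (Q : Fin m → SimplePolygon), P.IsDivision I Q →
        m = I.card + 1 ∧ χ (P.diagonals \ J) = ∏ k, χ ((Q k).diagonals \ J) := by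
  obtain ⟨ι, hι, S, hcard, hS, hbij, hprod⟩ := P.exists_division hJ hJc hI
  constructor
  · let e : Fin (I.card + 1) ≃ ι := (finCongr hcard.symm).trans (Fintype.equivFin ι).symm
    exact ⟨S ∘ e, fun k => (hS _).1, hbij.comp ⟨mapsTo_univ _ _, e.injective.injOn,
      fun k _ => ⟨e.symm k, trivial, e.apply_symm_apply k⟩⟩⟩
  · rintro m Q ⟨hQ, hQbij⟩
    have hID : I ⊆ P.diagonals := (hI J hJc).trans (mem_NC.1 hJ).1
    choose σ hσ using fun k : Fin m => hbij.surjOn (hQbij.mapsTo (mem_univ k))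
    have hσ' : ∀ k, (S (σ k)).inside = (Q k).inside := fun k => (hσ k).2
    have hσbij : Function.Bijective σ := by
      constructor
      · intro k l hkl
        refine hQbij.injOn (mem_univ _) (mem_univ _) ?_
        show (Q k).inside = (Q l).inside
        rw [← hσ', ← hσ', hkl]
      · intro i
        obtain ⟨k, -, hk⟩ := hQbij.surjOn (hbij.mapsTo (mem_univ i))
        refine ⟨k, hbij.injOn (mem_univ _) (mem_univ _) ?_⟩
        exact (hσ' k).trans hk
    refine ⟨?_, ?_⟩
    · have := Fintype.card_of_bijective hσbij
      rw [Fintype.card_fin] at this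
      omega
    · rw [hprod]
      refine (Fintype.prod_bijective σ hσbij _ _ fun k => ?_).symm
      rw [diagonals_eq_of_inside_eq hID (hQ k) (hS (σ k)).1 (hσ' k).symm]

end Division

end SimplePolygon

/-! ### Zigzag polygons -/

namespace SimplePolygon

/-- The points `(j, j ^ 2)` for odd `j` and `(j, j ^ 2 - 2)` for even `j`. -/
noncomputable def zig (j : ℕ) : Plane := !₂[(j : ℝ), (j : ℝ) ^ 2 - 2 * ((j + 1) % 2 : ℕ)]

@[simp] theorem zig_fst (j : ℕ) : zig j 0 = j := by simp [zig]

theorem zig_snd_of_even {j : ℕ} (h : Even j) : zig j 1 = (j : ℝ) ^ 2 - 2 := by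
  have : (j + 1) % 2 = 1 := Nat.odd_iff.1 h.add_one
  simp [zig, this]

theorem zig_snd_of_odd {j : ℕ} (h : Odd j) : zig j 1 = (j : ℝ) ^ 2 := by
  have : (j + 1) % 2 = 0 := Nat.even_iff.1 h.add_one
  simp [zig, this]

theorem zig_injective : Function.Injective zig := fun i j h => by
  have := congrArg (fun x : Plane => x 0) h
  simpa using this

/-- No three of the points are collinear. If the indices have the same parity, the points lie on a
parabola; otherwise two indices, say `i` and `j`, have the same parity, and the determinant is
`j - i` times an odd number. -/
theorem cross_zig_ne_zero {i j k : ℕ} (hij : i ≠ j) (hjk : j ≠ k) (hik : i ≠ k) :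
    cross (zig j - zig i) (zig k - zig i) ≠ 0 := by
  have key : ∀ x y t : ℤ, x ≠ y → ((y - x) * (2 * t + 1) : ℝ) ≠ 0 := by
    intro x y t hxy
    exact_mod_cast mul_ne_zero (sub_ne_zero.2 hxy.symm) (by omega)
  have key3 : ∀ x y z : ℕ, x ≠ y → y ≠ z → x ≠ z →
      ((y - x) * ((z - x) * (z - y)) : ℝ) ≠ 0 := by
    intro x y z h1 h2 h3
    refine mul_ne_zero (sub_ne_zero.2 ?_) (mul_ne_zero (sub_ne_zero.2 ?_) (sub_ne_zero.2 ?_)) <;>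
      norm_cast <;> omega
  intro h
  simp only [cross, PiLp.sub_apply, zig_fst] at h
  rcases Nat.even_or_odd' i with ⟨a, rfl | rfl⟩ <;>
    rcases Nat.even_or_odd' j with ⟨b, rfl | rfl⟩ <;>
      rcases Nat.even_or_odd' k with ⟨c, rfl | rfl⟩
  all_goals
    try simp only [zig_snd_of_even (even_two_mul a)] at h
    try simp only [zig_snd_of_even (even_two_mul b)] at h
    try simp only [zig_snd_of_even (even_two_mul c)] at h
    try simp only [zig_snd_of_odd (odd_two_mul_add_one a)] at h
    try simp only [zig_snd_of_odd (odd_two_mul_add_one b)] at h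
    try simp only [zig_snd_of_odd (odd_two_mul_add_one c)] at h
    push_cast at h
  · refine key3 a b c (by omega) (by omega) (by omega) ?_
    linear_combination h / 8
  · refine key a b (2 * ((c : ℤ) - a) * (c - b) + (c - a) + (c - b) + 1) (by omega) ?_
    push_cast; linear_combination h / 2
  · refine key a c (2 * ((b : ℤ) - a) * (b - c) + (b - a) + (b - c) + 1) (by omega) ?_
    push_cast; linear_combination -h / 2
  · refine key b c (2 * ((a : ℤ) - b) * (a - c) - (a - b) - (a - c) - 1) (by omega) ?_
    push_cast; linear_combination h / 2
  · refine key b c (2 * ((a : ℤ) - b) * (a - c) + (a - b) + (a - c) + 1) (by omega) ?_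
    push_cast; linear_combination h / 2
  · refine key a c (2 * ((b : ℤ) - a) * (b - c) - (b - a) - (b - c) - 1) (by omega) ?_
    push_cast; linear_combination -h / 2
  · refine key a b (2 * ((c : ℤ) - a) * (c - b) - (c - a) - (c - b) - 1) (by omega) ?_
    push_cast; linear_combination h / 2
  · refine key3 a b c (by omega) (by omega) (by omega) ?_
    linear_combination h / 8

theorem sq_sub_two_le_zig_snd (j : ℕ) : (j : ℝ) ^ 2 - 2 ≤ zig j 1 ∧ zig j 1 ≤ (j : ℝ) ^ 2 := by
  rcases Nat.even_or_odd j with h | h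
  · rw [zig_snd_of_even h]; constructor <;> linarith
  · rw [zig_snd_of_odd h]; constructor <;> linarith

/-- The points lie below the line through `zig 0` and `zig (2 * M)`. -/
theorem zig_snd_le {M j : ℕ} (hM : 2 ≤ M) (hj : j ≤ 2 * M) :
    zig j 1 ≤ 2 * M * j - 2 ∧ (zig j 1 = 2 * M * j - 2 → j = 0 ∨ j = 2 * M) := by
  have hj' : (j : ℝ) ≤ 2 * M := by exact_mod_cast hj
  have h0 : (0 : ℝ) ≤ j := Nat.cast_nonneg j
  rcases Nat.even_or_odd j with h | h
  · rw [zig_snd_of_even h]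
    refine ⟨by nlinarith, fun he => ?_⟩
    have : (j : ℝ) * (2 * M - j) = 0 := by linear_combination -he
    rcases mul_eq_zero.1 this with h1 | h1
    · exact Or.inl (by exact_mod_cast h1)
    · right
      have : (j : ℝ) = (2 * M : ℕ) := by push_cast; linarith
      exact_mod_cast this
  · rw [zig_snd_of_odd h]
    have hlt : (j : ℝ) ^ 2 < 2 * M * j - 2 := by
      have h1 : (1 : ℝ) ≤ j := by
        obtain ⟨a, rfl⟩ := h
        push_cast; nlinarith [Nat.cast_nonneg (α := ℝ) a]
      have h2 : (j : ℝ) + 1 ≤ 2 * M := by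
        obtain ⟨a, rfl⟩ := h
        have : 2 * a + 1 + 1 ≤ 2 * M := by omega
        exact_mod_cast this
      have h3 : (2 : ℝ) ≤ M := by exact_mod_cast hM
      nlinarith [mul_nonneg (sub_nonneg.2 h1) (by linarith : (0 : ℝ) ≤ 2 * M - 1 - j)]
    exact ⟨hlt.le, fun he => absurd he hlt.ne⟩

theorem mem_segment_zig {j : ℕ} {x : Plane} (hx : x ∈ segment ℝ (zig j) (zig (j + 1))) :
    ∃ t : ℝ, 0 ≤ t ∧ t ≤ 1 ∧ x = zig j + t • (zig (j + 1) - zig j) ∧ x 0 = j + t ∧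
      x 1 = (1 - t) * zig j 1 + t * zig (j + 1) 1 := by
  rw [segment_eq_image'] at hx
  obtain ⟨t, ht, rfl⟩ := hx
  refine ⟨t, ht.1, ht.2, rfl, ?_, ?_⟩
  · simp
  · simp; ring

theorem mem_segment_zig_top {M : ℕ} {x : Plane} (hx : x ∈ segment ℝ (zig (2 * M)) (zig 0)) :
    x 1 = 2 * M * x 0 - 2 := by
  rw [segment_eq_image'] at hx
  obtain ⟨t, -, rfl⟩ := hx
  simp [zig_snd_of_even (even_two_mul M), zig_snd_of_even (show Even 0 by simp)]
  ring

/-- The polygon with the vertices `zig 0, …, zig (2 * M)`. Its edges form a zigzag at a parabola,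
closed by the top edge from `zig (2 * M)` to `zig 0`; the vertices with odd index, which lie on
the parabola, are its reflex vertices. -/
noncomputable def zigzag (M : ℕ) (hM : 2 ≤ M) : SimplePolygon :=
  ofSeq (2 * M + 1) (by omega) zig (fun _ _ _ _ h => zig_injective h)
    (fun _ _ _ _ _ _ h1 h2 h3 => cross_zig_ne_zero h1 h2 h3)
    (fun i j hij hj x hxi hxj => by
      obtain ⟨t, ht0, ht1, -, h0, -⟩ := mem_segment_zig hxi
      obtain ⟨t', ht0', ht1', hx, h0', -⟩ := mem_segment_zig hxj
      have hle : (j : ℝ) ≤ (i + 1 : ℕ) := by push_cast; linarith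
      have hji : j = i + 1 := le_antisymm (by exact_mod_cast hle) hij
      subst hji
      push_cast at h0'
      have : t' = 0 := by linarith
      rw [this, zero_smul, add_zero] at hx
      exact ⟨rfl, hx⟩)
    (fun i hi x hxi hxt => by
      rw [Nat.add_sub_cancel] at hxt ⊢
      have htop := mem_segment_zig_top hxt
      obtain ⟨t, ht0, ht1, hx, h0, h1⟩ := mem_segment_zig hxi
      obtain ⟨h2, h3⟩ := zig_snd_le (j := i) hM (by omega)
      obtain ⟨h2', h3'⟩ := zig_snd_le (j := i + 1) hM (by omega)
      push_cast at h2'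
      rw [h0, h1] at htop
      have hsum : (1 - t) * (2 * M * i - 2 - zig i 1) +
          t * (2 * M * (i + 1) - 2 - zig (i + 1) 1) = 0 := by linear_combination -htop
      have ha := mul_nonneg (sub_nonneg.2 ht1) (sub_nonneg.2 h2)
      have hb := mul_nonneg ht0 (sub_nonneg.2 h2')
      have ha0 := (add_eq_zero_iff_of_nonneg ha hb).1 hsum
      rcases mul_eq_zero.1 ha0.1 with h | h
      · have : t = 1 := by linarith
        subst this
        left
        have := h3' (by push_cast; linarith [ha0.2])
        have hi' : i + 1 = 2 * M := by omega
        rw [one_smul, add_sub_cancel] at hx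
        exact ⟨hi', by rw [hx, hi']⟩
      · have := h3 (by linarith)
        have hi0 : i = 0 := by omega
        rcases mul_eq_zero.1 ha0.2 with h' | h'
        · right; rw [h', zero_smul, add_zero] at hx; exact ⟨hi0, by rw [hx, hi0]⟩
        · exfalso
          have := h3' (by push_cast; linarith)
          omega)

variable {M : ℕ} {hM : 2 ≤ M}

theorem zigzag_n : (zigzag M hM).n = 2 * M + 1 := rfl

theorem zigzag_vtx {k : ℕ} (hk : k < 2 * M + 1) : (zigzag M hM).vtx k = zig k := ofSeq_vtx hk

theorem mem_zigzag_verts {x : Plane} : x ∈ (zigzag M hM).verts ↔ ∃ k ≤ 2 * M, x = zig k := by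
  rw [mem_verts_iff _ 0]
  simp only [zero_add, zigzag_n]
  constructor
  · rintro ⟨k, hk, rfl⟩
    exact ⟨k, by omega, zigzag_vtx hk⟩
  · rintro ⟨k, hk, rfl⟩
    exact ⟨k, by omega, (zigzag_vtx (by omega)).symm⟩

theorem mem_zigzag_edges {s : Seg} : s ∈ (zigzag M hM).edges ↔
    (∃ k < 2 * M, s = s(zig k, zig (k + 1))) ∨ s = s(zig (2 * M), zig 0) := by
  have hlast : (zigzag M hM).vtx (2 * M + 1) = zig 0 := ofSeq_vtx_self
  rw [mem_edges_iff _ 0]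
  simp only [zero_add, zigzag_n]
  constructor
  · rintro ⟨k, hk, rfl⟩
    rcases Nat.lt_or_ge k (2 * M) with h | h
    · exact Or.inl ⟨k, h, by rw [zigzag_vtx (by omega), zigzag_vtx (by omega)]⟩
    · obtain rfl : k = 2 * M := by omega
      exact Or.inr (by rw [zigzag_vtx (by omega), hlast])
  · rintro (⟨k, hk, rfl⟩ | rfl)
    · exact ⟨k, by omega, by rw [zigzag_vtx (by omega), zigzag_vtx (by omega)]⟩
    · exact ⟨2 * M, by omega, by rw [zigzag_vtx (by omega), hlast]⟩

/-- The polygon contains the points above the parabola and below its top edge. -/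
theorem mem_zigzag_inside {x : Plane} (h1 : x 0 ^ 2 < x 1) (h2 : x 1 < 2 * M * x 0 - 2) :
    x ∈ (zigzag M hM).inside := by
  set P := zigzag M hM with hP
  set W : Set Plane := {x | x 0 ^ 2 < x 1} ∩ {x | x 1 < 2 * M * x 0 - 2} with hW
  have hM' : (2 : ℝ) ≤ M := by exact_mod_cast hM
  have hWconv : Convex ℝ W := by
    rintro x ⟨hx1, hx2⟩ y ⟨hy1, hy2⟩ a b ha hb hab
    simp only [mem_ofPred_eq] at hx1 hx2 hy1 hy2
    obtain rfl : b = 1 - a := by linarith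
    refine ⟨?_, ?_⟩ <;> simp only [mem_ofPred_eq, PiLp.add_apply, PiLp.smul_apply, smul_eq_mul]
    · rcases ha.eq_or_lt with rfl | ha'
      · simpa using hy1
      · have h3 : a * x 0 ^ 2 < a * x 1 := by gcongr
        have h4 : (1 - a) * y 0 ^ 2 ≤ (1 - a) * y 1 := by gcongr
        nlinarith [mul_nonneg (mul_nonneg ha hb) (sq_nonneg (x 0 - y 0))]
    · rcases ha.eq_or_lt with rfl | ha'
      · simpa using hy2
      · have h3 : a * x 1 < a * (2 * M * x 0 - 2) := by gcongr
        have h4 : (1 - a) * y 1 ≤ (1 - a) * (2 * M * y 0 - 2) := by gcongr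
        linarith
  have hWcurve : W ⊆ P.curveᶜ := by
    rintro y ⟨hy1, hy2⟩ hc
    simp only [mem_ofPred_eq] at hy1 hy2
    obtain ⟨s, hs, hys⟩ := P.exists_edge_of_mem_curve hc
    rcases mem_zigzag_edges.1 hs with ⟨k, hk, rfl⟩ | rfl
    · obtain ⟨t, ht0, ht1, -, e0, e1⟩ := mem_segment_zig hys
      have hpar : (1 - t) * zig k 1 + t * zig (k + 1) 1 ≤ (k + t) ^ 2 := by
        rcases Nat.even_or_odd k with h | h
        · rw [zig_snd_of_even h, zig_snd_of_odd h.add_one]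
          push_cast; nlinarith
        · rw [zig_snd_of_odd h, zig_snd_of_even h.add_one]
          push_cast; nlinarith
      rw [e0, e1] at hy1
      linarith
    · rw [mem_segment_zig_top hys] at hy2
      exact lt_irrefl _ hy2
  -- close to its midpoint, the interior lies below the top edge
  have htop : s(zig (2 * M), zig 0) ∈ P.edges := mem_zigzag_edges.2 (Or.inr rfl)
  have hmid := midpoint_mem_openSegment (zig (2 * M)) (zig 0)
  set c := (2⁻¹ : ℝ) • zig (2 * M) + (2⁻¹ : ℝ) • zig 0 with hc
  have hc0 : c 0 = M := by simp [hc]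
  have hc1 : c 1 = 2 * M ^ 2 - 2 := by
    simp [hc, zig_snd_of_even (even_two_mul M), zig_snd_of_even (show Even 0 by simp)]
    ring
  set e : Plane := !₂[0, 1] with he
  have he0 : e 0 = 0 := by simp [he]
  have he1 : e 1 = 1 := by simp [he]
  obtain ⟨σ, hσ, hside⟩ := exists_side htop hmid
  have hcross : cross (zig 0 - zig (2 * M)) e = -(2 * M) := by
    simp [cross, he0, he1]
  set n : Plane := !₂[1, 2 * M] with hn
  have hn' : ∀ x : Plane, cross n x = x 1 - 2 * M * x 0 := fun x => by simp [cross, hn]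
  have hn0 : n ≠ 0 := fun h => by
    have := congrArg (fun x : Plane => x 0) h
    simp [hn] at this
  have hbelow : ∀ x ∈ P.inside, cross n x < -2 := fun x hx => by
    refine P.cross_lt_of_mem_inside hn0 (fun v hv => ?_) hx
    obtain ⟨k, hk, rfl⟩ := mem_zigzag_verts.1 hv
    have := (zig_snd_le hM hk).1
    rw [hn', zig_fst]; linarith
  have hneg : σ < 0 ∨ 0 < σ := hσ.lt_or_gt
  have hσ' : 0 < σ := by
    refine hneg.resolve_left fun hlt => ?_
    obtain ⟨t, ht, ht0⟩ := ((hside e (by rw [hcross]; nlinarith)).and eventually_pos).exists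
    have := hbelow _ ht
    rw [hn'] at this
    simp only [PiLp.add_apply, PiLp.smul_apply, smul_eq_mul, hc0, hc1, he0, he1] at this
    nlinarith
  obtain ⟨t, ht, ht0, ht1⟩ := ((hside (-e) (by rw [cross_neg, hcross]; nlinarith)).and
    (Ioo_mem_nhdsGT (show (0 : ℝ) < 1 by norm_num))).exists
  refine P.subset_inside hWconv.isPreconnected hWcurve (x := c + t • -e) ⟨?_, ?_⟩ ht ⟨h1, h2⟩
  · simp only [mem_ofPred_eq, PiLp.add_apply, PiLp.smul_apply, PiLp.neg_apply, smul_eq_mul, hc0,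
      hc1, he0, he1]
    nlinarith
  · simp only [mem_ofPred_eq, PiLp.add_apply, PiLp.smul_apply, PiLp.neg_apply, smul_eq_mul, hc0,
      hc1, he0, he1]
    nlinarith

end SimplePolygon

/-! ### Chords between the reflex vertices -/

namespace SimplePolygon

/-- The reflex vertices of the zigzag polygons. -/
noncomputable def reflexVertex (i : ℕ) : Plane := zig (2 * i + 1)

@[simp] theorem reflexVertex_fst (i : ℕ) : reflexVertex i 0 = 2 * i + 1 := by simp [reflexVertex]

@[simp] theorem reflexVertex_snd (i : ℕ) : reflexVertex i 1 = (2 * i + 1) ^ 2 := by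
  rw [reflexVertex, zig_snd_of_odd (odd_two_mul_add_one i)]; push_cast; rfl

theorem reflexVertex_injective : Function.Injective reflexVertex := fun i j h => by
  have := zig_injective h; omega

/-- The chord between two reflex vertices. -/
noncomputable def reflexChord (p : ℕ × ℕ) : Seg := s(reflexVertex p.1, reflexVertex p.2)

theorem reflexVertex_mem_reflexChord {i : ℕ} {p : ℕ × ℕ} :
    reflexVertex i ∈ reflexChord p ↔ i = p.1 ∨ i = p.2 := by
  rw [reflexChord, Sym2.mem_iff, reflexVertex_injective.eq_iff, reflexVertex_injective.eq_iff]

theorem reflexChord_injOn : InjOn reflexChord {p | p.1 < p.2} := by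
  rintro ⟨a, b⟩ hab ⟨c, d⟩ hcd h
  simp only [mem_ofPred_eq] at hab hcd
  rcases Sym2.eq_iff.1 h with ⟨h1, h2⟩ | ⟨h1, h2⟩
  · exact Prod.ext (reflexVertex_injective h1) (reflexVertex_injective h2)
  · have := reflexVertex_injective h1
    have := reflexVertex_injective h2
    simp only at *
    omega

theorem mem_reflexChord_relInterior {p : ℕ × ℕ} {x : Plane}
    (hx : x ∈ (reflexChord p).relInterior) : ∃ t : ℝ, 0 < t ∧ t < 1 ∧
      x 0 = (1 - t) * (2 * p.1 + 1) + t * (2 * p.2 + 1) ∧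
      x 1 = (1 - t) * (2 * p.1 + 1) ^ 2 + t * (2 * p.2 + 1) ^ 2 := by
  rw [reflexChord, relInterior_mk, openSegment_eq_image'] at hx
  obtain ⟨t, ht, rfl⟩ := hx
  refine ⟨t, ht.1, ht.2, ?_, ?_⟩ <;> simp <;> ring

theorem nonCrossing_of_le {p q : ℕ × ℕ} (hp : p.1 < p.2) (hq : q.1 < q.2) (h : p.2 ≤ q.1) :
    NonCrossing (reflexChord p) (reflexChord q) := by
  refine disjoint_left.2 fun x hx hx' => ?_
  obtain ⟨t, ht0, ht1, h1, -⟩ := mem_reflexChord_relInterior hx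
  obtain ⟨t', ht0', ht1', h1', -⟩ := mem_reflexChord_relInterior hx'
  have hp' : (p.1 : ℝ) < p.2 := by exact_mod_cast hp
  have hq' : (q.1 : ℝ) < q.2 := by exact_mod_cast hq
  have h' : (p.2 : ℝ) ≤ q.1 := by exact_mod_cast h
  nlinarith [mul_pos (sub_pos.2 ht1) (sub_pos.2 hp'), mul_pos ht0' (sub_pos.2 hq')]

theorem nonCrossing_of_nested {p q : ℕ × ℕ} (hq : q.1 < q.2) (h1 : p.1 ≤ q.1) (h2 : q.2 ≤ p.2)
    (hne : p ≠ q) : NonCrossing (reflexChord p) (reflexChord q) := by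
  refine disjoint_left.2 fun x hx hx' => ?_
  obtain ⟨t, ht0, ht1, e0, e1⟩ := mem_reflexChord_relInterior hx
  obtain ⟨t', ht0', ht1', e0', e1'⟩ := mem_reflexChord_relInterior hx'
  have hq' : (q.1 : ℝ) < q.2 := by exact_mod_cast hq
  have h1' : (p.1 : ℝ) ≤ q.1 := by exact_mod_cast h1
  have h2' : (q.2 : ℝ) ≤ p.2 := by exact_mod_cast h2
  -- the second chord lies strictly below the line through the first one
  have hline : x 1 - 2 * (p.1 + p.2 + 1) * x 0 + (2 * p.1 + 1) * (2 * p.2 + 1) = 0 := by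
    rw [e0, e1]; ring
  have hline' : x 1 - 2 * (p.1 + p.2 + 1) * x 0 + (2 * p.1 + 1) * (2 * p.2 + 1) =
      -4 * ((1 - t') * ((q.1 - p.1) * (p.2 - q.1)) + t' * ((q.2 - p.1) * (p.2 - q.2))) := by
    rw [e0', e1']; ring
  have ha : 0 ≤ ((q.1 : ℝ) - p.1) * (p.2 - q.1) := mul_nonneg (by linarith) (by linarith)
  have hb : 0 ≤ ((q.2 : ℝ) - p.1) * (p.2 - q.2) := mul_nonneg (by linarith) (by linarith)
  have hpos : 0 < ((q.1 : ℝ) - p.1) * (p.2 - q.1) ∨ 0 < ((q.2 : ℝ) - p.1) * (p.2 - q.2) := by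
    rcases h1.eq_or_lt with h | h
    · right
      have : q.2 < p.2 := lt_of_le_of_ne h2 fun h' => hne (Prod.ext h h'.symm)
      have : (q.2 : ℝ) < p.2 := by exact_mod_cast this
      exact mul_pos (by linarith) (by linarith)
    · left
      have : (p.1 : ℝ) < q.1 := by exact_mod_cast h
      exact mul_pos (by linarith) (by linarith)
  have h1t : 0 < 1 - t' := by linarith
  have hsum : 0 < (1 - t') * ((q.1 - p.1) * (p.2 - q.1)) + t' * ((q.2 - p.1) * (p.2 - q.2)) := by
    rcases hpos with h | h
    · exact add_pos_of_pos_of_nonneg (mul_pos h1t h) (mul_nonneg ht0'.le hb)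
    · exact add_pos_of_nonneg_of_pos (mul_nonneg h1t.le ha) (mul_pos ht0' h)
  linarith

variable {M : ℕ} {hM : 2 ≤ M}

theorem reflexVertex_mem_verts {i : ℕ} (hi : i < M) : reflexVertex i ∈ (zigzag M hM).verts :=
  mem_zigzag_verts.2 ⟨2 * i + 1, by omega, rfl⟩

theorem reflexVertex_snd_lt (hM : 2 ≤ M) {i : ℕ} (hi : i < M) :
    ((2 * i + 1) ^ 2 : ℝ) < 2 * M * (2 * i + 1) - 2 := by
  obtain ⟨h1, h2⟩ := zig_snd_le (j := 2 * i + 1) hM (by omega)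
  rw [zig_snd_of_odd (odd_two_mul_add_one i)] at h1 h2
  push_cast at h1 h2
  exact lt_of_le_of_ne h1 fun h => by rcases h2 h with h | h <;> omega

theorem reflexChord_mem_diagonals {p : ℕ × ℕ} (h1 : p.1 < p.2) (h2 : p.2 < M) :
    reflexChord p ∈ (zigzag M hM).diagonals := by
  refine (mem_diagonals _).2 ⟨_, reflexVertex_mem_verts (h1.trans h2), _,
    reflexVertex_mem_verts h2, fun h => h1.ne (reflexVertex_injective h), rfl, fun x hx => ?_⟩
  obtain ⟨t, ht0, ht1, e0, e1⟩ := mem_reflexChord_relInterior (p := p) hx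
  have h1' : (p.1 : ℝ) < p.2 := by exact_mod_cast h1
  have ha := mul_lt_mul_of_pos_left (reflexVertex_snd_lt hM (h1.trans h2)) (sub_pos.2 ht1)
  have hb := mul_lt_mul_of_pos_left (reflexVertex_snd_lt hM h2) ht0
  refine mem_zigzag_inside ?_ ?_
  · rw [e0, e1]
    have : 0 < (1 - t) * t * ((p.2 - p.1 : ℝ) * (p.2 - p.1)) :=
      mul_pos (mul_pos (sub_pos.2 ht1) ht0) (mul_pos (sub_pos.2 h1') (sub_pos.2 h1'))
    nlinarith
  · rw [e0, e1]
    linarith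

/-- The vertices with even index are extreme: they lie on the parabola `y = x ^ 2 - 2`, and the
other vertices lie above its tangents. -/
theorem not_hasHalfDisc_zig_even {k : ℕ} (hk : Even k) (hkM : k ≤ 2 * M) :
    ¬ HasHalfDisc (zigzag M hM).inside (zig k) := by
  set n : Plane := !₂[-1, -2 * k] with hn
  have hn' : ∀ x : Plane, cross n x = 2 * k * x 0 - x 1 := fun x => by simp [cross, hn]; ring
  have hn0 : n ≠ 0 := fun h => by
    have := congrArg (fun x : Plane => x 0) h
    simp [hn] at this
  refine not_hasHalfDisc_of_cross_le _ hn0 (mem_zigzag_verts.2 ⟨k, hkM, rfl⟩) fun w hw => ?_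
  obtain ⟨l, -, rfl⟩ := mem_zigzag_verts.1 hw
  have := (sq_sub_two_le_zig_snd l).1
  rw [hn', hn', zig_fst, zig_fst, zig_snd_of_even hk]
  nlinarith [sq_nonneg ((k : ℝ) - l)]

/-- The two edges and a chord at a reflex vertex leave no room for a half-disc. -/
theorem not_hasHalfDisc_reflexVertex {I : Finset Seg} {i a : ℕ} (hi : i < M) (hai : a ≠ i)
    (h : s(reflexVertex i, reflexVertex a) ∈ I) :
    ¬ HasHalfDisc ((zigzag M hM).region I) (reflexVertex i) := by
  rintro ⟨n, hn, r, hr, hH⟩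
  set P := zigzag M hM with hP
  have hblock : ∀ p : Plane, (∀ x ∈ segment ℝ (reflexVertex i) p, x ∉ P.region I) →
      cross n (p - reflexVertex i) ≤ 0 := by
    intro p hp
    by_contra! hpos
    obtain ⟨t, ht, ht0, ht1⟩ := (((tendsto_add_smul (reflexVertex i)
      (p - reflexVertex i)).eventually (Metric.ball_mem_nhds _ hr)).and
      (Ioo_mem_nhdsGT (show (0 : ℝ) < 1 by norm_num))).exists
    refine hp _ ?_ (hH _ ht ?_)
    · rw [segment_eq_image']; exact ⟨t, ⟨ht0.le, ht1.le⟩, rfl⟩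
    · rw [add_sub_cancel_left, cross_smul]; exact mul_pos ht0 hpos
  have hedge : ∀ p : Plane, s(reflexVertex i, p) ∈ P.edges →
      cross n (p - reflexVertex i) ≤ 0 := fun p hp =>
    hblock p fun x hx hxr => hxr.1.1 (P.carrier_subset_curve hp hx)
  have h1 := hedge (zig (2 * i)) (mem_zigzag_edges.2 (Or.inl ⟨2 * i, by omega, Sym2.eq_swap⟩))
  have h2 := hedge (zig (2 * i + 1 + 1)) (mem_zigzag_edges.2 (Or.inl ⟨2 * i + 1, by omega, rfl⟩))
  have h3 := hblock (reflexVertex a) fun x hx hxr => (mem_region.1 hxr).2 _ h hx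
  have hev : Even (2 * i + 1 + 1) := ⟨i + 1, by ring⟩
  simp only [cross, PiLp.sub_apply, zig_fst, reflexVertex_fst, reflexVertex_snd,
    zig_snd_of_even (even_two_mul i), zig_snd_of_even hev] at h1 h2 h3
  push_cast at h1 h2
  have h1' : n 1 ≤ (4 * i + 3) * n 0 := by linarith
  have h2' : (4 * i + 1) * n 0 ≤ n 1 := by linarith
  have hα : 0 ≤ n 0 := by linarith
  have h3' : (a - i : ℝ) * (2 * (a + i + 1) * n 0 - n 1) ≤ 0 := by linarith
  have hα' : n 0 ≤ 0 := by
    rcases lt_or_gt_of_ne hai with hlt | hgt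
    · have hle : (a + 1 : ℝ) ≤ i := by exact_mod_cast hlt
      have : 0 ≤ 2 * (a + i + 1) * n 0 - n 1 := by
        by_contra! hneg
        exact absurd h3' (mul_pos_of_neg_of_neg (by linarith) hneg).not_ge
      nlinarith [mul_nonneg hα (sub_nonneg.2 hle)]
    · have hle : (i + 1 : ℝ) ≤ a := by exact_mod_cast hgt
      have : 2 * (a + i + 1) * n 0 - n 1 ≤ 0 := by
        by_contra! hpos
        exact absurd h3' (mul_pos (by linarith) hpos).not_ge
      nlinarith [mul_nonneg hα (sub_nonneg.2 hle)]
  have h0 : n 0 = 0 := le_antisymm hα' hα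
  rw [h0] at h1' h2'
  exact hn (ext_coord h0 (by simp; linarith))

/-- At a reflex vertex without chords, the tangent of the parabola bounds a half-disc. -/
theorem hasHalfDisc_reflexVertex {I : Finset Seg} {i : ℕ} (hi : i < M)
    (hI : I ⊆ (zigzag M hM).diagonals) (h : ∀ s ∈ I, reflexVertex i ∉ s) :
    HasHalfDisc ((zigzag M hM).region I) (reflexVertex i) := by
  set P := zigzag M hM with hP
  set v := reflexVertex i with hv
  have hvP : v ∈ P.verts := reflexVertex_mem_verts hi
  set n : Plane := !₂[1, 2 * (2 * i + 1)] with hn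
  have hn' : ∀ x : Plane, cross n x = x 1 - 2 * (2 * i + 1) * x 0 := fun x => by simp [cross, hn]
  have hn0 : n ≠ 0 := fun h => by
    have := congrArg (fun x : Plane => x 0) h
    simp [hn] at this
  obtain ⟨r, hr, hb⟩ := exists_ball_avoiding (P.finite_edges.union I.finite_toSet) v
  set H := Metric.ball v r ∩ {x | 0 < cross n (x - v)} with hHdef
  have hHpre : IsPreconnected H := ((convex_ball v r).inter (convex_cross_lt n v 0)).isPreconnected
  have hbelow : ∀ p : Plane, cross n (p - v) < 0 → ∀ x ∈ segment ℝ v p, ¬ 0 < cross n (x - v) := by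
    intro p hp x hx
    rw [segment_eq_image'] at hx
    obtain ⟨t, ht, rfl⟩ := hx
    rw [add_sub_cancel_left, cross_smul, not_lt]
    exact mul_nonpos_of_nonneg_of_nonpos ht.1 hp.le
  have hHc : H ⊆ P.curveᶜ := by
    rintro x ⟨hx, hpos⟩ hc
    obtain ⟨s, hs, hxs⟩ := P.exists_edge_of_mem_curve hc
    have hvs := P.mem_of_vertex_mem_carrier hs hvP (hb x hx s (Or.inl hs) hxs)
    rcases mem_zigzag_edges.1 hs with ⟨k, hk, rfl⟩ | rfl
    · rcases Sym2.mem_iff.1 hvs with h' | h' <;> have hk' := zig_injective h'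
      · have hev : Even (k + 1) := ⟨i + 1, by omega⟩
        subst hk'
        refine hbelow _ ?_ x hxs hpos
        rw [hn', PiLp.sub_apply, PiLp.sub_apply, zig_fst, zig_snd_of_even hev, hv, reflexVertex_fst,
          reflexVertex_snd]
        push_cast; nlinarith
      · obtain rfl : k = 2 * i := by omega
        refine hbelow (zig (2 * i)) ?_ x ?_ hpos
        · rw [hn', PiLp.sub_apply, PiLp.sub_apply, zig_fst, zig_snd_of_even (even_two_mul i), hv,
            reflexVertex_fst, reflexVertex_snd]
          push_cast; nlinarith
        · rw [carrier_mk, segment_symm] at hxs; exact hxs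
    · rcases Sym2.mem_iff.1 hvs with h' | h' <;> have hk' := zig_injective h' <;> omega
  set e : Plane := !₂[0, 1] with he
  have he0 : e 0 = 0 := by simp [he]
  have he1 : e 1 = 1 := by simp [he]
  have hlt := reflexVertex_snd_lt hM hi
  obtain ⟨t, ht, ht0, ht1⟩ := (((tendsto_add_smul v e).eventually (Metric.ball_mem_nhds _ hr)).and
      (Ioo_mem_nhdsGT (show (0 : ℝ) < 2 * M * (2 * i + 1) - 2 - (2 * i + 1) ^ 2 by
        linarith))).exists
  have hpH : v + t • e ∈ H := by
    refine ⟨ht, ?_⟩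
    show 0 < cross n _
    rw [add_sub_cancel_left, cross_smul, hn', he0, he1]
    linarith
  have hin : v + t • e ∈ P.inside := by
    refine mem_zigzag_inside ?_ ?_ <;>
      simp only [PiLp.add_apply, PiLp.smul_apply, smul_eq_mul, hv, reflexVertex_fst,
        reflexVertex_snd, he0, he1]
    · nlinarith
    · nlinarith
  refine ⟨n, hn0, r, hr, fun x hx hpos => mem_region.2
    ⟨P.subset_inside hHpre hHc hpH hin ⟨hx, hpos⟩, fun s hs hxs => ?_⟩⟩
  obtain ⟨p, -, -, rfl⟩ := P.exists_eq_of_mem_carrier (P.exists_of_mem_diagonals (hI hs)) hvP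
    (hb x hx s (Or.inr hs) hxs)
  exact h _ hs (Sym2.mem_mk_left _ _)

open Classical in
/-- A non-crossing set of chords between reflex vertices is a convex partition if and only if
every reflex vertex is an end-point of a chord. -/
theorem isConvexPartition_image_reflexChord {F : Finset (ℕ × ℕ)}
    (hF : ∀ p ∈ F, p.1 < p.2 ∧ p.2 < M)
    (hnc : ((F.image reflexChord : Finset Seg) : Set Seg).Pairwise NonCrossing) :
    (zigzag M hM).IsConvexPartition (F.image reflexChord) ↔
      ∀ i < M, ∃ p ∈ F, i = p.1 ∨ i = p.2 := by
  have hsub : F.image reflexChord ⊆ (zigzag M hM).diagonals := by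
    intro s hs
    obtain ⟨p, hp, rfl⟩ := Finset.mem_image.1 hs
    exact reflexChord_mem_diagonals (hF p hp).1 (hF p hp).2
  rw [isConvexPartition_iff _ hsub hnc]
  constructor
  · intro h i hi
    by_contra! hcon
    refine h _ (reflexVertex_mem_verts hi) (hasHalfDisc_reflexVertex hi hsub fun s hs hmem => ?_)
    obtain ⟨p, hp, rfl⟩ := Finset.mem_image.1 hs
    rcases reflexVertex_mem_reflexChord.1 hmem with h' | h'
    exacts [(hcon p hp).1 h', (hcon p hp).2 h']
  · intro h v hv hh
    obtain ⟨k, hk, rfl⟩ := mem_zigzag_verts.1 hv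
    rcases Nat.even_or_odd' k with ⟨i, rfl | rfl⟩
    · exact not_hasHalfDisc_zig_even (even_two_mul i) hk (hh.mono sdiff_subset)
    · have hi : i < M := by omega
      obtain ⟨p, hp, h' | h'⟩ := h i hi
      · refine not_hasHalfDisc_reflexVertex (a := p.2) hi (by have := hF p hp; omega) ?_ hh
        exact Finset.mem_image.2 ⟨p, hp, by rw [reflexChord, h']⟩
      · refine not_hasHalfDisc_reflexVertex (a := p.1) hi (by have := hF p hp; omega) ?_ hh
        exact Finset.mem_image.2 ⟨p, hp, by rw [reflexChord, h', Sym2.eq_swap]⟩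

end SimplePolygon

/-! ### Edge covers, independent sets and the realization of all integers -/

/-- Inclusion and exclusion over the uncovered vertices: the alternating sum over the edge covers
of a graph with vertices `0, …, M - 1` and edge set `E` is, up to sign, the alternating sum over
its independent sets. -/
theorem sum_edgeCovers_eq (M : ℕ) (E : Finset (ℕ × ℕ)) (hE : ∀ p ∈ E, p.1 < M ∧ p.2 < M) :
    ∑ F ∈ E.powerset with ∀ i < M, ∃ p ∈ F, i = p.1 ∨ i = p.2, (-1 : ℤ) ^ F.card =
      (-1) ^ M * ∑ T ∈ (Finset.range M).powerset with ∀ p ∈ E, p.1 ∈ T → p.2 ∉ T,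
        (-1) ^ T.card := by
  set V := Finset.range M with hV
  let U : Finset (ℕ × ℕ) → Finset ℕ := fun F => V.filter fun i => ∀ p ∈ F, i ≠ p.1 ∧ i ≠ p.2
  let A : Finset ℕ → Finset (ℕ × ℕ) := fun S => E.filter fun p => p.1 ∉ S ∧ p.2 ∉ S
  -- `S` runs through the sets of vertices that `F` does not cover, and `A S` is the set of edges
  -- that avoid `S`; summing over `F` first leaves the sets `S` whose complement is independent
  have hL : ∑ F ∈ E.powerset with ∀ i < M, ∃ p ∈ F, i = p.1 ∨ i = p.2, (-1 : ℤ) ^ F.card =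
      ∑ F ∈ E.powerset, ∑ S ∈ (U F).powerset, (-1) ^ F.card * (-1) ^ S.card := by
    rw [Finset.sum_filter]
    refine Finset.sum_congr rfl fun F _ => ?_
    rw [← Finset.mul_sum, Finset.sum_powerset_neg_one_pow_card, mul_ite, mul_one, mul_zero]
    refine if_congr ?_ rfl rfl
    simp only [U, Finset.filter_eq_empty_iff, hV, Finset.mem_range, not_forall, exists_prop,
      not_and_or, not_not]
  have hR : ∑ T ∈ V.powerset with ∀ p ∈ E, p.1 ∈ T → p.2 ∉ T, (-1 : ℤ) ^ M * (-1) ^ T.card =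
      ∑ S ∈ V.powerset, ∑ F ∈ (A S).powerset, (-1) ^ F.card * (-1) ^ S.card := by
    have : ∀ S ∈ V.powerset, ∑ F ∈ (A S).powerset, (-1 : ℤ) ^ F.card * (-1) ^ S.card =
        if A S = ∅ then (-1) ^ S.card else 0 := fun S _ => by
      rw [← Finset.sum_mul, Finset.sum_powerset_neg_one_pow_card, ite_mul, one_mul, zero_mul]
    rw [Finset.sum_congr rfl this, ← Finset.sum_filter]
    refine Finset.sum_nbij' (fun T => V \ T) (fun S => V \ S) ?_ ?_ ?_ ?_ ?_
    · intro T hT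
      obtain ⟨-, hT⟩ := Finset.mem_filter.1 hT
      refine Finset.mem_filter.2 ⟨Finset.mem_powerset.2 Finset.sdiff_subset, ?_⟩
      refine Finset.filter_eq_empty_iff.2 fun p hp hh => ?_
      have h1 := hE p hp
      simp only [hV, Finset.mem_sdiff, Finset.mem_range, h1.1, h1.2, true_and, not_not] at hh
      exact hT p hp hh.1 hh.2
    · intro S hS
      obtain ⟨-, hS⟩ := Finset.mem_filter.1 hS
      refine Finset.mem_filter.2 ⟨Finset.mem_powerset.2 Finset.sdiff_subset, fun p hp h1 h2 => ?_⟩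
      exact Finset.filter_eq_empty_iff.1 hS hp
        ⟨(Finset.mem_sdiff.1 h1).2, (Finset.mem_sdiff.1 h2).2⟩
    · exact fun T hT => Finset.sdiff_sdiff_eq_self
        (Finset.mem_powerset.1 (Finset.mem_filter.1 hT).1)
    · exact fun T hT => Finset.sdiff_sdiff_eq_self
        (Finset.mem_powerset.1 (Finset.mem_filter.1 hT).1)
    · intro T hT
      have hTV := Finset.mem_powerset.1 (Finset.mem_filter.1 hT).1
      have hM : M = (V \ T).card + T.card := by
        rw [Finset.card_sdiff_add_card_eq_card hTV, hV, Finset.card_range]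
      rw [hM, pow_add, mul_assoc, ← mul_pow, neg_one_mul, neg_neg, one_pow, mul_one]
  rw [hL, Finset.mul_sum, hR]
  refine Finset.sum_comm' fun F S => ?_
  simp only [Finset.mem_powerset, U, A]
  constructor
  · rintro ⟨hF, hS⟩
    refine ⟨fun p hp => Finset.mem_filter.2 ⟨hF hp, fun h => ?_, fun h => ?_⟩,
      hS.trans (Finset.filter_subset _ _)⟩
    · exact ((Finset.mem_filter.1 (hS h)).2 p hp).1 rfl
    · exact ((Finset.mem_filter.1 (hS h)).2 p hp).2 rfl
  · rintro ⟨hF, hS⟩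
    refine ⟨hF.trans (Finset.filter_subset _ _), fun i hi => Finset.mem_filter.2 ⟨hS hi, ?_⟩⟩
    refine fun p hp => ⟨?_, ?_⟩ <;> rintro rfl
    · exact (Finset.mem_filter.1 (hF hp)).2.1 hi
    · exact (Finset.mem_filter.1 (hF hp)).2.2 hi

/-- In the path `0, 1, 2, …` with additional edges from `3 * t` to `3 * t + 2`, the lower
neighbours of `m` are the numbers `i` with `lowerEnd m ≤ i < m`. -/
def lowerEnd (m : ℕ) : ℕ := if m % 3 = 2 then m - 2 else m - 1

theorem lowerEnd_le (m : ℕ) : lowerEnd m ≤ m := by unfold lowerEnd; split_ifs <;> omega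

/-- The alternating sum over the independent sets among the first `M` vertices of the graph. -/
def independentSum (M : ℕ) : ℤ :=
  ∑ T ∈ (Finset.range M).powerset with ∀ i ∈ T, ∀ m ∈ T, i < m → i < lowerEnd m, (-1) ^ T.card

/-- The independent sets with largest vertex `m` correspond to the independent sets among the
vertices below all lower neighbours of `m`. -/
theorem independentSum_succ (m : ℕ) :
    independentSum (m + 1) = independentSum m - independentSum (lowerEnd m) := by
  unfold independentSum
  rw [← Finset.sum_filter_add_sum_filter_not _ (m ∈ ·), add_comm, sub_eq_add_neg,
    ← Finset.sum_neg_distrib]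
  congr 1
  · refine Finset.sum_congr (Finset.ext fun T => ?_) fun _ _ => rfl
    simp only [Finset.mem_filter, Finset.mem_powerset]
    constructor
    · rintro ⟨⟨h1, h2⟩, h3⟩
      refine ⟨fun i hi => ?_, h2⟩
      have := Finset.mem_range.1 (h1 hi)
      have : i ≠ m := by rintro rfl; exact h3 hi
      exact Finset.mem_range.2 (by omega)
    · rintro ⟨h1, h2⟩
      exact ⟨⟨h1.trans (Finset.range_mono (by omega)), h2⟩, fun h => by simpa using h1 h⟩
  · refine Finset.sum_nbij' (fun T => T.erase m) (fun T => insert m T) ?_ ?_ ?_ ?_ ?_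
    · intro T hT
      simp only [Finset.mem_filter, Finset.mem_powerset] at hT ⊢
      obtain ⟨⟨h1, h2⟩, h3⟩ := hT
      refine ⟨fun i hi => ?_, fun i hi j hj => h2 i (Finset.mem_of_mem_erase hi) j
        (Finset.mem_of_mem_erase hj)⟩
      obtain ⟨hne, hi⟩ := Finset.mem_erase.1 hi
      have := Finset.mem_range.1 (h1 hi)
      exact Finset.mem_range.2 (h2 i hi m h3 (by omega))
    · intro T hT
      simp only [Finset.mem_filter, Finset.mem_powerset] at hT ⊢
      obtain ⟨h1, h2⟩ := hT
      have hlt : ∀ i ∈ T, i < lowerEnd m := fun i hi => Finset.mem_range.1 (h1 hi)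
      have hle := lowerEnd_le m
      refine ⟨⟨fun i hi => ?_, fun i hi j hj hij => ?_⟩, Finset.mem_insert_self _ _⟩
      · rcases Finset.mem_insert.1 hi with rfl | hi
        · exact Finset.mem_range.2 (by omega)
        · have := hlt i hi
          exact Finset.mem_range.2 (by omega)
      · rcases Finset.mem_insert.1 hi with rfl | hi' <;>
          rcases Finset.mem_insert.1 hj with rfl | hj'
        · exact absurd hij (lt_irrefl _)
        · have := hlt j hj'; omega
        · exact hlt i hi'
        · exact h2 i hi' j hj' hij
    · exact fun T hT => Finset.insert_erase (Finset.mem_filter.1 hT).2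
    · intro T hT
      refine Finset.erase_insert fun h => ?_
      have := Finset.mem_range.1 (Finset.mem_powerset.1 (Finset.mem_filter.1 hT).1 h)
      have := lowerEnd_le m
      omega
    · intro T hT
      rw [← Finset.card_erase_add_one (Finset.mem_filter.1 hT).2, pow_succ]; ring

theorem independentSum_three_mul (k : ℕ) : independentSum (3 * k) = (-1) ^ k * (k + 1) ∧
    independentSum (3 * k + 1) = (-1) ^ k * k := by
  induction k with
  | zero =>
    have h0 : independentSum 0 = 1 := by simp [independentSum, Finset.filter_singleton]
    refine ⟨by simpa using h0, ?_⟩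
    rw [mul_zero, independentSum_succ, show lowerEnd 0 = 0 from rfl]
    simp
  | succ k ih =>
    obtain ⟨h0, h1⟩ := ih
    have e1 : lowerEnd (3 * k + 1) = 3 * k := by unfold lowerEnd; split_ifs <;> omega
    have e2 : lowerEnd (3 * k + 2) = 3 * k := by unfold lowerEnd; split_ifs <;> omega
    have e3 : lowerEnd (3 * k + 3) = 3 * k + 2 := by unfold lowerEnd; split_ifs <;> omega
    have h2 := independentSum_succ (3 * k + 1)
    have h3 := independentSum_succ (3 * k + 2)
    have h4 := independentSum_succ (3 * k + 3)
    rw [e1, h0, h1] at h2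
    rw [e2, h0] at h3
    rw [e3] at h4
    rw [mul_add, mul_one, h4, h3, h2]
    push_cast
    constructor <;> ring

namespace SimplePolygon

variable {M : ℕ} {hM : 2 ≤ M}

open Classical in
/-- Chords between reflex vertices that do not interlace are non-crossing diagonals, and their
convex partitions are the edge covers of the corresponding graph. In `hnest`, for two chords with
`p.2 ≤ q.2`, either `p` lies to the left of `q`, or they are nested one way or the other. -/
theorem χ_zigzag {E : Finset (ℕ × ℕ)} (hE : ∀ p ∈ E, p.1 < p.2 ∧ p.2 < M)
    (hnest : ∀ p ∈ E, ∀ q ∈ E, p.2 ≤ q.2 → p.2 ≤ q.1 ∨ q.1 ≤ p.1 ∨ p.1 ≤ q.1 ∧ p.2 = q.2) :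
    E.image reflexChord ∈ NC (zigzag M hM).diagonals ∧
      χ ((zigzag M hM).diagonals \ E.image reflexChord) =
        ∑ F ∈ E.powerset with ∀ i < M, ∃ p ∈ F, i = p.1 ∨ i = p.2, (-1 : ℤ) ^ F.card := by
  have hpair : ∀ p ∈ E, ∀ q ∈ E, p.2 ≤ q.2 → p ≠ q →
      NonCrossing (reflexChord p) (reflexChord q) := by
    intro p hp q hq hle hne
    rcases hnest p hp q hq hle with h | h | ⟨h, h'⟩
    · exact nonCrossing_of_le (hE p hp).1 (hE q hq).1 h
    · exact (nonCrossing_of_nested (hE p hp).1 h hle hne.symm).symm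
    · exact nonCrossing_of_nested (hE q hq).1 h h'.ge hne
  have hJ : E.image reflexChord ∈ NC (zigzag M hM).diagonals := by
    refine mem_NC.2 ⟨fun s hs => ?_, fun s hs t ht hst => ?_⟩
    · obtain ⟨p, hp, rfl⟩ := Finset.mem_image.1 hs
      exact reflexChord_mem_diagonals (hE p hp).1 (hE p hp).2
    · obtain ⟨p, hp, rfl⟩ := Finset.mem_image.1 hs
      obtain ⟨q, hq, rfl⟩ := Finset.mem_image.1 ht
      have hpq : p ≠ q := fun h => hst (h ▸ rfl)
      rcases le_total p.2 q.2 with h | h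
      · exact hpair p hp q hq h hpq
      · exact (hpair q hq p hp h hpq.symm).symm
  refine ⟨hJ, ?_⟩
  have hsign : (-1 : ℤ) ^ ((zigzag M hM).n + 1) = 1 := by
    rw [zigzag_n, show 2 * M + 1 + 1 = 2 * (M + 1) by ring, pow_mul]; simp
  have hinj : InjOn reflexChord (E : Set (ℕ × ℕ)) :=
    reflexChord_injOn.mono fun p hp => (hE p hp).1
  rw [χ_sdiff_eq_convexSum _ hJ, convexSum, hsign, one_mul]
  symm
  have hnc : ∀ F ⊆ E, ((F.image reflexChord : Finset Seg) : Set Seg).Pairwise NonCrossing :=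
    fun F hF => (mem_NC.1 hJ).2.mono (by exact_mod_cast Finset.image_subset_image hF)
  refine Finset.sum_bij (fun F _ => F.image reflexChord) ?_ ?_ ?_ ?_
  · intro F hF
    obtain ⟨hFE, hcov⟩ := Finset.mem_filter.1 hF
    rw [Finset.mem_powerset] at hFE
    exact mem_NCc.2 ⟨Finset.image_subset_image hFE, hnc F hFE,
      (isConvexPartition_image_reflexChord (fun p hp => hE p (hFE hp)) (hnc F hFE)).2 hcov⟩
  · intro F hF G hG h
    have hF' := Finset.mem_powerset.1 (Finset.mem_filter.1 hF).1
    have hG' := Finset.mem_powerset.1 (Finset.mem_filter.1 hG).1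
    have h' : reflexChord '' (F : Set (ℕ × ℕ)) = reflexChord '' (G : Set (ℕ × ℕ)) := by
      exact_mod_cast congrArg (fun S : Finset Seg => (S : Set Seg)) h
    exact_mod_cast (hinj.image_eq_image_iff (by exact_mod_cast hF') (by exact_mod_cast hG')).1 h'
  · intro I hI
    obtain ⟨hIJ, -, hconv⟩ := mem_NCc.1 hI
    obtain ⟨F, hFE, rfl⟩ := Finset.subset_image_iff.1 hIJ
    have hFE' : F ⊆ E := by exact_mod_cast hFE
    refine ⟨F, Finset.mem_filter.2 ⟨Finset.mem_powerset.2 hFE', ?_⟩, rfl⟩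
    exact (isConvexPartition_image_reflexChord (fun p hp => hE p (hFE' hp)) (hnc F hFE')).1 hconv
  · intro F hF
    have hF' := Finset.mem_powerset.1 (Finset.mem_filter.1 hF).1
    rw [Finset.card_image_of_injOn (hinj.mono (by exact_mod_cast hF'))]

open Classical in
/-- The non-crossing chords between the reflex vertices with indices `i` and `m`, for `i` a lower
neighbour of `m`, realize the alternating sum over the independent sets. -/
theorem exists_χ_eq_independentSum (hM : 2 ≤ M) : ∃ (P : SimplePolygon) (J : Finset Seg),
    J ∈ NC P.diagonals ∧ χ (P.diagonals \ J) = (-1) ^ M * independentSum M := by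
  set E := (Finset.range M ×ˢ Finset.range M).filter fun p =>
    lowerEnd p.2 ≤ p.1 ∧ p.1 < p.2 with hE
  have hmem : ∀ p : ℕ × ℕ, p ∈ E ↔ lowerEnd p.2 ≤ p.1 ∧ p.1 < p.2 ∧ p.2 < M := fun p => by
    simp only [hE, Finset.mem_filter, Finset.mem_product, Finset.mem_range]
    constructor
    · rintro ⟨⟨h1, h2⟩, h3, h4⟩; exact ⟨h3, h4, h2⟩
    · rintro ⟨h3, h4, h2⟩; exact ⟨⟨h4.trans h2, h2⟩, h3, h4⟩
  obtain ⟨h1, h2⟩ := χ_zigzag (hM := hM) (E := E) (fun p hp => ((hmem p).1 hp).2)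
    (by
      rintro ⟨a, b⟩ hp ⟨c, d⟩ hq hle
      have hp' := (hmem _).1 hp
      have hq' := (hmem _).1 hq
      simp only [lowerEnd] at hp' hq' hle ⊢
      split_ifs at hp' hq' <;> omega)
  refine ⟨_, _, h1, ?_⟩
  rw [h2, sum_edgeCovers_eq M E fun p hp => by have := (hmem p).1 hp; omega]
  congr 1
  refine Finset.sum_congr (Finset.filter_congr fun T hT => ?_) fun _ _ => rfl
  rw [Finset.mem_powerset] at hT
  constructor
  · intro h i hi m hm him
    by_contra! hle
    exact h (i, m) ((hmem _).2 ⟨hle, him, Finset.mem_range.1 (hT hm)⟩) hi hm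
  · rintro h p hp h1 h2
    have := (hmem p).1 hp
    have := h _ h1 _ h2 this.2.1
    omega

open Classical in
/-- Every integer is realized. For `l < 0` and `l > 1` the alternating sums over independent sets
suffice; a zigzag polygon without chords, which has no convex partition, realizes `0`, and a
triangle realizes `1`. -/
theorem exists_χ_eq (l : ℤ) : ∃ (P : SimplePolygon) (J : Finset Seg),
    J ∈ NC P.diagonals ∧ χ (P.diagonals \ J) = l := by
  have hsq : ∀ k : ℕ, (-1 : ℤ) ^ k * (-1) ^ k = 1 := fun k => by
    rw [← mul_pow]; simp
  have hcube : ∀ k : ℕ, (-1 : ℤ) ^ (3 * k) = (-1) ^ k := fun k => by rw [pow_mul]; norm_num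
  rcases lt_trichotomy l 0 with hl | rfl | hl
  · obtain ⟨k, rfl⟩ : ∃ k : ℕ, l = -k := ⟨l.natAbs, by omega⟩
    obtain ⟨P, J, hJ, h⟩ := exists_χ_eq_independentSum (M := 3 * k + 1) (by omega)
    refine ⟨P, J, hJ, ?_⟩
    rw [h, (independentSum_three_mul k).2, pow_succ, hcube]
    linear_combination (-(k : ℤ)) * hsq k
  · obtain ⟨h1, h2⟩ := χ_zigzag (M := 2) (hM := le_rfl) (E := ∅) (by simp) (by simp)
    refine ⟨_, _, h1, h2.trans ?_⟩
    refine Finset.sum_eq_zero fun F hF => ?_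
    obtain ⟨hF, hcov⟩ := Finset.mem_filter.1 hF
    obtain ⟨p, hp, -⟩ := hcov 0 (by norm_num)
    simpa using Finset.mem_powerset.1 hF hp
  · rcases (show 1 ≤ l from hl).eq_or_lt with rfl | hl
    · obtain ⟨-, -, Q, -, -, hQ, -⟩ := (zigzag 2 le_rfl).exists_ear (by rw [zigzag_n]; norm_num)
      refine ⟨Q, ∅, mem_NC.2 ⟨Finset.empty_subset _, by simp⟩, ?_⟩
      rw [Q.diagonals_eq_empty hQ, Finset.sdiff_empty, χ_empty]
    · obtain ⟨k, rfl⟩ : ∃ k : ℕ, l = k + 1 := ⟨(l - 1).toNat, by omega⟩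
      obtain ⟨P, J, hJ, h⟩ := exists_χ_eq_independentSum (M := 3 * k) (by omega)
      refine ⟨P, J, hJ, ?_⟩
      rw [h, (independentSum_three_mul k).1, hcube]
      linear_combination ((k : ℤ) + 1) * hsq k

end SimplePolygon

end

open Classical Seg in
theorem theorem2 :
    (∀ (P : SimplePolygon) (J : Finset Seg), J ∈ NC P.diagonals →
      -- the main formula
      χ (P.diagonals \ J) = (-1) ^ (P.n + 1) * ∑ I ∈ P.NCc J, (-1) ^ I.card ∧
      -- (1)
      (J ∈ P.NCnc P.diagonals → χ (P.diagonals \ J) = 0) ∧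
      -- (2)
      (J ∈ P.NCc P.diagonals →
        -- (a)
        (∀ J' : Finset Seg, P.minimalNCc J = {J'} →
          χ (P.diagonals \ J) = if J' = J then (-1) ^ (P.n + 1 + J.card) else 0) ∧
        -- (b)
        ((P.minimalNCc J).sup id ≠ J → χ (P.diagonals \ J) = 0) ∧
        -- (c)
        (∀ J' : Finset Seg, (∀ I ∈ P.NCc J, J' ⊆ I) →
          (∃ Q : Fin (J'.card + 1) → SimplePolygon, P.IsDivision J' Q) ∧
          ∀ (m : ℕ) (Q : Fin m → SimplePolygon), P.IsDivision J' Q →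
            m = J'.card + 1 ∧
            χ (P.diagonals \ J) = ∏ k, χ ((Q k).diagonals \ J)))) ∧
    -- (3)
    (∀ l : ℤ, ∃ (P : SimplePolygon) (J : Finset Seg),
      J ∈ NC P.diagonals ∧ χ (P.diagonals \ J) = l) := by
  refine ⟨fun P J hJ => ⟨P.χ_sdiff_eq_convexSum hJ, fun hJn => ?_, fun hJc => ⟨?_, ?_, ?_⟩⟩,
    SimplePolygon.exists_χ_eq⟩
  · rw [P.χ_sdiff_eq_convexSum hJ]
    exact SimplePolygon.convexSum_eq_zero_of_notMem hJ fun h => by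
      rw [SimplePolygon.NCnc, Finset.mem_sdiff] at hJn
      have := SimplePolygon.mem_NCc.1 h
      exact hJn.2 (SimplePolygon.mem_NCc.2 ⟨(mem_NC.1 hJ).1, this.2⟩)
  · intro J' hJ'
    rw [P.χ_sdiff_eq_convexSum hJ]
    have hmem : J' ∈ P.NCc J :=
      (SimplePolygon.mem_minimalNCc.1 (by rw [hJ']; exact Finset.mem_singleton_self J')).prop
    split_ifs with h
    · subst h
      exact SimplePolygon.convexSum_of_minimalNCc_eq_singleton_self hJ'
    · obtain ⟨d, hd, hd'⟩ := Finset.exists_of_ssubset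
        ((SimplePolygon.mem_NCc.1 hmem).1.ssubset_of_ne h)
      refine SimplePolygon.convexSum_eq_zero_of_forall_notMem hJ hd fun K hK => ?_
      rw [hJ', Finset.mem_singleton] at hK
      rwa [hK]
  · intro h
    rw [P.χ_sdiff_eq_convexSum hJ]
    have hsub : (P.minimalNCc J).sup id ⊆ J := Finset.sup_le fun K hK =>
      (SimplePolygon.mem_NCc.1 (SimplePolygon.mem_minimalNCc.1 hK).prop).1
    obtain ⟨d, hd, hd'⟩ := Finset.exists_of_ssubset (hsub.ssubset_of_ne h)
    refine SimplePolygon.convexSum_eq_zero_of_forall_notMem hJ hd fun K hK hdK => hd' ?_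
    exact (Finset.le_sup (f := id) hK : K ⊆ _) hdK
  · intro J' hJ'
    have hJc' : J ∈ P.NCc J :=
      SimplePolygon.mem_NCc.2 ⟨Finset.Subset.rfl, (SimplePolygon.mem_NCc.1 hJc).2⟩
    exact SimplePolygon.χ_eq_prod_of_isDivision hJ hJc' hJ'
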